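/- Let $d\ge 0$ be an integer and let $f,g\in\mathcal D'(\mathbb R^d)$ be complex-valued distributions. Suppose that for every $x\in\operatorname{singsupp}(f)\cap\operatorname{singsupp}(g)$ there are test functions $\varphi_f,\varphi_g\in\mathcal D(\mathbb R^d)$ with $\varphi_f(x)\ne0$, $\varphi_g(x)\neq 0$, and numbers $\alpha>0$, $\beta<0$ (all allowed to depend on $x$) such that $\varphi_f f\in\mathcal C^\alpha_c(\mathbb R^d)$, $\varphi_g g\in\mathcal C^\beta_c(\mathbb R^d)$ and $$\alpha+\beta^*_{\varphi_g g}>0 .$$ Then $f$ and $g$ have a unique canonical product $f\cdot g=\Delta^*(f\otimes g)\in\mathcal D'(\mathbb R^d)$. Here the notions are the following. For $r\in\mathbb N$ let $\mathcal B^r$ be the set of test functions $\psi$ with support in the open unit ball and $\|\psi\|_{C^r}\le1$, and for an integer $m\ge0$ let $\mathcal B^r_m$ be the set of those $\psi\in\mathcal B^r$ with $\int y^k\psi(y)\,dy=0$ for all multi-indices $|k|\le m$. Put $\psi_x^\lambda(y)=\lambda^{-d}\psi((x-y)/\lambda)$ and $\psi_x=\psi_x^1$. - For $\alpha>0$, $\mathcal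 C^\alpha_c$ is the set of compactly supported distributions given by a function $F$ of class $C^m$, $m$ being the largest integer $<\alpha$, such that for every compact $K$ there is $C$ with $|F(y)-\sum_{|k|<\alpha}\partial^kF(x)(y-x)^k/k!|\le C|x-y|^\alpha$ for all $x,y\in K$. - For $\beta<0$, $\mathcal C^\beta_c$ is the set of compactly supported distributions $u$ such that for every compact $K$ there is $C$ with $|u(\psi_x^\lambda)|\le C\lambda^\beta$ for all $x\in K$, $\lambda\in(0,1]$, $\psi\in\mathcal B^r$, where $r$ is the smallest integer $>-\beta$. - For $\gamma\le 0$ and $p\in[2,\infty]$, a distribution $u$ is in $B^\gamma_{p,\infty,\mathrm{loc}}(\mathbb R^d)$ if for some integer $r>-\gamma$ (the choice does not matter) and every compact $K$: if $\gamma<0$, $\sup_{n\ge0}2^{n\gamma}\big\|\sup_{\psi\in\mathcal B^r}|u(\psi_x^{2^{-n}})|\big\|_{L^p(K)}<\infty$; if $\gamma=0$, $\big\|\sup_{\psi\in\mathcal B^r}|u(\psi_x)|\big\|_{L^p(K)}+\sup_{n\ge0}\big\|\sup_{\psi\in\mathcal B^r_0}|u(\psi_x^{2^{-n}})|\big\|_{L^p(K)}<\infty$.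 Further, $\beta^*_u=\sup\{\gamma\le0: u\in B^\gamma_{p,\infty,\mathrm{loc}}(\mathbb R^d)\text{ for some }p\in[2,\infty]\}$. - $f\otimes g\in\mathcal D'(\mathbb R^d\times\mathbb R^d)$ is the tensor product, and $h=\Delta^*u$, the pull-back of $u\in\mathcal D'(\mathbb R^d\times\mathbb R^d)$ along the diagonal map $\Delta(x)=(x,x)$, means the extension by continuity of $F\mapsto F\circ\Delta$: for every sequence of test functions $\Theta_n$ on $\mathbb R^d\times\mathbb R^d$ with $\int\Theta_n=1$, $\sup_n\|\Theta_n\|_{L^1}<\infty$ and supports shrinking to $\{0\}$, the functions $(u*\Theta_n)\circ\Delta$ converge to $h$ in $\mathcal D'(\mathbb R^d)$. -/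

import Mathlib

open MeasureTheory Filter TopologicalSpace Topology
open scoped ENNReal ContDiff Distributions

namespace MicrolocalYoung

noncomputable section

/-- Euclidean space `ℝ^d`. -/
abbrev Rd (d : ℕ) : Type := EuclideanSpace ℝ (Fin d)

/-- Real test functions on a whole normed space. -/
abbrev Test (E : Type) [NormedAddCommGroup E] [NormedSpace ℝ E] : Type :=
  𝓓((⊤ : Opens E), ℝ)

/-- Complex test functions on a whole normed space. -/
abbrev CTest (E : Type) [NormedAddCommGroup E] [NormedSpace ℝ E] : Type :=
  𝓓((⊤ : Opens E), ℂ)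

/-- Complex-valued distributions on a whole normed space (Mathlib tests them against real
test functions, which amounts to the same as testing `ℂ`-linearly against complex ones). -/
abbrev Distr (E : Type) [NormedAddCommGroup E] [NormedSpace ℝ E] : Type :=
  𝓓'((⊤ : Opens E), ℂ)

section TestFunctions

variable {E : Type} [NormedAddCommGroup E] [NormedSpace ℝ E]
variable {E' : Type} [NormedAddCommGroup E'] [NormedSpace ℝ E']

/-- The test function `q ↦ Θ (p - q)`. -/
def reflect (Θ : Test E) (p : E) : Test E where
  toFun q := Θ (p - q)
  contDiff' := Θ.contDiff.comp (contDiff_const.sub contDiff_id)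
  hasCompactSupport' := Θ.hasCompactSupport.comp_homeomorph (Homeomorph.subLeft p)
  tsupport_subset' := fun _ _ => trivial

/-- The rescaled test function `y ↦ lam ^ (-dim E) * ψ ((x - y) / lam)`. -/
def rescale (ψ : Test E) (x : E) (lam : ℝ) (hlam : 0 < lam) : Test E where
  toFun y := (lam ^ Module.finrank ℝ E)⁻¹ * ψ (lam⁻¹ • (x - y))
  contDiff' := contDiff_const.mul
    (ψ.contDiff.comp ((contDiff_const.sub contDiff_id).const_smul lam⁻¹))
  hasCompactSupport' := (ψ.hasCompactSupport.comp_homeomorph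
    ((Homeomorph.subLeft x).trans
      (Homeomorph.smulOfNeZero lam⁻¹ (inv_ne_zero hlam.ne')))).mul_left
  tsupport_subset' := fun _ _ => trivial

/-- The tensor product `(x, y) ↦ φ x * ψ y` of two test functions. -/
def tensorTest (φ : Test E) (ψ : Test E') : Test (E × E') where
  toFun p := φ p.1 * ψ p.2
  contDiff' := (φ.contDiff.comp contDiff_fst).mul (ψ.contDiff.comp contDiff_snd)
  hasCompactSupport' := by
    refine HasCompactSupport.intro
      (φ.hasCompactSupport.isCompact.prod ψ.hasCompactSupport.isCompact) ?_
    rintro ⟨x, y⟩ h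
    by_cases hx : x ∈ tsupport φ
    · have hy : y ∉ tsupport ψ := fun hy => h ⟨hx, hy⟩
      simp [image_eq_zero_of_notMem_tsupport hy]
    · simp [image_eq_zero_of_notMem_tsupport hx]
  tsupport_subset' := fun _ _ => trivial

/-- Multiplication `ψ ↦ ψ a` of test functions by a smooth function `a`. -/
def mulCLM (a : E → ℝ) (ha : ContDiff ℝ ∞ a) : Test E →L[ℝ] Test E :=
  TestFunction.limitCLM ℝ
    (fun ψ => (⟨fun x => ψ x * a x, ψ.contDiff.mul ha, ψ.hasCompactSupport.mul_right,
      fun _ _ => trivial⟩ : Test E))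
    (fun _ hK => TestFunction.ofSupportedInCLM ℝ hK ∘L
      ContDiffMapSupportedIn.bilinLeftCLM (ContinuousLinearMap.mul ℝ ℝ) ha)
    (fun _ _ _ => rfl)

theorem contDiff_re (φ : CTest E) : ContDiff ℝ ∞ fun x => (φ x).re :=
  Complex.reCLM.contDiff.comp φ.contDiff

theorem contDiff_im (φ : CTest E) : ContDiff ℝ ∞ fun x => (φ x).im :=
  Complex.imCLM.contDiff.comp φ.contDiff

/-- The product `φ f` of a distribution with a complex test function,
`(φ f)(ψ) = f(φ ψ) = f(ψ Re φ) + i f(ψ Im φ)`. -/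
def localize (φ : CTest E) (f : Distr E) : Distr E where
  toFun ψ := f (mulCLM _ (contDiff_re φ) ψ) + Complex.I * f (mulCLM _ (contDiff_im φ) ψ)
  map_add' ψ χ := by simp only [map_add]; ring
  map_smul' c ψ := by
    simp only [map_smul, RingHom.id_apply, Complex.real_smul]; ring
  cont := (f.continuous.comp (mulCLM _ (contDiff_re φ)).continuous).add
    (continuous_const.mul (f.continuous.comp (mulCLM _ (contDiff_im φ)).continuous))

end TestFunctions

section SingularSupport

variable {d : ℕ}

/-- The singular support: the complement of the largest open set on which `f` is given by
integration against a smooth function. -/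
def singSupp (f : Distr (Rd d)) : Set (Rd d) :=
  {x | ¬ ∃ U : Set (Rd d), IsOpen U ∧ x ∈ U ∧ ∃ F : Rd d → ℂ, ContDiffOn ℝ ∞ F U ∧
    ∀ ψ : Test (Rd d), tsupport ψ ⊆ U → f ψ = ∫ y, (ψ y : ℂ) * F y}

end SingularSupport

section FunctionSpaces

variable {d : ℕ}

/-- Test functions supported in the open unit ball, with `C^r` norm at most one. -/
def unitTests (d r : ℕ) : Set (Test (Rd d)) :=
  {ψ | tsupport ψ ⊆ Metric.ball 0 1 ∧
    ∀ k : ℕ, k ≤ r → ∀ x, ‖iteratedFDeriv ℝ k (ψ : Rd d → ℝ) x‖ ≤ 1}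

/-- The elements of `unitTests d r` whose moments of order at most `m` vanish. -/
def unitTestsMoments (d r m : ℕ) : Set (Test (Rd d)) :=
  {ψ | ψ ∈ unitTests d r ∧
    ∀ k : Fin d → ℕ, ∑ i, k i ≤ m → ∫ x : Rd d, (∏ i, x i ^ k i) * ψ x = 0}

/-- Locally Hölder distributions of exponent `α > 0`: `f` is (integration against) a function `F`
of class `C^m`, where `m = ⌈α⌉ - 1` is the largest integer `< α`, whose Taylor polynomial of
order `m` approximates it up to `O(|x - y|^α)` locally uniformly. -/
def MemHolderPosLoc (α : ℝ) (f : Distr (Rd d)) : Prop :=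
  ∃ F : Rd d → ℂ, ContDiff ℝ ((⌈α⌉₊ - 1 : ℕ) : WithTop ℕ∞) F ∧
    (∀ K : Set (Rd d), IsCompact K → ∃ C : ℝ, ∀ x ∈ K, ∀ y ∈ K,
      ‖F y - ∑ j ∈ Finset.range ⌈α⌉₊,
        ((j.factorial : ℝ)⁻¹) • iteratedFDeriv ℝ j F x (fun _ => y - x)‖ ≤ C * ‖x - y‖ ^ α) ∧
    ∀ ψ : Test (Rd d), f ψ = ∫ y, (ψ y : ℂ) * F y

/-- Locally Hölder distributions of exponent `β < 0`; `⌊-β⌋ + 1` is the smallest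
integer `> -β`. -/
def MemHolderNegLoc (β : ℝ) (g : Distr (Rd d)) : Prop :=
  ∀ K : Set (Rd d), IsCompact K → ∃ C : ℝ, ∀ x ∈ K, ∀ lam : ℝ, ∀ hlam : 0 < lam, lam ≤ 1 →
    ∀ ψ ∈ unitTests d (⌊-β⌋₊ + 1), ‖g (rescale ψ x lam hlam)‖ ≤ C * lam ^ β

/-- Compactly supported Hölder distributions of exponent `α > 0`. -/
def MemHolderPosCompact (α : ℝ) (f : Distr (Rd d)) : Prop :=
  MemHolderPosLoc α f ∧ IsCompact (Distribution.dsupport f)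

/-- Compactly supported Hölder distributions of exponent `β < 0`. -/
def MemHolderNegCompact (β : ℝ) (g : Distr (Rd d)) : Prop :=
  MemHolderNegLoc β g ∧ IsCompact (Distribution.dsupport g)

/-- `x ↦ sup_{ψ ∈ B} |f(ψ_x^{2^{-n}})|`. -/
def scaleSup (f : Distr (Rd d)) (B : Set (Test (Rd d))) (n : ℕ) (x : Rd d) : ℝ≥0∞ :=
  ⨆ ψ ∈ B, ‖f (rescale ψ x ((1 / 2 : ℝ) ^ n) (by positivity))‖ₑ

/-- The quantity `‖ ‖ sup_{ψ ∈ B} |f(ψ_x^{2^{-n}})| / 2^{-nα} ‖_{L^p(K)} ‖_{ℓ^q(ℕ)}`. -/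
def scaleNorm (α : ℝ) (p q : ℝ≥0∞) (f : Distr (Rd d)) (B : Set (Test (Rd d)))
    (K : Set (Rd d)) : ℝ≥0∞ :=
  eLpNorm (fun n : ℕ => eLpNorm
    (fun x => ENNReal.ofReal ((2 : ℝ) ^ ((n : ℝ) * α)) * scaleSup f B n x)
    p (volume.restrict K)) q Measure.count

/-- The local Besov space `B^α_{p,q,loc}(ℝ^d)`. The space does not depend on the choice of
the integer `r > -α`. -/
def MemBesovLoc (α : ℝ) (p q : ℝ≥0∞) (f : Distr (Rd d)) : Prop :=
  ∃ r : ℕ, -α < r ∧ ∀ K : Set (Rd d), IsCompact K →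
    (α < 0 → scaleNorm α p q f (unitTests d r) K < ⊤) ∧
    (0 ≤ α → eLpNorm (scaleSup f (unitTests d r) 0) p (volume.restrict K) +
      scaleNorm α p q f (unitTestsMoments d r ⌊α⌋₊) K < ⊤)

/-- The exponent `β*_g = sup {γ ≤ 0 : g ∈ B^γ_{p,∞,loc} for some p ∈ [2,∞]}`. -/
def betaStar (g : Distr (Rd d)) : ℝ :=
  sSup {γ : ℝ | γ ≤ 0 ∧ ∃ p : ℝ≥0∞, 2 ≤ p ∧ MemBesovLoc γ p ⊤ g}

end FunctionSpaces

section CanonicalProduct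

/-- `u = f ⊗ g`. -/
def IsTensorProduct {d : ℕ} (f g : Distr (Rd d)) (u : Distr (Rd d × Rd d)) : Prop :=
  ∀ φ ψ : Test (Rd d), u (tensorTest φ ψ) = f φ * g ψ

/-- Strict delta sequences: integral one, bounded in `L^1`, supports shrinking to the origin. -/
structure IsDeltaSeq {E : Type} [NormedAddCommGroup E] [NormedSpace ℝ E] [MeasureSpace E]
    (Θ : ℕ → Test E) : Prop where
  integral_eq_one : ∀ n, ∫ p, Θ n p = 1
  bounded : ∃ C : ℝ, ∀ n, ∫ p, ‖Θ n p‖ ≤ C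
  shrinking : ∀ ε : ℝ, 0 < ε → ∀ᶠ n in atTop, tsupport (Θ n) ⊆ Metric.ball 0 ε

/-- The regularization `u * Θ`, a smooth function: `(u * Θ)(p) = u(Θ(p - ·))`. -/
def regularize {E : Type} [NormedAddCommGroup E] [NormedSpace ℝ E]
    (u : Distr E) (Θ : Test E) (p : E) : ℂ :=
  u (reflect Θ p)

/-- `h = Δ^* u`, the pull-back of `u` along the diagonal map `Δ x = (x, x)`. It extends the
pull-back `F ↦ F ∘ Δ` of functions by continuity: for all regularizations `u * Θ_n` of `u`, the
functions `(u * Θ_n) ∘ Δ` converge to `h` in the sense of distributions. -/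
def IsDiagonalPullback {d : ℕ} (u : Distr (Rd d × Rd d)) (h : Distr (Rd d)) : Prop :=
  ∀ Θ : ℕ → Test (Rd d × Rd d), IsDeltaSeq Θ → ∀ ψ : Test (Rd d),
    Tendsto (fun n => ∫ x, (ψ x : ℂ) * regularize u (Θ n) (x, x)) atTop (𝓝 (h ψ))

/-- `h` is the canonical product of `f` and `g`, that is `h = Δ^* (f ⊗ g)`. -/
def IsCanonicalProduct {d : ℕ} (f g h : Distr (Rd d)) : Prop :=
  ∃ u : Distr (Rd d × Rd d), IsTensorProduct f g u ∧ IsDiagonalPullback u h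

end CanonicalProduct

end

end MicrolocalYoung

/-!
A canonical product is unique because `θ_n ⊗ θ_n` is a delta sequence when `θ_n` is, and
regularizing with it gives `(f * θ_n) (g * θ_n)` on the diagonal. Its existence is local: by a
finite cutoff argument it is enough that the regularizations converge when tested on functions
supported near any given point. Where one of the factors is smooth, this is immediate.

Near a point where `f` agrees with a Hölder function `F` of exponent `α` and `g` has Besov
regularity `γ` with `α + γ > 0`, testing `(f ⊗ g) * Θ_n` on the diagonal against `η` amounts to
evaluating `g` at a smearing `H_n` of `η F`. The `H_n` are smooth, converge to `η F`, and are Hölder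
of exponent `α` uniformly in `n`. Let `ρ` be a kernel that reproduces polynomials up to high degree.
Averaging `H_n` with `ρ` at scale `2^{-k}` costs `O(2^{-kα})` in the sup norm, while the averages of
`g` are `O(k 2^{-kγ})` in `L¹`. Since averages at different scales commute, the differences in `k`
of the approximate pairings `⟨g, ρ_k * ρ_k * H_n⟩` factor into these two sizes, so they are
summable, uniformly in `n`; the limits in `k` and in `n` can therefore be interchanged.
-/

namespace MicrolocalYoung

noncomputable section

section CkNorm

variable {E F : Type*} [NormedAddCommGroup E] [NormedSpace ℝ E] [NormedAddCommGroup F]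
  [NormedSpace ℝ F]

/-- The bound `‖φ‖_{C^N} ≤ S` for the norm of uniform convergence of all derivatives of order at
most `N`. -/
def CkNormLE (N : ℕ) (φ : E → F) (S : ℝ) : Prop :=
  ∀ k ≤ N, ∀ x, ‖iteratedFDeriv ℝ k φ x‖ ≤ S

theorem CkNormLE.nonneg {N : ℕ} {φ : E → F} {S : ℝ} (h : CkNormLE N φ S) : 0 ≤ S :=
  (norm_nonneg _).trans (h 0 (Nat.zero_le _) 0)

end CkNorm

section Pairing

variable {E : Type} [NormedAddCommGroup E] [NormedSpace ℝ E]

/-- Complex test functions, unbundled: smooth functions of compact support. -/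
structure IsTest (φ : E → ℂ) : Prop where
  smooth : ContDiff ℝ ∞ φ
  compact : HasCompactSupport φ

namespace IsTest

variable {φ ψ : E → ℂ}

theorem continuous (h : IsTest φ) : Continuous φ := h.smooth.continuous

theorem add (h : IsTest φ) (h' : IsTest ψ) : IsTest fun x => φ x + ψ x :=
  ⟨h.smooth.add h'.smooth, h.compact.add h'.compact⟩

theorem sub (h : IsTest φ) (h' : IsTest ψ) : IsTest fun x => φ x - ψ x :=
  ⟨h.smooth.sub h'.smooth, h.compact.sub h'.compact⟩

theorem mul_left (h : IsTest φ) (h' : ContDiff ℝ ∞ ψ) : IsTest fun x => ψ x * φ x :=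
  ⟨h'.mul h.smooth, h.compact.mul_left⟩

theorem mul_right (h : IsTest φ) (h' : ContDiff ℝ ∞ ψ) : IsTest fun x => φ x * ψ x :=
  ⟨h.smooth.mul h', h.compact.mul_right⟩

theorem const_mul (h : IsTest φ) (c : ℂ) : IsTest fun x => c * φ x :=
  h.mul_left contDiff_const

theorem comp_add_right (h : IsTest φ) (c : E) : IsTest fun x => φ (x + c) :=
  ⟨h.smooth.comp (contDiff_id.add contDiff_const),
    h.compact.comp_homeomorph (Homeomorph.addRight c)⟩

theorem ofReal (ψ : Test E) : IsTest fun x => (ψ x : ℂ) :=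
  ⟨Complex.ofRealCLM.contDiff.comp ψ.contDiff,
    ψ.hasCompactSupport.comp_left (g := Complex.ofReal) rfl⟩

theorem zero : IsTest (fun _ : E => (0 : ℂ)) :=
  ⟨contDiff_const, HasCompactSupport.zero⟩

theorem fderiv_apply (h : IsTest φ) (v : E) : IsTest fun x => fderiv ℝ φ x v :=
  ⟨(h.smooth.fderiv_right (m := ∞) (by simp)).clm_apply contDiff_const,
    h.compact.fderiv_apply (𝕜 := ℝ) v⟩

/-- The real test function `L ∘ φ`, bundled; used for the real and the imaginary part of `φ`. -/
def realPart (L : ℂ →L[ℝ] ℝ) (h : IsTest φ) : Test E :=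
  ⟨fun x => L (φ x), L.contDiff.comp h.smooth, h.compact.comp_left (map_zero L), fun _ _ => trivial⟩

@[simp] theorem realPart_apply (L : ℂ →L[ℝ] ℝ) (h : IsTest φ) (x : E) :
    h.realPart L x = L (φ x) := rfl

theorem tsupport_realPart_subset (L : ℂ →L[ℝ] ℝ) (h : IsTest φ) :
    tsupport (h.realPart L) ⊆ tsupport φ :=
  tsupport_comp_subset (map_zero L) φ

theorem ckNormLE_realPart {L : ℂ →L[ℝ] ℝ} (hL : ‖L‖ ≤ 1) (h : IsTest φ) {N : ℕ} {S : ℝ}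
    (hS : CkNormLE N φ S) : CkNormLE N (h.realPart L) S := fun k hk x => by
  change ‖iteratedFDeriv ℝ k (L ∘ φ) x‖ ≤ S
  rw [L.iteratedFDeriv_comp_left h.smooth.contDiffAt (i := k) (mod_cast le_top)]
  exact (L.norm_compContinuousMultilinearMap_le _).trans
    ((mul_le_of_le_one_left (norm_nonneg _) hL).trans (hS k hk x))

end IsTest

open Classical in
/-- The complex linear extension of a distribution to complex test functions; the junk value on
functions that are not test functions is `0`. -/
def pair (g : Distr E) (φ : E → ℂ) : ℂ :=
  if h : IsTest φ then g (h.realPart Complex.reCLM) + Complex.I * g (h.realPart Complex.imCLM)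
  else 0

theorem pair_eq (g : Distr E) {φ : E → ℂ} (h : IsTest φ) :
    pair g φ = g (h.realPart Complex.reCLM) + Complex.I * g (h.realPart Complex.imCLM) := by
  rw [pair, dif_pos h]

theorem pair_ofReal (g : Distr E) (ψ : Test E) : pair g (fun x => (ψ x : ℂ)) = g ψ := by
  have hre : (IsTest.ofReal ψ).realPart Complex.reCLM = ψ := by ext x; simp
  have him : (IsTest.ofReal ψ).realPart Complex.imCLM = 0 := by ext x; simp
  rw [pair_eq g (IsTest.ofReal ψ), hre, him, map_zero, mul_zero, add_zero]

theorem pair_add (g : Distr E) {φ ψ : E → ℂ} (h : IsTest φ) (h' : IsTest ψ) :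
    pair g (fun x => φ x + ψ x) = pair g φ + pair g ψ := by
  have hadd (L : ℂ →L[ℝ] ℝ) : (h.add h').realPart L = h.realPart L + h'.realPart L := by
    ext x; simp
  rw [pair_eq g h, pair_eq g h', pair_eq g (h.add h'), hadd, hadd, map_add, map_add]
  ring

theorem pair_const_mul (g : Distr E) {φ : E → ℂ} (h : IsTest φ) (c : ℂ) :
    pair g (fun x => c * φ x) = c * pair g φ := by
  have hre : (h.const_mul c).realPart Complex.reCLM =
      c.re • h.realPart Complex.reCLM - c.im • h.realPart Complex.imCLM := by ext x; simp
  have him : (h.const_mul c).realPart Complex.imCLM =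
      c.re • h.realPart Complex.imCLM + c.im • h.realPart Complex.reCLM := by ext x; simp
  rw [pair_eq g h, pair_eq g (h.const_mul c), hre, him]
  simp only [map_add, map_sub, map_smul, Complex.real_smul]
  conv_rhs => rw [← Complex.re_add_im c]
  linear_combination -(c.im * g (h.realPart Complex.imCLM)) * Complex.I_mul_I

theorem pair_sub (g : Distr E) {φ ψ : E → ℂ} (h : IsTest φ) (h' : IsTest ψ) :
    pair g (fun x => φ x - ψ x) = pair g φ - pair g ψ := by
  rw [eq_sub_iff_add_eq, ← pair_add g (h.sub h') h']
  simp only [sub_add_cancel]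

theorem pair_zero (g : Distr E) : pair g (fun _ => 0) = 0 := by
  simpa using pair_const_mul g (IsTest.zero (E := E)) 0

theorem exists_norm_apply_le (g : Distr E) {K : Set E} (hK : IsCompact K) :
    ∃ N : ℕ, ∃ C : ℝ, 0 ≤ C ∧ ∀ φ : Test E, tsupport φ ⊆ K → ∀ S : ℝ, CkNormLE N φ S →
      ‖g φ‖ ≤ C * S := by
  let K' : Compacts E := ⟨K, hK⟩
  have hK' : (K' : Set E) ⊆ (⊤ : Opens E) := fun _ _ => trivial
  let q : Seminorm ℝ 𝓓_{K'}(E, ℝ) := (normSeminorm ℝ ℂ).comp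
    (g.toLinearMap ∘ₗ (TestFunction.ofSupportedInCLM ℝ hK').toLinearMap)
  have hq : Continuous q :=
    (g.continuous.comp (TestFunction.ofSupportedInCLM ℝ hK').continuous).norm
  obtain ⟨s, C, -, h⟩ := Seminorm.bound_of_continuous
    (ContDiffMapSupportedIn.withSeminorms ℝ E ℝ ⊤ K') q hq
  refine ⟨s.sup id, C, C.2, fun φ hφ S hS => ?_⟩
  let φ' : 𝓓_{K'}(E, ℝ) := .of_support_subset φ.contDiff ((subset_tsupport _).trans hφ)
  have hgφ : ‖g φ‖ ≤ C * (s.sup (ContDiffMapSupportedIn.seminorm ℝ E ℝ ⊤ K')) φ' := h φ'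
  refine hgφ.trans
    (mul_le_mul_of_nonneg_left (Seminorm.finset_sup_apply_le hS.nonneg fun i hi => ?_) C.2)
  exact (ContDiffMapSupportedIn.seminorm_top_le_iff ℝ hS.nonneg i φ').2
    fun x _ => hS i (Finset.le_sup (f := id) hi) x

theorem exists_norm_pair_le (g : Distr E) {K : Set E} (hK : IsCompact K) :
    ∃ N : ℕ, ∃ C : ℝ, 0 ≤ C ∧ ∀ φ : E → ℂ, IsTest φ → tsupport φ ⊆ K → ∀ S : ℝ, CkNormLE N φ S →
      ‖pair g φ‖ ≤ C * S := by
  obtain ⟨N, C, hC, hg⟩ := exists_norm_apply_le g hK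
  refine ⟨N, C + C, by positivity, fun φ hφ hsupp S hS => ?_⟩
  have hpart (L : ℂ →L[ℝ] ℝ) (hL : ‖L‖ ≤ 1) : ‖g (hφ.realPart L)‖ ≤ C * S :=
    hg _ ((hφ.tsupport_realPart_subset L).trans hsupp) S (hφ.ckNormLE_realPart hL hS)
  calc ‖pair g φ‖ ≤ ‖g (hφ.realPart Complex.reCLM)‖ + ‖g (hφ.realPart Complex.imCLM)‖ := by
        rw [pair_eq g hφ]
        exact (norm_add_le _ _).trans_eq (by rw [norm_mul, Complex.norm_I, one_mul])
    _ ≤ (C + C) * S := by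
        rw [add_mul]
        exact add_le_add (hpart _ (by simp)) (hpart _ (by simp))

/-- The distribution given by a linear functional that is of finite order on compact sets. -/
def mkDistr (T : Test E → ℂ) (hadd : ∀ φ ψ, T (φ + ψ) = T φ + T ψ)
    (hsmul : ∀ (c : ℝ) φ, T (c • φ) = c • T φ)
    (hbound : ∀ K : Set E, IsCompact K → ∃ N : ℕ, ∃ C : ℝ, 0 ≤ C ∧ ∀ φ : Test E, tsupport φ ⊆ K →
      ∀ S : ℝ, CkNormLE N φ S → ‖T φ‖ ≤ C * S) : Distr E :=
  TestFunction.mkCLM ℝ T hadd hsmul fun K hK => by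
    refine (ContDiffMapSupportedIn.mkCLMtoNormedSpace (𝕜 := ℝ)
      (fun φ => T (TestFunction.ofSupportedIn hK φ))
      (fun φ ψ => hadd (TestFunction.ofSupportedIn hK φ) (TestFunction.ofSupportedIn hK ψ))
      (fun c φ => hsmul c (TestFunction.ofSupportedIn hK φ)) ?_).continuous
    obtain ⟨N, C, hC, h⟩ := hbound K K.isCompact
    refine ⟨Finset.range (N + 1), C, hC, fun φ => h _ φ.tsupport_subset _ fun k hk x => ?_⟩
    refine (ContDiffMapSupportedIn.norm_iteratedFDeriv_apply_le_seminorm_top ℝ (f := φ)).trans ?_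
    exact Seminorm.le_finset_sup_apply (Finset.mem_range.2 (by omega))

@[simp] theorem mkDistr_apply (T : Test E → ℂ) (hadd hsmul hbound) (φ : Test E) :
    mkDistr T hadd hsmul hbound φ = T φ := rfl

end Pairing

section IteratedDerivatives

variable {E F : Type*} [NormedAddCommGroup E] [NormedSpace ℝ E] [NormedAddCommGroup F]
  [NormedSpace ℝ F]

theorem contDiff_iteratedFDeriv {φ : E → F} (h : ContDiff ℝ ∞ φ) (k : ℕ) :
    ContDiff ℝ ∞ (iteratedFDeriv ℝ k φ) :=
  h.iteratedFDeriv_right (m := ∞)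
    (by exact_mod_cast (le_top : (⊤ : ℕ∞) + (k : ℕ∞) ≤ ⊤))

theorem norm_iteratedFDeriv_fderiv_apply_le {φ : E → F} (h : ContDiff ℝ ∞ φ) (v x : E) (k : ℕ) :
    ‖iteratedFDeriv ℝ k (fun y => fderiv ℝ φ y v) x‖ ≤ ‖iteratedFDeriv ℝ (k + 1) φ x‖ * ‖v‖ := by
  refine ContinuousMultilinearMap.opNorm_le_bound (by positivity) fun m => ?_
  rw [iteratedFDeriv_clm_apply_const_apply (n := ∞) (h.fderiv_right (m := ∞) (by simp))
    (mod_cast le_top), ← norm_iteratedFDeriv_fderiv]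
  calc _ ≤ ‖iteratedFDeriv ℝ k (fderiv ℝ φ) x m‖ * ‖v‖ := ContinuousLinearMap.le_opNorm _ _
    _ ≤ (‖iteratedFDeriv ℝ k (fderiv ℝ φ) x‖ * ∏ i, ‖m i‖) * ‖v‖ := by
      gcongr; exact ContinuousMultilinearMap.le_opNorm _ _
    _ = _ := by ring

theorem iteratedFDeriv_succ_apply_eq_fderiv_apply {φ : E → F} (h : ContDiff ℝ ∞ φ) (k : ℕ) (x : E)
    (m : Fin (k + 1) → E) :
    iteratedFDeriv ℝ (k + 1) φ x m =
      iteratedFDeriv ℝ k (fun y => fderiv ℝ φ y (m (Fin.last k))) x (Fin.init m) := by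
  rw [iteratedFDeriv_succ_apply_right, ← iteratedFDeriv_clm_apply_const_apply (n := ∞)
    (h.fderiv_right (m := ∞) (by simp)) (mod_cast le_top)]

theorem iteratedFDeriv_fderiv_apply {φ : E → F} (h : ContDiff ℝ ∞ φ) (v : E) (k : ℕ) :
    iteratedFDeriv ℝ k (fun y => fderiv ℝ φ y v)
      = fun x => fderiv ℝ (iteratedFDeriv ℝ k φ) x v := by
  induction k with
  | zero =>
    ext x m
    rw [iteratedFDeriv_zero_apply, iteratedFDeriv_zero_eq_comp, LinearIsometryEquiv.comp_fderiv]
    rfl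
  | succ k ih =>
    ext x m
    have hk := contDiff_iteratedFDeriv h k
    have hd : DifferentiableAt ℝ (fderiv ℝ (iteratedFDeriv ℝ k φ)) x :=
      (hk.fderiv_right (m := ∞) (by simp)).differentiable (by simp) x
    have hsymm : IsSymmSndFDerivAt ℝ (iteratedFDeriv ℝ k φ) x :=
      hk.contDiffAt.isSymmSndFDerivAt (by
        rw [minSmoothness_of_isRCLikeNormedField]
        exact WithTop.coe_le_coe.2 (le_top : (2 : ℕ∞) ≤ ⊤))
    rw [iteratedFDeriv_succ_apply_left, ih, ← fderiv_continuousMultilinear_apply_const_apply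
      ((contDiff_iteratedFDeriv h (k + 1)).differentiable (by simp) x)]
    simp_rw [iteratedFDeriv_succ_apply_left]
    rw [fderiv_clm_apply hd (differentiableAt_const v),
      fderiv_continuousMultilinear_apply_const_apply (hd.clm_apply (differentiableAt_const _)),
      fderiv_clm_apply hd (differentiableAt_const (m 0))]
    simp only [fderiv_fun_const, ContinuousLinearMap.flip_apply, Pi.zero_apply,
      ContinuousLinearMap.comp_zero, zero_add]
    rw [hsymm.eq]

theorem exists_norm_sub_sub_fderiv_le {A : E → F} (hA : ContDiff ℝ ∞ A) (hc : HasCompactSupport A) :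
    ∃ C : ℝ, 0 ≤ C ∧ ∀ x h, ‖A (x + h) - A x - fderiv ℝ A x h‖ ≤ C * ‖h‖ ^ 2 := by
  obtain ⟨C, hC⟩ := ContDiff.lipschitzWith_of_hasCompactSupport (𝕂 := ℝ) (n := ∞)
    (hc.fderiv (𝕜 := ℝ)) (hA.fderiv_right (m := ∞) (by simp)) (by simp)
  refine ⟨C, C.2, fun x h => ?_⟩
  have hdiff : ∀ z ∈ Metric.closedBall x ‖h‖, ‖fderiv ℝ A z - fderiv ℝ A x‖ ≤ C * ‖h‖ :=
    fun z hz => (hC.norm_sub_le z x).trans (by gcongr; simpa [dist_eq_norm] using hz)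
  have := (convex_closedBall x ‖h‖).norm_image_sub_le_of_norm_fderiv_le' (𝕜 := ℝ) (y := x + h)
    (fun z _ => (hA.differentiable (by simp)).differentiableAt) hdiff
    (Metric.mem_closedBall_self (norm_nonneg _)) (by simp)
  simpa [pow_two, mul_assoc] using this

theorem iteratedFDeriv_sub_sub_fderiv {φ : E → F} (h : ContDiff ℝ ∞ φ) (v x : E) (k : ℕ) :
    iteratedFDeriv ℝ k (fun y => φ (y + v) - φ y - fderiv ℝ φ y v) x =
      iteratedFDeriv ℝ k φ (x + v) - iteratedFDeriv ℝ k φ x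
        - fderiv ℝ (iteratedFDeriv ℝ k φ) x v := by
  have hshift : ContDiff ℝ k fun y => φ (y + v) :=
    (h.comp (contDiff_id.add contDiff_const)).of_le (mod_cast le_top)
  have hk : ContDiff ℝ k φ := h.of_le (mod_cast le_top)
  have hd : ContDiff ℝ k fun y => fderiv ℝ φ y v :=
    ((h.fderiv_right (m := ∞) (by simp)).clm_apply contDiff_const).of_le (mod_cast le_top)
  calc _ = iteratedFDeriv ℝ k (fun y => φ (y + v) - φ y) x
        - iteratedFDeriv ℝ k (fun y => fderiv ℝ φ y v) x :=
        iteratedFDeriv_sub_apply (hshift.sub hk).contDiffAt hd.contDiffAt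
    _ = _ := by
        rw [← iteratedFDeriv_comp_add_right, iteratedFDeriv_fderiv_apply h]
        exact congrArg (· - _) (iteratedFDeriv_sub_apply hshift.contDiffAt hk.contDiffAt)

theorem exists_ckNormLE_sub_sub_fderiv {φ : E → F} (h : ContDiff ℝ ∞ φ) (hc : HasCompactSupport φ)
    (N : ℕ) :
    ∃ C : ℝ, ∀ v, CkNormLE N (fun y => φ (y + v) - φ y - fderiv ℝ φ y v) (C * ‖v‖ ^ 2) := by
  choose D hD0 hD using fun k =>
    exists_norm_sub_sub_fderiv_le (contDiff_iteratedFDeriv h k) (hc.iteratedFDeriv k)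
  refine ⟨∑ k ∈ Finset.range (N + 1), D k, fun v k hk x => ?_⟩
  rw [iteratedFDeriv_sub_sub_fderiv h]
  refine (hD k x v).trans ?_
  gcongr
  exact Finset.single_le_sum (f := D) (fun i _ => hD0 i) (Finset.mem_range.2 (by omega))

end IteratedDerivatives

section Slices

theorem tsupport_slice_subset {X Y M : Type*} [TopologicalSpace X] [TopologicalSpace Y]
    [T2Space Y] [Zero M] {Φ : X × Y → M} (h : HasCompactSupport Φ)
    (p : X) :
    tsupport (fun z => Φ (p, z)) ⊆ Prod.snd '' tsupport Φ :=
  closure_minimal (fun z hz => ⟨(p, z), subset_tsupport _ hz, rfl⟩)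
    (h.isCompact.image continuous_snd).isClosed

/-- The partial pairing `p ↦ g(Φ(p, ·))` of a distribution with a function of two variables. -/
def partialPair {X E : Type} [NormedAddCommGroup E] [NormedSpace ℝ E] (g : Distr E)
    (Φ : X × E → ℂ) (p : X) : ℂ :=
  pair g fun z => Φ (p, z)

theorem partialPair_eq_zero {X E : Type} [NormedAddCommGroup E] [NormedSpace ℝ E] (g : Distr E)
    {Φ : X × E → ℂ} {p : X} (h : ∀ z, Φ (p, z) = 0) : partialPair g Φ p = 0 := by
  simp only [partialPair, h, pair_zero]

variable {P E : Type} [NormedAddCommGroup P] [NormedSpace ℝ P]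
  [NormedAddCommGroup E] [NormedSpace ℝ E]

theorem iteratedFDeriv_slice {F : Type*} [NormedAddCommGroup F] [NormedSpace ℝ F]
    {Φ : P × E → F} (h : ContDiff ℝ ∞ Φ) (p : P) (z : E) (k : ℕ) :
    iteratedFDeriv ℝ k (fun z => Φ (p, z)) z =
      (iteratedFDeriv ℝ k Φ (p, z)).compContinuousLinearMap
        fun _ => ContinuousLinearMap.inr ℝ P E := by
  have hslice : (fun z => Φ (p, z)) =
      (fun q => Φ ((p, 0) + q)) ∘ ContinuousLinearMap.inr ℝ P E := by
    ext z; simp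
  have hshift : ContDiff ℝ ∞ fun q => Φ ((p, 0) + q) := h.comp (contDiff_const.add contDiff_id)
  rw [hslice, ContinuousLinearMap.iteratedFDeriv_comp_right _ hshift z (i := k) (mod_cast le_top),
    iteratedFDeriv_comp_add_left]
  simp

theorem norm_compContinuousLinearMap_inr_le {F : Type*} [NormedAddCommGroup F] [NormedSpace ℝ F]
    {k : ℕ} (A : (P × E) [×k]→L[ℝ] F) :
    ‖A.compContinuousLinearMap fun _ => ContinuousLinearMap.inr ℝ P E‖ ≤ ‖A‖ :=
  (A.norm_compContinuousLinearMap_le _).trans (mul_le_of_le_one_right (norm_nonneg _)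
    (Finset.prod_le_one (fun _ _ => norm_nonneg _)
      fun _ _ => ContinuousLinearMap.norm_inr_le_one ℝ P E))

theorem CkNormLE.slice {F : Type*} [NormedAddCommGroup F] [NormedSpace ℝ F] {Φ : P × E → F}
    (h : ContDiff ℝ ∞ Φ) {N : ℕ} {S : ℝ} (hS : CkNormLE N Φ S) (p : P) :
    CkNormLE N (fun z => Φ (p, z)) S :=
  fun k hk z => by
    rw [iteratedFDeriv_slice h]
    exact (norm_compContinuousLinearMap_inr_le _).trans (hS k hk _)

theorem IsTest.slice {Φ : P × E → ℂ} (h : IsTest Φ) (p : P) : IsTest fun z => Φ (p, z) :=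
  ⟨h.smooth.comp (contDiff_const.prodMk contDiff_id),
    (h.compact.isCompact.image continuous_snd).of_isClosed_subset (isClosed_tsupport _)
      (tsupport_slice_subset h.compact p)⟩

theorem partialPair_add (g : Distr E) {Φ Ψ : P × E → ℂ} (h : IsTest Φ) (h' : IsTest Ψ) (p : P) :
    partialPair g (fun q => Φ q + Ψ q) p = partialPair g Φ p + partialPair g Ψ p :=
  pair_add g (h.slice p) (h'.slice p)

theorem partialPair_sub (g : Distr E) {Φ Ψ : P × E → ℂ} (h : IsTest Φ) (h' : IsTest Ψ) (p : P) :
    partialPair g (fun q => Φ q - Ψ q) p = partialPair g Φ p - partialPair g Ψ p :=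
  pair_sub g (h.slice p) (h'.slice p)

theorem partialPair_const_mul (g : Distr E) {Φ : P × E → ℂ} (h : IsTest Φ) (c : ℂ) (p : P) :
    partialPair g (fun q => c * Φ q) p = c * partialPair g Φ p :=
  pair_const_mul g (h.slice p) c

theorem exists_norm_partialPair_le (g : Distr E) {K : Set E} (hK : IsCompact K) :
    ∃ N : ℕ, ∃ C : ℝ, 0 ≤ C ∧ ∀ Φ : P × E → ℂ, IsTest Φ → Prod.snd '' tsupport Φ ⊆ K →
      ∀ S : ℝ, CkNormLE N Φ S → ∀ p, ‖partialPair g Φ p‖ ≤ C * S := by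
  obtain ⟨N, C, hC, hg⟩ := exists_norm_pair_le g hK
  exact ⟨N, C, hC, fun Φ h hs S hS p => hg _ (h.slice p)
    ((tsupport_slice_subset h.compact p).trans hs) S (hS.slice h.smooth p)⟩

theorem tsupport_partialPair_subset (g : Distr E) {Φ : P × E → ℂ} (h : IsTest Φ) :
    tsupport (partialPair g Φ) ⊆ Prod.fst '' tsupport Φ := by
  refine closure_minimal (fun p hp => ?_) (h.compact.isCompact.image continuous_fst).isClosed
  by_contra hp'
  exact hp (partialPair_eq_zero g fun z =>
    image_eq_zero_of_notMem_tsupport fun h' => hp' ⟨_, h', rfl⟩)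

variable [FiniteDimensional ℝ P]

/-- The derivative `v ↦ g(∂ᵥΦ(p, ·))` of a partial pairing, `v` pointing in the direction of the
first variable. -/
def partialPairDeriv (g : Distr E) {Φ : P × E → ℂ} (h : IsTest Φ) (p : P) : P →L[ℝ] ℂ :=
  LinearMap.toContinuousLinearMap
    { toFun := fun v => partialPair g (fun q => fderiv ℝ Φ q (v, 0)) p
      map_add' := fun v w => by
        rw [← partialPair_add g (h.fderiv_apply _) (h.fderiv_apply _)]
        simp only [← map_add, Prod.mk_add_mk, add_zero]
      map_smul' := fun c v => by
        rw [RingHom.id_apply, Complex.real_smul, ← partialPair_const_mul g (h.fderiv_apply _)]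
        simp only [← Complex.real_smul, ← map_smul, Prod.smul_mk, smul_zero] }

theorem partialPairDeriv_apply (g : Distr E) {Φ : P × E → ℂ} (h : IsTest Φ) (p v : P) :
    partialPairDeriv g h p v = partialPair g (fun q => fderiv ℝ Φ q (v, 0)) p := rfl

theorem hasFDerivAt_partialPair (g : Distr E) {Φ : P × E → ℂ} (h : IsTest Φ) (p : P) :
    HasFDerivAt (partialPair g Φ) (partialPairDeriv g h p) p := by
  let R (v : P) : P × E → ℂ := fun q => Φ (q + (v, 0)) - Φ q - fderiv ℝ Φ q (v, 0)
  have hR (v : P) : IsTest (R v) := ((h.comp_add_right _).sub h).sub (h.fderiv_apply _)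
  have hpair (v : P) : partialPair g (R v) p =
      partialPair g Φ (p + v) - partialPair g Φ p - partialPairDeriv g h p v := by
    rw [partialPair_sub g ((h.comp_add_right _).sub h) (h.fderiv_apply _),
      partialPair_sub g (h.comp_add_right _) h, partialPairDeriv_apply]
    simp only [partialPair, Prod.mk_add_mk, add_zero]
  have hsupp (v : P) : Prod.snd '' tsupport (R v) ⊆ Prod.snd '' tsupport Φ := by
    have hcl : IsClosed (Prod.snd ⁻¹' (Prod.snd '' tsupport Φ) : Set (P × E)) :=
      (h.compact.isCompact.image continuous_snd).isClosed.preimage continuous_snd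
    refine Set.image_subset_iff.2 (closure_minimal (fun q hq => ?_) hcl)
    by_contra hq'
    have hz : ∀ p', (p', q.2) ∉ tsupport Φ := fun p' hp' => hq' ⟨_, hp', rfl⟩
    refine hq ?_
    simp [R, image_eq_zero_of_notMem_tsupport (hz q.1), show q + (v, 0) = (q.1 + v, q.2) by simp
      [Prod.ext_iff], image_eq_zero_of_notMem_tsupport (hz (q.1 + v)),
      image_eq_zero_of_notMem_tsupport fun h' => hz q.1 (tsupport_fderiv_subset ℝ h')]
  obtain ⟨N, C, -, hC⟩ :=
    exists_norm_partialPair_le (P := P) g (h.compact.isCompact.image continuous_snd)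
  obtain ⟨D, hD⟩ := exists_ckNormLE_sub_sub_fderiv h.smooth h.compact N
  have hbound (v : P) : ‖partialPair g Φ (p + v) - partialPair g Φ p - partialPairDeriv g h p v‖
      ≤ C * D * ‖‖v‖ ^ 2‖ := by
    rw [← hpair, norm_pow, norm_norm, mul_assoc]
    simpa [Prod.norm_def] using hC (R v) (hR v) (hsupp v) _ (hD (v, 0)) p
  exact hasFDerivAt_iff_isLittleO_nhds_zero.2
    ((Asymptotics.IsBigO.of_bound _ (Eventually.of_forall hbound)).trans_isLittleO
      (Asymptotics.isLittleO_norm_pow_id (by norm_num)))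

theorem fderiv_partialPair_apply (g : Distr E) {Φ : P × E → ℂ} (h : IsTest Φ) (p v : P) :
    fderiv ℝ (partialPair g Φ) p v = partialPair g (fun q => fderiv ℝ Φ q (v, 0)) p := by
  rw [(hasFDerivAt_partialPair g h p).fderiv, partialPairDeriv_apply]

theorem contDiff_partialPair (g : Distr E) {Φ : P × E → ℂ} (h : IsTest Φ) :
    ContDiff ℝ ∞ (partialPair g Φ : P → ℂ) := by
  rw [contDiff_infty]
  intro n
  induction n generalizing Φ with
  | zero =>
    exact contDiff_zero.2
      (continuous_iff_continuousAt.2 fun p => (hasFDerivAt_partialPair g h p).continuousAt)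
  | succ n ih =>
    push_cast
    refine contDiff_succ_iff_fderiv_apply.2
      ⟨fun p => (hasFDerivAt_partialPair g h p).differentiableAt, by simp, fun v => ?_⟩
    simp_rw [fderiv_partialPair_apply g h]
    exact ih (h.fderiv_apply (v, 0))

theorem IsTest.partialPair (g : Distr E) {Φ : P × E → ℂ} (h : IsTest Φ) :
    IsTest (partialPair g Φ : P → ℂ) :=
  ⟨contDiff_partialPair g h, (h.compact.isCompact.image continuous_fst).of_isClosed_subset
    (isClosed_tsupport _) (tsupport_partialPair_subset g h)⟩

theorem exists_ckNormLE_partialPair (g : Distr E) {K : Set (P × E)} (hK : IsCompact K) :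
    ∃ N : ℕ, ∃ C : ℝ, 0 ≤ C ∧ ∀ k : ℕ, ∀ Φ : P × E → ℂ, IsTest Φ → tsupport Φ ⊆ K → ∀ S : ℝ,
      CkNormLE (N + k) Φ S → CkNormLE k (partialPair g Φ : P → ℂ) (C * S) := by
  obtain ⟨N, C, hC, hg⟩ := exists_norm_partialPair_le (P := P) g (hK.image continuous_snd)
  suffices hk : ∀ k, ∀ Φ : P × E → ℂ, IsTest Φ → tsupport Φ ⊆ K → ∀ S, CkNormLE (N + k) Φ S →
      ∀ p, ‖iteratedFDeriv ℝ k (partialPair g Φ : P → ℂ) p‖ ≤ C * S from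
    ⟨N, C, hC, fun k Φ h hs S hS j hj => hk j Φ h hs S fun i hi => hS i (by omega)⟩
  intro k
  induction k with
  | zero =>
    intro Φ h hs S hS p
    rw [norm_iteratedFDeriv_zero]
    exact hg Φ h (Set.image_mono hs) S hS p
  | succ k ih =>
    intro Φ h hs S hS p
    have hS0 := hS.nonneg
    refine ContinuousMultilinearMap.opNorm_le_bound (by positivity) fun m => ?_
    set v := m (Fin.last k)
    have hderiv : CkNormLE (N + k) (fun q => fderiv ℝ Φ q (v, 0)) (S * ‖v‖) := fun j hj q => by
      refine (norm_iteratedFDeriv_fderiv_apply_le h.smooth _ _ _).trans ?_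
      rw [show ‖((v, 0) : P × E)‖ = ‖v‖ by simp [Prod.norm_def]]
      gcongr
      exact hS _ (by omega) _
    have hind := ih _ (h.fderiv_apply (v, 0)) ((tsupport_fderiv_apply_subset ℝ _).trans hs) _
      hderiv p
    rw [iteratedFDeriv_succ_apply_eq_fderiv_apply (contDiff_partialPair g h)]
    simp_rw [fderiv_partialPair_apply g h]
    calc _ ≤ C * (S * ‖v‖) * ∏ i, ‖Fin.init m i‖ :=
          (ContinuousMultilinearMap.le_opNorm _ _).trans (by gcongr)
      _ = C * S * ∏ i, ‖m i‖ := by rw [Fin.prod_univ_castSucc]; simp only [Fin.init, v]; ring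

end Slices

section Integrals

theorem tsupport_integral_subset {P E : Type*} [TopologicalSpace P] [MeasureSpace P]
    [TopologicalSpace E] [T2Space E] (H : P → ℂ) {Φ : P × E → ℂ} (h : HasCompactSupport Φ) :
    tsupport (fun z => ∫ p, H p * Φ (p, z)) ⊆ Prod.snd '' tsupport Φ := by
  refine closure_minimal (fun z hz => ?_) (h.isCompact.image continuous_snd).isClosed
  by_contra hz'
  have hΦ (p : P) : Φ (p, z) = 0 := image_eq_zero_of_notMem_tsupport fun h' => hz' ⟨_, h', rfl⟩
  exact hz (by simp [hΦ])

theorem exists_clm_comp_eq_of_norm_le {V Y : Type*} [AddCommGroup V] [Module ℂ V]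
    [NormedAddCommGroup Y] [NormedSpace ℂ Y] (T : V →ₗ[ℂ] Y) (l : V →ₗ[ℂ] ℂ) {C : ℝ}
    (hC : ∀ φ, ‖l φ‖ ≤ C * ‖T φ‖) : ∃ L : Y →L[ℂ] ℂ, ∀ φ, L (T φ) = l φ := by
  have hker : T.ker ≤ l.ker := fun φ hφ => by
    simpa [LinearMap.mem_ker.1 hφ] using hC φ
  let l' : T.range →ₗ[ℂ] ℂ := T.ker.liftQ l hker ∘ₗ T.quotKerEquivRange.symm
  have hl' (φ : V) : l' ⟨T φ, φ, rfl⟩ = l φ := by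
    rw [LinearMap.comp_apply, LinearEquiv.coe_coe, show (⟨T φ, φ, rfl⟩ : T.range) =
      T.quotKerEquivRange (Submodule.Quotient.mk φ) from rfl, LinearEquiv.symm_apply_apply]
    rfl
  have hbound : ∀ y : T.range, ‖l' y‖ ≤ C * ‖y‖ := by
    rintro ⟨_, φ, rfl⟩
    rw [hl']
    exact hC φ
  obtain ⟨L, hL, -⟩ := exists_extension_norm_eq T.range (l'.mkContinuous C hbound)
  exact ⟨L, fun φ => (hL ⟨T φ, φ, rfl⟩).trans (hl' φ)⟩

variable {P E : Type} [NormedAddCommGroup P] [NormedSpace ℝ P]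
  [NormedAddCommGroup E] [NormedSpace ℝ E]

/-- The space of bounded continuous fields of `k`-linear forms, where the derivatives of order `k`
of test functions live. -/
def Jet (E : Type) [NormedAddCommGroup E] [NormedSpace ℝ E] (k : ℕ) : Type :=
  BoundedContinuousFunction E (E [×k]→L[ℝ] ℂ)

instance (k : ℕ) : NormedAddCommGroup (Jet E k) :=
  inferInstanceAs (NormedAddCommGroup (BoundedContinuousFunction E (E [×k]→L[ℝ] ℂ)))

instance (k : ℕ) : NormedSpace ℂ (Jet E k) :=
  inferInstanceAs (NormedSpace ℂ (BoundedContinuousFunction E (E [×k]→L[ℝ] ℂ)))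

instance (k : ℕ) : CompleteSpace (Jet E k) :=
  inferInstanceAs (CompleteSpace (BoundedContinuousFunction E (E [×k]→L[ℝ] ℂ)))

/-- Evaluation of a field of `k`-linear forms. -/
def Jet.eval (k : ℕ) (z : E) (m : Fin k → E) : Jet E k →L[ℝ] ℂ :=
  ContinuousMultilinearMap.apply ℝ (fun _ : Fin k => E) ℂ m ∘L BoundedContinuousFunction.evalCLM ℝ z

theorem Jet.ext_eval {k : ℕ} {A B : Jet E k} (h : ∀ z m, Jet.eval k z m A = Jet.eval k z m B) :
    A = B :=
  BoundedContinuousFunction.ext fun z => ContinuousMultilinearMap.ext fun m => h z m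

theorem IsTest.continuous_iteratedFDeriv {φ : E → ℂ} (h : IsTest φ) (k : ℕ) :
    Continuous (iteratedFDeriv ℝ k φ) :=
  h.smooth.continuous_iteratedFDeriv (mod_cast le_top)

/-- The derivative of order `k` of a test function, as a bounded continuous function. -/
def IsTest.jet {φ : E → ℂ} (h : IsTest φ) (k : ℕ) : Jet E k :=
  BoundedContinuousFunction.ofNormedAddCommGroup (iteratedFDeriv ℝ k φ)
    (h.continuous_iteratedFDeriv k)
    ((h.continuous_iteratedFDeriv k).bounded_above_of_compact_support
      (h.compact.iteratedFDeriv k)).choose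
    ((h.continuous_iteratedFDeriv k).bounded_above_of_compact_support
      (h.compact.iteratedFDeriv k)).choose_spec

theorem IsTest.ckNormLE_of_norm_jet_le {φ : E → ℂ} (h : IsTest φ) {N : ℕ} {S : ℝ}
    (hS : ∀ k ≤ N, ‖h.jet k‖ ≤ S) : CkNormLE N φ S := fun k hk z =>
  (BoundedContinuousFunction.norm_coe_le_norm (β := E [×k]→L[ℝ] ℂ) (h.jet k) z).trans (hS k hk)

theorem IsTest.jet_add {φ ψ : E → ℂ} (h : IsTest φ) (h' : IsTest ψ) (k : ℕ) :
    (h.add h').jet k = h.jet k + h'.jet k :=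
  BoundedContinuousFunction.ext fun _ =>
    iteratedFDeriv_add_apply (h.smooth.contDiffAt.of_le (mod_cast le_top))
      (h'.smooth.contDiffAt.of_le (mod_cast le_top))

theorem IsTest.jet_const_mul {φ : E → ℂ} (h : IsTest φ) (c : ℂ) (k : ℕ) :
    (h.const_mul c).jet k = c • h.jet k :=
  BoundedContinuousFunction.ext fun _ =>
    iteratedFDeriv_const_smul_apply (𝕜 := ℝ) (h.smooth.contDiffAt.of_le (mod_cast le_top)) (a := c)

theorem continuous_jet_slice {Φ : P × E → ℂ} (h : IsTest Φ) (k : ℕ) :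
    Continuous fun p => (h.slice p).jet k := by
  obtain ⟨C, hC⟩ := ContDiff.lipschitzWith_of_hasCompactSupport (𝕂 := ℝ) (n := ∞)
    (h.compact.iteratedFDeriv k) (contDiff_iteratedFDeriv h.smooth k) (by simp)
  refine (LipschitzWith.of_dist_le_mul (K := C) fun p p' =>
    (BoundedContinuousFunction.dist_le (by positivity)).2 fun z => ?_).continuous
  change dist (iteratedFDeriv ℝ k (fun z => Φ (p, z)) z)
    (iteratedFDeriv ℝ k (fun z => Φ (p', z)) z) ≤ C * dist p p'
  rw [iteratedFDeriv_slice h.smooth, iteratedFDeriv_slice h.smooth, dist_eq_norm]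
  calc _ ≤ ‖iteratedFDeriv ℝ k Φ (p, z) - iteratedFDeriv ℝ k Φ (p', z)‖ :=
        norm_compContinuousLinearMap_inr_le (_ - _)
    _ ≤ C * ‖(p, z) - (p', z)‖ := hC.norm_sub_le _ _
    _ = C * dist p p' := by simp [Prod.norm_def, dist_eq_norm]

/-- The space of test functions supported in `K`. -/
def testsIn (K : Set E) : Submodule ℂ (E → ℂ) where
  carrier := {φ | IsTest φ ∧ tsupport φ ⊆ K}
  zero_mem' := ⟨.zero, by simp [tsupport]⟩
  add_mem' := fun {φ ψ} h h' =>
    ⟨h.1.add h'.1, (tsupport_add φ ψ).trans (Set.union_subset h.2 h'.2)⟩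
  smul_mem' := fun c _ h => ⟨h.1.const_mul c, (tsupport_mul_subset_right).trans h.2⟩

theorem exists_pair_eq_clm_jet (g : Distr E) {K : Set E} (hK : IsCompact K) :
    ∃ N : ℕ, ∃ L : (∀ k : Fin N, Jet E k) →L[ℂ] ℂ, ∀ φ : E → ℂ, ∀ h : IsTest φ, tsupport φ ⊆ K →
      pair g φ = L fun k => h.jet k := by
  obtain ⟨N, C, -, hg⟩ := exists_norm_pair_le g hK
  let T : testsIn K →ₗ[ℂ] ∀ k : Fin (N + 1), Jet E k :=
    { toFun := fun φ k => φ.2.1.jet k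
      map_add' := fun φ ψ => funext fun k => IsTest.jet_add φ.2.1 ψ.2.1 k
      map_smul' := fun c φ => funext fun k => IsTest.jet_const_mul φ.2.1 c k }
  let l : testsIn K →ₗ[ℂ] ℂ :=
    { toFun := fun φ => pair g φ
      map_add' := fun φ ψ => pair_add g φ.2.1 ψ.2.1
      map_smul' := fun c φ => pair_const_mul g φ.2.1 c }
  have hT (φ : testsIn K) : CkNormLE N φ.1 ‖T φ‖ := φ.2.1.ckNormLE_of_norm_jet_le fun k hk =>
    norm_le_pi_norm (T φ) ⟨k, by omega⟩
  obtain ⟨L, hL⟩ := exists_clm_comp_eq_of_norm_le T l fun φ => hg _ φ.2.1 φ.2.2 _ (hT φ)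
  exact ⟨N + 1, L, fun φ h hφ => (hL ⟨φ, h, hφ⟩).symm⟩

theorem IsTest.comp_swap {Φ : P × E → ℂ} (h : IsTest Φ) : IsTest fun q : E × P => Φ (q.2, q.1) :=
  ⟨h.smooth.comp (contDiff_snd.prodMk contDiff_fst),
    h.compact.comp_homeomorph (Homeomorph.prodComm E P)⟩

theorem IsTest.slice_left {Φ : P × E → ℂ} (h : IsTest Φ) (z : E) : IsTest fun p => Φ (p, z) :=
  h.comp_swap.slice z

theorem fderiv_comp_swap {Φ : P × E → ℂ} (h : IsTest Φ) (p : P) (z v : E) :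
    fderiv ℝ (fun q : E × P => Φ (q.2, q.1)) (z, p) (v, 0) = fderiv ℝ Φ (p, z) (0, v) := by
  have hswap : HasFDerivAt (fun q : E × P => (q.2, q.1))
      ((ContinuousLinearMap.snd ℝ E P).prod (ContinuousLinearMap.fst ℝ E P)) (z, p) :=
    hasFDerivAt_snd.prodMk hasFDerivAt_fst
  have hΦ : DifferentiableAt ℝ Φ (p, z) := h.smooth.differentiable (by simp) (p, z)
  refine (DFunLike.congr_fun (HasFDerivAt.comp (z, p) (g := Φ) hΦ.hasFDerivAt hswap).fderiv
    (v, 0)).trans ?_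
  simp

theorem fderiv_slice {Φ : P × E → ℂ} (h : IsTest Φ) (p : P) (z v : E) :
    fderiv ℝ (fun z => Φ (p, z)) z v = fderiv ℝ Φ (p, z) (0, v) := by
  have hΦ : DifferentiableAt ℝ Φ (p, z) := h.smooth.differentiable (by simp) (p, z)
  refine (DFunLike.congr_fun
    (HasFDerivAt.comp z (g := Φ) hΦ.hasFDerivAt (hasFDerivAt_prodMk_right p z)).fderiv v).trans ?_
  simp

variable [MeasureSpace P] [BorelSpace P] [IsLocallyFiniteMeasure (volume : Measure P)]

theorem integrable_mul_of_isTest {H φ : P → ℂ} (hH : Continuous H) (h : IsTest φ) :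
    Integrable fun x => H x * φ x :=
  (hH.mul h.continuous).integrable_of_hasCompactSupport h.compact.mul_left

/-- The distribution given by a continuous function. -/
def ofFun (H : P → ℂ) : Distr P :=
  TestFunction.integralAgainstBilinCLM (ContinuousLinearMap.lsmul ℝ ℝ) volume H

theorem ofFun_apply {H : P → ℂ} (hH : Continuous H) (φ : Test P) :
    ofFun H φ = ∫ x, (φ x : ℂ) * H x := by
  refine (TestFunction.integralAgainstBilinCLM_eq_integral
    (hH.locallyIntegrable.locallyIntegrableOn _)).trans ?_
  simp

theorem pair_eq_integral_of_forall {f : Distr P} {H : P → ℂ} (hH : Continuous H)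
    {φ : P → ℂ} (h : IsTest φ)
    (hf : ∀ ψ : Test P, tsupport ψ ⊆ tsupport φ → f ψ = ∫ x, (ψ x : ℂ) * H x) :
    pair f φ = ∫ x, H x * φ x := by
  have hint (L : ℂ →L[ℝ] ℝ) : Integrable fun x => (h.realPart L x : ℂ) * H x := by
    simp_rw [mul_comm _ (H _)]
    exact integrable_mul_of_isTest hH (IsTest.ofReal _)
  rw [pair_eq _ h, hf _ (h.tsupport_realPart_subset _), hf _ (h.tsupport_realPart_subset _),
    ← integral_const_mul, ← integral_add (hint _) ((hint _).const_mul _)]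
  congr 1 with x
  simp only [IsTest.realPart_apply, Complex.reCLM_apply, Complex.imCLM_apply]
  conv_rhs => rw [← Complex.re_add_im (φ x)]
  ring

theorem pair_ofFun {H : P → ℂ} (hH : Continuous H) {φ : P → ℂ} (h : IsTest φ) :
    pair (ofFun H) φ = ∫ x, H x * φ x :=
  pair_eq_integral_of_forall hH h fun ψ _ => ofFun_apply hH ψ

theorem integral_mul_eq_partialPair {H : P → ℂ} (hH : Continuous H) {Φ : P × E → ℂ}
    (h : IsTest Φ) :
    (fun z => ∫ p, H p * Φ (p, z)) = partialPair (ofFun H) fun q : E × P => Φ (q.2, q.1) :=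
  funext fun z => (pair_ofFun hH (h.slice_left z)).symm

theorem integrable_smul_jet_slice {H : P → ℂ} (hH : Continuous H) {Φ : P × E → ℂ} (h : IsTest Φ)
    (k : ℕ) : Integrable fun p => H p • (h.slice p).jet k := by
  refine (hH.smul (continuous_jet_slice h k)).integrable_of_hasCompactSupport
    (HasCompactSupport.intro (h.compact.isCompact.image continuous_fst) fun p hp => ?_)
  have hΦ : (fun z => Φ (p, z)) = 0 :=
    funext fun z => image_eq_zero_of_notMem_tsupport fun h' => hp ⟨_, h', rfl⟩
  have hjet : (h.slice p).jet k = 0 := BoundedContinuousFunction.ext fun z => by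
    change iteratedFDeriv ℝ k (fun z => Φ (p, z)) z = 0
    rw [hΦ]
    exact congrFun iteratedFDeriv_fun_zero z
  exact (congrArg (H p • ·) hjet).trans (smul_zero _)

variable [FiniteDimensional ℝ E]

theorem isTest_integral {H : P → ℂ} (hH : Continuous H) {Φ : P × E → ℂ} (h : IsTest Φ) :
    IsTest fun z => ∫ p, H p * Φ (p, z) := by
  rw [integral_mul_eq_partialPair hH h]
  exact h.comp_swap.partialPair (ofFun H)

theorem fderiv_integral_apply {H : P → ℂ} (hH : Continuous H) {Φ : P × E → ℂ} (h : IsTest Φ)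
    (z v : E) :
    fderiv ℝ (fun z => ∫ p, H p * Φ (p, z)) z v = ∫ p, H p * fderiv ℝ Φ (p, z) (0, v) := by
  rw [integral_mul_eq_partialPair hH h, fderiv_partialPair_apply _ h.comp_swap, partialPair]
  simp_rw [fderiv_comp_swap h]
  exact pair_ofFun hH ((h.fderiv_apply (0, v)).slice_left z)

theorem iteratedFDeriv_integral {H : P → ℂ} (hH : Continuous H) {Φ : P × E → ℂ} (h : IsTest Φ)
    (k : ℕ) (z : E) (m : Fin k → E) :
    iteratedFDeriv ℝ k (fun z => ∫ p, H p * Φ (p, z)) z m =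
      ∫ p, H p * iteratedFDeriv ℝ k (fun z => Φ (p, z)) z m := by
  induction k generalizing Φ with
  | zero => simp
  | succ k ih =>
    rw [iteratedFDeriv_succ_apply_eq_fderiv_apply (isTest_integral hH h).smooth]
    simp_rw [fderiv_integral_apply hH h, ih (h.fderiv_apply (0, m (Fin.last k))),
      iteratedFDeriv_succ_apply_eq_fderiv_apply (h.slice _).smooth, fderiv_slice h]

theorem jet_integral {H : P → ℂ} (hH : Continuous H) {Φ : P × E → ℂ} (h : IsTest Φ) (k : ℕ) :
    (isTest_integral hH h).jet k = ∫ p, H p • (h.slice p).jet k := by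
  refine Jet.ext_eval fun z m => ?_
  rw [← (Jet.eval k z m).integral_comp_comm (integrable_smul_jet_slice hH h k)]
  exact iteratedFDeriv_integral hH h k z m

theorem integral_mul_partialPair (g : Distr E) {H : P → ℂ} (hH : Continuous H) {Φ : P × E → ℂ}
    (h : IsTest Φ) :
    ∫ p, H p * partialPair g Φ p = pair g fun z => ∫ p, H p * Φ (p, z) := by
  obtain ⟨N, L, hL⟩ := exists_pair_eq_clm_jet g (h.compact.isCompact.image continuous_snd)
  have hint (k : Fin N) := integrable_smul_jet_slice hH h k
  calc ∫ p, H p * partialPair g Φ p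
      = ∫ p, L fun k => H p • (h.slice p).jet k := by
        congr 1 with p
        rw [partialPair, hL _ (h.slice p) (tsupport_slice_subset h.compact p), ← smul_eq_mul,
          ← map_smul]
        rfl
    _ = L fun k => ∫ p, H p • (h.slice p).jet k := by
        rw [L.integral_comp_comm (Integrable.of_eval hint)]
        congr 1 with k : 1
        exact eval_integral hint k
    _ = pair g fun z => ∫ p, H p * Φ (p, z) := by
        simp_rw [hL _ (isTest_integral hH h) (tsupport_integral_subset H h.compact),
          jet_integral hH h]

end Integrals

section Tensor

variable {P E : Type} [NormedAddCommGroup P] [NormedSpace ℝ P] [FiniteDimensional ℝ P]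
  [NormedAddCommGroup E] [NormedSpace ℝ E]

theorem IsTest.ckNormLE_ofReal {ψ : Test E} {N : ℕ} {S : ℝ} (h : CkNormLE N ψ S) :
    CkNormLE N (fun x => (ψ x : ℂ)) S := fun k hk x => by
  change ‖iteratedFDeriv ℝ k (Complex.ofRealLI ∘ ψ) x‖ ≤ S
  rw [LinearIsometry.norm_iteratedFDeriv_comp_left _ ψ.contDiff.contDiffAt (mod_cast le_top)]
  exact h k hk x

theorem exists_norm_pair_partialPair_le (f : Distr P) (g : Distr E) {K : Set (P × E)}
    (hK : IsCompact K) :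
    ∃ N : ℕ, ∃ C : ℝ, 0 ≤ C ∧ ∀ Φ : P × E → ℂ, IsTest Φ → tsupport Φ ⊆ K → ∀ S : ℝ,
      CkNormLE N Φ S → ‖pair f (partialPair g Φ)‖ ≤ C * S := by
  obtain ⟨N, C, hC, hg⟩ := exists_ckNormLE_partialPair g hK
  obtain ⟨N', C', hC', hf⟩ := exists_norm_pair_le f (hK.image continuous_fst)
  refine ⟨N + N', C' * C, by positivity, fun Φ h hs S hS => ?_⟩
  rw [mul_assoc]
  exact hf _ (h.partialPair g) ((tsupport_partialPair_subset g h).trans (Set.image_mono hs)) _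
    (hg N' Φ h hs S hS)

/-- The tensor product of two distributions. -/
def tensor (f : Distr P) (g : Distr E) : Distr (P × E) :=
  mkDistr (fun Φ => pair f (partialPair g fun q => (Φ q : ℂ)))
    (fun Φ Ψ => by
      rw [← pair_add f ((IsTest.ofReal Φ).partialPair g) ((IsTest.ofReal Ψ).partialPair g)]
      simp_rw [← partialPair_add g (IsTest.ofReal Φ) (IsTest.ofReal Ψ)]
      simp)
    (fun c Φ => by
      rw [Complex.real_smul, ← pair_const_mul f ((IsTest.ofReal Φ).partialPair g)]
      simp_rw [← partialPair_const_mul g (IsTest.ofReal Φ)]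
      simp)
    (fun K hK => by
      obtain ⟨N, C, hC, hfg⟩ := exists_norm_pair_partialPair_le f g hK
      exact ⟨N, C, hC, fun Φ hΦ S hS => hfg _ (IsTest.ofReal Φ)
        ((tsupport_comp_subset (g := Complex.ofReal) rfl Φ).trans hΦ) S
        (IsTest.ckNormLE_ofReal hS)⟩)

theorem tensor_apply (f : Distr P) (g : Distr E) (Φ : Test (P × E)) :
    tensor f g Φ = pair f (partialPair g fun q => (Φ q : ℂ)) := rfl

end Tensor

theorem isTensorProduct_tensor {d : ℕ} (f g : Distr (Rd d)) :
    IsTensorProduct f g (tensor f g) := fun φ ψ => by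
  have hpair (p : Rd d) :
      partialPair g (fun q => (tensorTest φ ψ q : ℂ)) p = g ψ * φ p := by
    rw [← pair_ofReal g, mul_comm, ← pair_const_mul g (IsTest.ofReal ψ)]
    exact congrArg (pair g) (funext fun z => Complex.ofReal_mul _ _)
  rw [tensor_apply, funext hpair, pair_const_mul f (IsTest.ofReal φ), pair_ofReal, mul_comm]

section Taylor

variable {E F : Type*} [NormedAddCommGroup E] [NormedSpace ℝ E] [NormedAddCommGroup F]
  [NormedSpace ℝ F]

theorem iteratedDeriv_comp_line {n : WithTop ℕ∞} {φ : E → F} (h : ContDiff ℝ n φ) (x w : E) {k : ℕ}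
    (hk : k ≤ n) (t : ℝ) :
    iteratedDeriv k (fun t : ℝ => φ (x + t • w)) t =
      iteratedFDeriv ℝ k φ (x + t • w) fun _ => w := by
  have hline : (fun t : ℝ => φ (x + t • w)) =
      (fun z => φ (x + z)) ∘ ContinuousLinearMap.toSpanSingleton ℝ w := by
    ext t; simp
  have hshift : ContDiff ℝ n fun z => φ (x + z) := h.comp (contDiff_const.add contDiff_id)
  rw [iteratedDeriv_eq_iteratedFDeriv, hline,
    ContinuousLinearMap.iteratedFDeriv_comp_right _ hshift t hk, iteratedFDeriv_comp_add_left]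
  simp

theorem norm_sub_taylor_le {φ : E → F} {m : ℕ} (h : ContDiff ℝ (m + 1) φ) {S : ℝ}
    (hS : ∀ x, ‖iteratedFDeriv ℝ (m + 1) φ x‖ ≤ S) (x w : E) :
    ‖φ (x + w) - ∑ j ∈ Finset.range (m + 1),
      ((j.factorial : ℝ)⁻¹) • iteratedFDeriv ℝ j φ x fun _ => w‖ ≤ S * ‖w‖ ^ (m + 1) := by
  have hS0 : 0 ≤ S := (norm_nonneg _).trans (hS x)
  set u : ℝ → F := fun t => φ (x + t • w)
  have hu : ContDiff ℝ (m + 1) u := h.comp (contDiff_const.add (contDiff_id.smul contDiff_const))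
  have hderiv {k : ℕ} (hk : k ≤ m + 1) {t : ℝ} (ht : t ∈ Set.Icc (0 : ℝ) 1) :
      iteratedDerivWithin k u (Set.Icc 0 1) t = iteratedFDeriv ℝ k φ (x + t • w) fun _ => w := by
    have hk' : (k : WithTop ℕ∞) ≤ m + 1 := mod_cast hk
    rw [iteratedDerivWithin_eq_iteratedDeriv (uniqueDiffOn_Icc one_pos)
      (hu.contDiffAt.of_le hk') ht, iteratedDeriv_comp_line h x w hk']
  have hderiv_le (t : ℝ) (ht : t ∈ Set.Icc (0 : ℝ) 1) :
      ‖iteratedDerivWithin (m + 1) u (Set.Icc 0 1) t‖ ≤ S * ‖w‖ ^ (m + 1) := by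
    rw [hderiv le_rfl ht]
    refine (ContinuousMultilinearMap.le_opNorm _ _).trans ?_
    simp only [Finset.prod_const, Finset.card_univ, Fintype.card_fin]
    gcongr
    exact hS _
  have htaylor : taylorWithinEval u m (Set.Icc 0 1) 0 1 =
      ∑ j ∈ Finset.range (m + 1), ((j.factorial : ℝ)⁻¹) • iteratedFDeriv ℝ j φ x fun _ => w := by
    rw [taylor_within_apply]
    refine Finset.sum_congr rfl fun j hj => ?_
    rw [hderiv (Finset.mem_range.1 hj).le (by simp)]
    simp
  have hrem := taylor_mean_remainder_bound (x := 1) zero_le_one hu.contDiffOn (by simp) hderiv_le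
  rw [htaylor, sub_zero, one_pow, mul_one, show u 1 = φ (x + w) by simp [u]] at hrem
  exact hrem.trans (div_le_self (by positivity) (mod_cast m.factorial_pos))

end Taylor

section RayPolynomials

variable {E : Type} [NormedAddCommGroup E] [NormedSpace ℝ E]

/-- Continuous functions whose restriction to every line through the origin is a polynomial of
degree at most `m`. Taylor polynomials are of this kind, in a form which needs no coordinates and
is stable under products. -/
structure IsRayPoly (m : ℕ) (p : E → ℂ) : Prop where
  continuous : Continuous p
  exists_poly : ∀ w, ∃ P : Polynomial ℂ, P.natDegree ≤ m ∧ ∀ t : ℝ, p (t • w) = P.eval (t : ℂ)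

theorem IsRayPoly.mul {m n : ℕ} {p q : E → ℂ} (hp : IsRayPoly m p) (hq : IsRayPoly n q) :
    IsRayPoly (m + n) fun w => p w * q w := by
  refine ⟨hp.continuous.mul hq.continuous, fun w => ?_⟩
  obtain ⟨P, hPdeg, hP⟩ := hp.exists_poly w
  obtain ⟨Q, hQdeg, hQ⟩ := hq.exists_poly w
  exact ⟨P * Q, Polynomial.natDegree_mul_le.trans (add_le_add hPdeg hQdeg), fun t => by
    rw [hP, hQ, Polynomial.eval_mul]⟩

theorem IsRayPoly.zero (m : ℕ) : IsRayPoly m fun _ : E => (0 : ℂ) :=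
  ⟨continuous_const, fun _ => ⟨0, by simp, by simp⟩⟩

theorem IsRayPoly.comp_smul {m : ℕ} {p : E → ℂ} (hp : IsRayPoly m p) (c : ℝ) :
    IsRayPoly m fun w => p (c • w) := by
  refine ⟨hp.continuous.comp (continuous_const_smul c), fun w => ?_⟩
  obtain ⟨P, hPdeg, hP⟩ := hp.exists_poly (c • w)
  exact ⟨P, hPdeg, fun t => by rw [smul_comm, hP]⟩

theorem isRayPoly_sum (m : ℕ) (c : ℕ → ℝ) (D : ∀ j : ℕ, E [×j]→L[ℝ] ℂ) :
    IsRayPoly m fun w => ∑ j ∈ Finset.range (m + 1), c j • D j fun _ => w := by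
  refine ⟨continuous_finsetSum _ fun j _ => ((D j).cont.comp
    (continuous_pi fun _ => continuous_id)).const_smul (c j), fun w => ?_⟩
  refine ⟨∑ j ∈ Finset.range (m + 1), Polynomial.C (c j • D j fun _ => w) * Polynomial.X ^ j,
    Polynomial.natDegree_sum_le_of_forall_le _ _ fun j hj => ?_, fun t => ?_⟩
  · exact (Polynomial.natDegree_C_mul_X_pow_le _ _).trans (by simpa [Nat.lt_succ_iff] using hj)
  · rw [Polynomial.eval_finsetSum]
    refine Finset.sum_congr rfl fun j _ => ?_
    rw [(D j).map_smul_univ (fun _ => t) fun _ => w]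
    simp
    ring

/-- `H` is approximated at `x` by a ray polynomial of degree `m`, to order `α`, with constant `A`:
a local form of the Hölder condition which keeps the constants and is stable under products. -/
def ApproxAt (α : ℝ) (m : ℕ) (A : ℝ) (H : E → ℂ) (x : E) : Prop :=
  ∃ p : E → ℂ, IsRayPoly m p ∧ (∀ w, ‖w‖ ≤ 1 → ‖p w‖ ≤ A) ∧
    ∀ w, ‖w‖ ≤ 1 → ‖H (x + w) - p w‖ ≤ A * ‖w‖ ^ α

theorem eq_of_norm_sub_le_mul_rpow {E : Type} [NormedAddCommGroup E] {α A : ℝ} (hα : 0 < α)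
    {H p : E → ℂ} {x : E} (hH : ∀ w, ‖w‖ ≤ 1 → ‖H (x + w) - p w‖ ≤ A * ‖w‖ ^ α) : H x = p 0 := by
  have hzero := hH 0 (by simp)
  rwa [norm_zero, Real.zero_rpow hα.ne', mul_zero, norm_le_zero_iff, sub_eq_zero, add_zero]
    at hzero

variable {α : ℝ} {m n : ℕ} {A B : ℝ} {H G : E → ℂ} {x : E}

theorem ApproxAt.nonneg (h : ApproxAt α m A H x) : 0 ≤ A := by
  obtain ⟨p, -, hp, -⟩ := h
  exact (norm_nonneg _).trans (hp 0 (by simp))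

theorem ApproxAt.norm_le (hα : 0 < α) (h : ApproxAt α m A H x) : ‖H x‖ ≤ A := by
  obtain ⟨p, -, hpA, hpH⟩ := h
  rw [eq_of_norm_sub_le_mul_rpow hα hpH]
  exact hpA 0 (by simp)

theorem ApproxAt.mono (h : ApproxAt α m A H x) (hAB : A ≤ B) : ApproxAt α m B H x := by
  obtain ⟨p, hp, hpA, hpH⟩ := h
  exact ⟨p, hp, fun w hw => (hpA w hw).trans hAB, fun w hw => (hpH w hw).trans (by gcongr)⟩

theorem ApproxAt.mul (hα : 0 < α) (hH : ApproxAt α m A H x) (hG : ApproxAt α n B G x) :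
    ApproxAt α (m + n) (3 * A * B) (fun y => H y * G y) x := by
  have hA := hH.nonneg
  have hB := hG.nonneg
  obtain ⟨p, hp, hpA, hpH⟩ := hH
  obtain ⟨q, hq, hqB, hqG⟩ := hG
  refine ⟨_, hp.mul hq, fun w hw => ?_, fun w hw => ?_⟩
  · rw [norm_mul]
    calc ‖p w‖ * ‖q w‖ ≤ A * B := by gcongr <;> [exact hpA w hw; exact hqB w hw]
      _ ≤ 3 * A * B := by nlinarith [mul_nonneg hA hB]
  · have hw1 : ‖w‖ ^ α ≤ 1 := Real.rpow_le_one (norm_nonneg _) hw hα.le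
    have hH2 : ‖H (x + w)‖ ≤ 2 * A :=
      calc ‖H (x + w)‖ = ‖(H (x + w) - p w) + p w‖ := by rw [sub_add_cancel]
        _ ≤ A * ‖w‖ ^ α + A := (norm_add_le _ _).trans (add_le_add (hpH w hw) (hpA w hw))
        _ ≤ 2 * A := by nlinarith
    calc ‖H (x + w) * G (x + w) - p w * q w‖
        = ‖H (x + w) * (G (x + w) - q w) + (H (x + w) - p w) * q w‖ := by ring_nf
      _ ≤ ‖H (x + w)‖ * ‖G (x + w) - q w‖ + ‖H (x + w) - p w‖ * ‖q w‖ :=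
        (norm_add_le _ _).trans_eq (by rw [norm_mul, norm_mul])
      _ ≤ 2 * A * (B * ‖w‖ ^ α) + A * ‖w‖ ^ α * B := by
        gcongr <;> [exact hqG w hw; exact hpH w hw; exact hqB w hw]
      _ = _ := by ring

theorem ApproxAt.comp_add_right {c : E} (h : ApproxAt α m A H (x + c)) :
    ApproxAt α m A (fun y => H (y + c)) x := by
  obtain ⟨p, hp, hpA, hpH⟩ := h
  exact ⟨p, hp, hpA, fun w hw => by simpa only [add_right_comm] using hpH w hw⟩

theorem approxAt_zero (α : ℝ) (m : ℕ) (hA : 0 ≤ A) (h : ∀ w, ‖w‖ ≤ 1 → H (x + w) = 0) :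
    ApproxAt α m A H x :=
  ⟨_, IsRayPoly.zero m, fun w _ => by simpa using hA, fun w hw => by
    rw [h w hw]; simpa using by positivity⟩

theorem norm_inv_factorial_smul_apply_le {j : ℕ} (D : E [×j]→L[ℝ] ℂ) {w : E} (hw : ‖w‖ ≤ 1) :
    ‖((j.factorial : ℝ)⁻¹) • D fun _ => w‖ ≤ ‖D‖ := by
  rw [norm_smul, norm_inv, Real.norm_natCast]
  calc _ ≤ ‖D fun _ => w‖ := mul_le_of_le_one_left (norm_nonneg _)
        (inv_le_one_of_one_le₀ (mod_cast j.factorial_pos))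
    _ ≤ ‖D‖ * ∏ _ : Fin j, ‖w‖ := D.le_opNorm _
    _ ≤ ‖D‖ := mul_le_of_le_one_right (norm_nonneg _)
        (Finset.prod_le_one (fun _ _ => norm_nonneg _) fun _ _ => hw)

theorem approxAt_of_contDiff {φ : E → ℂ} (h : ContDiff ℝ (m + 1) φ) {S : ℝ} (hα : α ≤ m + 1)
    (hS : CkNormLE (m + 1) φ S) (x : E) : ApproxAt α m ((m + 1) * S) φ x := by
  have hS0 := hS.nonneg
  refine ⟨_, isRayPoly_sum m (fun j => (j.factorial : ℝ)⁻¹) fun j => iteratedFDeriv ℝ j φ x,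
    fun w hw => ?_, fun w hw => ?_⟩
  · calc _ ≤ ∑ _j ∈ Finset.range (m + 1), S := norm_sum_le_of_le _ fun j hj =>
          (norm_inv_factorial_smul_apply_le _ hw).trans (hS j (Finset.mem_range.1 hj).le x)
      _ = (m + 1) * S := by simp
  · have hpow : ‖w‖ ^ (m + 1) ≤ ‖w‖ ^ α := by
      rcases (norm_nonneg w).eq_or_lt with h0 | h0
      · rw [← h0, zero_pow (by omega)]; positivity
      · rw [← Real.rpow_natCast]
        exact Real.rpow_le_rpow_of_exponent_ge h0 hw (by push_cast; exact hα)
    calc _ ≤ S * ‖w‖ ^ (m + 1) := norm_sub_taylor_le h (hS _ le_rfl) x w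
      _ ≤ ((m + 1) * S) * ‖w‖ ^ α := by
        gcongr
        exact le_mul_of_one_le_left hS0 (by simp)

theorem IsTest.exists_ckNormLE {φ : E → ℂ} (h : IsTest φ) (N : ℕ) : ∃ S : ℝ, CkNormLE N φ S := by
  choose D hD using fun k : ℕ => (h.continuous_iteratedFDeriv k).bounded_above_of_compact_support
    (h.compact.iteratedFDeriv k)
  refine ⟨∑ k ∈ Finset.range (N + 1), D k, fun k hk x => (hD k x).trans ?_⟩
  exact Finset.single_le_sum (f := D) (fun i _ => (norm_nonneg _).trans (hD i 0))
    (Finset.mem_range.2 (by omega))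

theorem IsTest.exists_approxAt {φ : E → ℂ} (h : IsTest φ) (hα : α ≤ m + 1) :
    ∃ A, ∀ x, ApproxAt α m A φ x := by
  obtain ⟨S, hS⟩ := h.exists_ckNormLE (m + 1)
  exact ⟨_, approxAt_of_contDiff (h.smooth.of_le (mod_cast le_top)) hα hS⟩

theorem IsTest.exists_approxAt_mul [ProperSpace E] {κ F : E → ℂ} (h : IsTest κ) (hα : 0 < α)
    (hαm : α ≤ m + 1) (hF : ∀ K : Set E, IsCompact K → ∃ A, ∀ x ∈ K, ApproxAt α n A F x) :
    ∃ A, ∀ x, ApproxAt α (m + n) A (fun y => κ y * F y) x := by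
  obtain ⟨A, hA⟩ := h.exists_approxAt hαm
  obtain ⟨B, hB⟩ := hF _ (h.compact.isCompact.cthickening (r := 1))
  refine ⟨|3 * A * B|, fun x => ?_⟩
  by_cases hx : x ∈ Metric.cthickening 1 (tsupport κ)
  · exact ((hA x).mul hα (hB x hx)).mono (le_abs_self _)
  · refine approxAt_zero _ _ (abs_nonneg _) fun w hw => ?_
    have hxw : x + w ∉ tsupport κ := fun h' =>
      hx (Metric.mem_cthickening_of_dist_le x (x + w) _ _ h' (by simpa [dist_eq_norm] using hw))
    rw [image_eq_zero_of_notMem_tsupport hxw, zero_mul]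

end RayPolynomials

section Kernel

theorem sum_lagrange_basis_eval_mul_pow {v : ℕ → ℝ} (hv : Function.Injective v) (x : ℝ) {j M : ℕ}
    (hj : j ≤ M) :
    ∑ i ∈ Finset.range (M + 1), (Lagrange.basis (Finset.range (M + 1)) v i).eval x * v i ^ j =
      x ^ j := by
  have hinterp := Lagrange.eq_interpolate (s := Finset.range (M + 1)) (v := v)
    (f := (Polynomial.X ^ j : Polynomial ℝ)) hv.injOn (by
      rw [Polynomial.degree_X_pow, Finset.card_range]; exact_mod_cast Nat.lt_succ_of_le hj)
  have heval := congrArg (Polynomial.eval x) hinterp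
  rw [Lagrange.interpolate_apply, Polynomial.eval_finsetSum] at heval
  simp only [Polynomial.eval_pow, Polynomial.eval_X, Polynomial.eval_mul, Polynomial.eval_C]
    at heval
  rw [heval]
  exact Finset.sum_congr rfl fun i _ => mul_comm _ _

theorem exists_extrapolation {v : ℕ → ℝ} (hv : Function.Injective v) (x : ℝ) (M : ℕ) :
    ∃ c : ℕ → ℝ, ∀ P : Polynomial ℂ, P.natDegree ≤ M →
      ∑ i ∈ Finset.range (M + 1), (c i : ℂ) * P.eval (v i : ℂ) = P.eval (x : ℂ) := by
  refine ⟨fun i => (Lagrange.basis (Finset.range (M + 1)) v i).eval x, fun P hP => ?_⟩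
  simp_rw [Polynomial.eval_eq_sum_range' (Nat.lt_succ_of_le hP), Finset.mul_sum]
  rw [Finset.sum_comm]
  refine Finset.sum_congr rfl fun j hj => ?_
  have hpow := congrArg Complex.ofReal
    (sum_lagrange_basis_eval_mul_pow hv x (Nat.le_of_lt_succ (Finset.mem_range.1 hj)))
  push_cast at hpow
  rw [← hpow, Finset.mul_sum]
  exact Finset.sum_congr rfl fun i _ => by ring

variable {E : Type} [NormedAddCommGroup E] [NormedSpace ℝ E]

theorem rescale_apply (ψ : Test E) (x y : E) {l : ℝ} (hl : 0 < l) :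
    rescale ψ x l hl y = (l ^ Module.finrank ℝ E)⁻¹ * ψ (l⁻¹ • (x - y)) :=
  rfl

theorem tsupport_rescale_subset {ψ : Test E} {r : ℝ} (hψ : tsupport ψ ⊆ Metric.ball 0 r) (x : E)
    {l : ℝ} (hl : 0 < l) : tsupport (rescale ψ x l hl) ⊆ Metric.ball x (l * r) := by
  have hcomp : tsupport (rescale ψ x l hl) ⊆ (fun y => l⁻¹ • (x - y)) ⁻¹' tsupport ψ :=
    (tsupport_mul_subset_right).trans
      (tsupport_comp_subset_preimage ψ (f := fun y => l⁻¹ • (x - y)) (by fun_prop))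
  intro y hy
  have hnorm : ‖l⁻¹ • (x - y)‖ < r := by simpa using hψ (hcomp hy)
  rw [norm_smul, norm_inv, Real.norm_of_nonneg hl.le, inv_mul_lt_iff₀ hl] at hnorm
  rwa [mem_ball_iff_norm, norm_sub_rev]

variable [MeasureSpace E]

/-- Test functions supported in the unit ball which act on ray polynomials of degree at most `M`
like the point evaluation at the origin. Averaging against such a function at scale `l` is exact
up to an error of order `l ^ α` on functions of Hölder regularity `α ≤ M + 1`. -/
structure IsReproducing (M : ℕ) (ρ : Test E) : Prop where
  tsupport_subset : tsupport ρ ⊆ Metric.ball 0 1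
  integral_mul : ∀ p : E → ℂ, IsRayPoly M p → ∫ w, p w * ρ w = p 0

theorem IsReproducing.integral_eq_one {M : ℕ} {ρ : Test E} (h : IsReproducing M ρ) :
    ∫ w, ρ w = 1 := by
  have hone := h.integral_mul (fun _ => 1) ⟨continuous_const, fun _ => ⟨1, by simp, by simp⟩⟩
  simp only [one_mul, integral_complex_ofReal] at hone
  exact_mod_cast hone

variable [FiniteDimensional ℝ E] [BorelSpace E] [(volume : Measure E).IsAddHaarMeasure]

theorem integral_mul_rescale (H : E → ℂ) (ψ : Test E) (x : E) {l : ℝ} (hl : 0 < l) :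
    ∫ y, H y * rescale ψ x l hl y = ∫ w, H (x - l • w) * ψ w := by
  have hdil := Measure.integral_comp_smul (volume : Measure E)
    (fun w => H (x - w) * (ψ (l⁻¹ • w) : ℂ)) l
  simp only [inv_smul_smul₀ hl.ne'] at hdil
  rw [hdil, abs_of_pos (by positivity), ← integral_smul, ← integral_sub_left_eq_self _ _ x]
  congr 1; ext w
  rw [rescale_apply, sub_sub_cancel, Complex.real_smul]
  push_cast
  ring

theorem exists_bump {ε : ℝ} (hε : 0 < ε) : ∃ ρ : Test E, tsupport ρ ⊆ Metric.ball 0 ε ∧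
    ∫ x, ρ x = 1 ∧ ∀ x, 0 ≤ ρ x := by
  let b : ContDiffBump (0 : E) := ⟨ε / 4, ε / 2, by positivity, by linarith⟩
  refine ⟨⟨b.normed volume, b.contDiff_normed, b.hasCompactSupport_normed, fun _ _ => trivial⟩,
    ?_, b.integral_normed, fun x => b.nonneg_normed x⟩
  change tsupport (b.normed volume) ⊆ _
  rw [b.tsupport_normed_eq]
  exact Metric.closedBall_subset_ball (half_lt_self hε)

variable (E) in
/-- Richardson extrapolation: the moments of a bump at several scales are combined so that all of
them but the zeroth cancel. -/
theorem exists_isReproducing (M : ℕ) : ∃ ρ : Test E, IsReproducing M ρ := by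
  have hinj : Function.Injective fun i : ℕ => -(1 / 2 : ℝ) ^ i :=
    neg_injective.comp (pow_right_injective₀ (by norm_num) (by norm_num))
  obtain ⟨c, hc⟩ := exists_extrapolation hinj 0 M
  obtain ⟨b, hb, hb1, -⟩ := exists_bump (E := E) one_pos
  have hpos (i : ℕ) : (0 : ℝ) < (1 / 2) ^ i := by positivity
  refine ⟨∑ i ∈ Finset.range (M + 1), c i • rescale b 0 _ (hpos i), ?_, fun p hp => ?_⟩
  · refine Finset.sum_induction _ (fun ψ : Test E => tsupport ψ ⊆ Metric.ball 0 1)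
      (fun φ ψ hφ hψ => (tsupport_add φ ψ).trans (Set.union_subset hφ hψ))
      (by simp [tsupport]) fun i _ => ?_
    exact (tsupport_smul_subset_right (fun _ => c i) _).trans
      ((tsupport_rescale_subset hb 0 (hpos i)).trans
        (Metric.ball_subset_ball (by rw [mul_one]; exact pow_le_one₀ (by norm_num) (by norm_num))))
  have hint (i : ℕ) : Integrable fun w => p w * (rescale b 0 _ (hpos i) w : ℂ) :=
    integrable_mul_of_isTest hp.continuous (.ofReal _)
  have hint' (i : ℕ) : Integrable fun w => p (-(1 / 2 : ℝ) ^ i • w) * (b w : ℂ) :=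
    integrable_mul_of_isTest (hp.comp_smul _).continuous (.ofReal b)
  have hextra (w : E) :
      ∑ i ∈ Finset.range (M + 1), (c i : ℂ) * p (-(1 / 2 : ℝ) ^ i • w) = p 0 := by
    obtain ⟨P, hPdeg, hP⟩ := hp.exists_poly w
    simp_rw [hP, hc P hPdeg]
    simpa using (hP 0).symm
  calc _ = ∫ w, ∑ i ∈ Finset.range (M + 1), (c i : ℂ) * (p w * rescale b 0 _ (hpos i) w) := by
        congr 1; ext w
        rw [sum_apply, Complex.ofReal_sum, Finset.mul_sum]
        refine Finset.sum_congr rfl fun i _ => ?_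
        simp only [smul_apply, smul_eq_mul, Complex.ofReal_mul]
        ring
    _ = ∑ i ∈ Finset.range (M + 1), (c i : ℂ) * ∫ w, p (-(1 / 2 : ℝ) ^ i • w) * b w := by
        rw [integral_finsetSum _ fun i _ => (hint i).const_mul _]
        simp_rw [integral_const_mul, integral_mul_rescale, zero_sub, neg_smul]
    _ = ∫ w, (∑ i ∈ Finset.range (M + 1), (c i : ℂ) * p (-(1 / 2 : ℝ) ^ i • w)) * b w := by
        simp_rw [Finset.sum_mul, mul_assoc]
        rw [integral_finsetSum _ fun i _ => (hint' i).const_mul _]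
        simp_rw [integral_const_mul]
    _ = p 0 := by
        simp_rw [hextra, integral_const_mul, integral_complex_ofReal, hb1]
        simp

end Kernel

section Cutoff

open scoped Manifold in
theorem exists_cutoff {E : Type} [NormedAddCommGroup E] [NormedSpace ℝ E] [FiniteDimensional ℝ E]
    {K U : Set E} (hK : IsCompact K) (hU : IsOpen U) (hKU : K ⊆ U) :
    ∃ ζ : Test E, tsupport ζ ⊆ U ∧ ∀ᶠ x in 𝓝ˢ K, ζ x = 1 := by
  obtain ⟨L, hL, hKL, hLU⟩ := exists_compact_between hK hU hKU
  obtain ⟨ζ, hζK, hζL, -⟩ := exists_contMDiffMap_one_nhds_of_subset_interior (n := (⊤ : ℕ∞))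
    𝓘(ℝ, E) hK.isClosed hKL
  have hsupp : Function.support ζ ⊆ L := Function.support_subset_iff'.2 hζL
  exact ⟨⟨ζ, ζ.contMDiff.contDiff, .of_support_subset_isCompact hL hsupp, fun _ _ => trivial⟩,
    (closure_minimal hsupp hL.isClosed).trans hLU, hζK⟩

end Cutoff

section Translates

variable {E : Type} [NormedAddCommGroup E] [NormedSpace ℝ E]

theorem IsTest.mul_comp_add_smul {χ φ : E → ℂ} (hχ : IsTest χ) (hφ : IsTest φ) (c : ℝ) :
    IsTest fun q : E × E => χ q.1 * φ (q.2 + c • q.1) := by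
  refine ⟨(hχ.smooth.comp contDiff_fst).mul
    (hφ.smooth.comp (contDiff_snd.add (contDiff_fst.const_smul c))), ?_⟩
  refine HasCompactSupport.intro ((hχ.compact.isCompact.prod hφ.compact.isCompact).image
    (f := fun q : E × E => (q.1, q.2 - c • q.1)) (by fun_prop)) ?_
  rintro ⟨x, y⟩ hxy
  by_contra hne
  exact hxy ⟨(x, y + c • x), ⟨subset_tsupport _ (left_ne_zero_of_mul hne),
    subset_tsupport _ (right_ne_zero_of_mul hne)⟩, by simp⟩

variable [FiniteDimensional ℝ E]

theorem continuous_pair_comp_add_smul (g : Distr E) {φ : E → ℂ} (h : IsTest φ) (c : ℝ) :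
    Continuous fun x => pair g fun z => φ (z + c • x) := by
  refine continuous_iff_continuousAt.2 fun x => ?_
  obtain ⟨ζ, -, hζ⟩ := exists_cutoff (isCompact_singleton (x := x)) isOpen_univ (Set.subset_univ _)
  rw [nhdsSet_singleton] at hζ
  have hcont := (((IsTest.ofReal ζ).mul_comp_add_smul h c).partialPair g).continuous
  refine hcont.continuousAt.congr ?_
  filter_upwards [hζ] with y hy
  simp [partialPair, hy]

theorem exists_test_mul_eq {H : E → ℂ} (hc : HasCompactSupport H) :
    ∃ ζ : Test E, ∀ x, H x * (ζ x : ℂ) = H x := by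
  obtain ⟨ζ, -, hζ⟩ := exists_cutoff hc.isCompact isOpen_univ (Set.subset_univ _)
  refine ⟨ζ, fun x => ?_⟩
  by_cases hx : x ∈ tsupport H
  · rw [hζ.self_of_nhdsSet x hx, Complex.ofReal_one, mul_one]
  · rw [image_eq_zero_of_notMem_tsupport hx, zero_mul]

variable [MeasureSpace E] [BorelSpace E] [IsLocallyFiniteMeasure (volume : Measure E)]

theorem IsTest.integral_mul_comp_add_smul {H φ : E → ℂ} (h : IsTest φ) (hH : Continuous H)
    (hc : HasCompactSupport H) (c : ℝ) : IsTest fun z => ∫ x, H x * φ (z + c • x) := by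
  obtain ⟨ζ, hζ⟩ := exists_test_mul_eq hc
  simpa only [← mul_assoc, hζ] using
    isTest_integral hH ((IsTest.ofReal ζ).mul_comp_add_smul h c)

theorem integral_mul_pair_comp_add_smul (g : Distr E) {H φ : E → ℂ} (hH : Continuous H)
    (hc : HasCompactSupport H) (h : IsTest φ) (c : ℝ) :
    ∫ x, H x * pair g (fun z => φ (z + c • x)) = pair g fun z => ∫ x, H x * φ (z + c • x) := by
  obtain ⟨ζ, hζ⟩ := exists_test_mul_eq hc
  have hpartial (x : E) : partialPair g (fun q : E × E => (ζ q.1 : ℂ) * φ (q.2 + c • q.1)) x =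
      ζ x * pair g fun z => φ (z + c • x) :=
    pair_const_mul g (h.comp_add_right (c • x)) (ζ x : ℂ)
  simpa only [hpartial, ← mul_assoc, hζ] using
    integral_mul_partialPair g hH ((IsTest.ofReal ζ).mul_comp_add_smul h c)

end Translates

section Kernels

variable {E : Type} [NormedAddCommGroup E] [NormedSpace ℝ E]

/-- The value of `g` on the kernel `ρ` rescaled to size `2⁻ⁿ` around `x`. -/
def kern (g : Distr E) (ρ : Test E) (n : ℕ) (x : E) : ℂ :=
  g (rescale ρ x ((1 / 2) ^ n) (by positivity))

theorem kern_eq_pair (g : Distr E) (ρ : Test E) (n : ℕ) (x : E) :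
    kern g ρ n x =
      pair g fun z => (rescale ρ 0 ((1 / 2) ^ n) (by positivity) (z + (-1 : ℝ) • x) : ℂ) := by
  rw [kern, ← pair_ofReal]
  congr 1; ext z
  simp only [rescale_apply]
  congr 4
  module

theorem norm_half_pow_smul_le {ρ : Test E} (hρ : tsupport ρ ⊆ Metric.ball 0 1) (n : ℕ) {w : E}
    (hw : w ∈ tsupport ρ) : ‖(1 / 2 : ℝ) ^ n • w‖ ≤ (1 / 2) ^ n := by
  have hw1 : ‖w‖ < 1 := by simpa using hρ hw
  rw [norm_smul, Real.norm_of_nonneg (by positivity)]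
  exact mul_le_of_le_one_right (by positivity) hw1.le

variable [FiniteDimensional ℝ E]

theorem continuous_kern (g : Distr E) (ρ : Test E) (n : ℕ) : Continuous (kern g ρ n) := by
  rw [funext (kern_eq_pair g ρ n)]
  exact continuous_pair_comp_add_smul g (.ofReal _) (-1)

end Kernels

section Averages

variable {E : Type} [NormedAddCommGroup E] [NormedSpace ℝ E] [MeasureSpace E]

/-- The average of `H` at scale `2⁻ⁿ` around `x`, with weight `ρ`. -/
def avg (ρ : Test E) (n : ℕ) (H : E → ℂ) (x : E) : ℂ :=
  ∫ w, H (x + (1 / 2 : ℝ) ^ n • w) * ρ w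

theorem avg_comp_add_right (ρ : Test E) (n : ℕ) (H : E → ℂ) (c : E) :
    avg ρ n (fun y => H (y + c)) = fun x => avg ρ n H (x + c) := by
  ext x; simp only [avg, add_right_comm]

theorem avg_const_mul (ρ : Test E) (n : ℕ) (c : ℂ) (H : E → ℂ) :
    avg ρ n (fun y => c * H y) = fun x => c * avg ρ n H x := by
  ext x; simp only [avg, mul_assoc, integral_const_mul]

theorem support_avg_subset {ρ : Test E} (hρ : tsupport ρ ⊆ Metric.ball 0 1) (n : ℕ)
    {H : E → ℂ} {K : Set E} (hK : tsupport H ⊆ K) :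
    Function.support (avg ρ n H) ⊆ Metric.cthickening 1 K := by
  refine Function.support_subset_iff'.2 fun x hx => ?_
  refine integral_eq_zero_of_ae (Eventually.of_forall fun w => mul_eq_zero.2 ?_)
  by_cases hw : w ∈ tsupport ρ
  · refine .inl (image_eq_zero_of_notMem_tsupport fun hmem => hx ?_)
    refine Metric.mem_cthickening_of_dist_le x _ _ _ (hK hmem) ?_
    rw [dist_self_add_right]
    exact (norm_half_pow_smul_le hρ n hw).trans (pow_le_one₀ (by norm_num) (by norm_num))
  · exact .inr (by rw [image_eq_zero_of_notMem_tsupport hw, Complex.ofReal_zero])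

variable [BorelSpace E] [IsLocallyFiniteMeasure (volume : Measure E)]

theorem avg_add (ρ : Test E) (n : ℕ) {H H' : E → ℂ} (hH : Continuous H) (hH' : Continuous H') :
    avg ρ n (fun y => H y + H' y) = fun x => avg ρ n H x + avg ρ n H' x := by
  ext x
  simp only [avg, add_mul]
  exact integral_add
    (integrable_mul_of_isTest (hH.comp (continuous_const.add (continuous_const_smul _)))
      (.ofReal ρ))
    (integrable_mul_of_isTest (hH'.comp (continuous_const.add (continuous_const_smul _)))
      (.ofReal ρ))

theorem integrable_norm_test (ρ : Test E) : Integrable fun w => ‖ρ w‖ :=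
  (ρ.continuous.integrable_of_hasCompactSupport ρ.hasCompactSupport).norm

theorem norm_integral_mul_test_le {ρ : Test E} {f : E → ℂ} {ε : ℝ}
    (hf : ∀ w ∈ tsupport ρ, ‖f w‖ ≤ ε) : ‖∫ w, f w * ρ w‖ ≤ ε * ∫ w, ‖ρ w‖ := by
  rw [← integral_const_mul]
  refine norm_integral_le_of_norm_le ((integrable_norm_test ρ).const_mul ε)
    (Eventually.of_forall fun w => ?_)
  rw [norm_mul, Complex.norm_real]
  by_cases hw : w ∈ tsupport ρ
  · gcongr; exact hf w hw
  · simp [image_eq_zero_of_notMem_tsupport hw]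

theorem norm_integral_mul_test_sub_le {ρ : Test E} (hρ : ∫ w, ρ w = 1) {f : E → ℂ}
    (hf : Continuous f) {c : ℂ} {ε : ℝ} (hε : ∀ w ∈ tsupport ρ, ‖f w - c‖ ≤ ε) :
    ‖(∫ w, f w * ρ w) - c‖ ≤ ε * ∫ w, ‖ρ w‖ := by
  have hconst : ∫ w, c * (ρ w : ℂ) = c := by
    rw [integral_const_mul, integral_complex_ofReal, hρ, Complex.ofReal_one, mul_one]
  have hsub : (∫ w, f w * ρ w) - c = ∫ w, (f w - c) * ρ w := by
    simp only [sub_mul]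
    rw [integral_sub (integrable_mul_of_isTest hf (.ofReal ρ))
      (integrable_mul_of_isTest continuous_const (.ofReal ρ)), hconst]
  exact hsub ▸ norm_integral_mul_test_le hε

theorem norm_avg_le {ρ : Test E} {n : ℕ} {B : ℝ} {H : E → ℂ} (hB : ∀ x, ‖H x‖ ≤ B) (x : E) :
    ‖avg ρ n H x‖ ≤ B * ∫ w, ‖ρ w‖ :=
  norm_integral_mul_test_le fun _ _ => hB _

theorem IsReproducing.norm_avg_sub_le {M : ℕ} {ρ : Test E} (hρ : IsReproducing M ρ) {α A : ℝ}
    (hα : 0 < α) {H : E → ℂ} (hH : Continuous H) {x : E} (h : ApproxAt α M A H x) (n : ℕ) :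
    ‖avg ρ n H x - H x‖ ≤ (A * ∫ w, ‖ρ w‖) * ((1 / 2 : ℝ) ^ n) ^ α := by
  have hA := h.nonneg
  obtain ⟨p, hp, -, hpH⟩ := h
  have hp' := hp.comp_smul ((1 / 2 : ℝ) ^ n)
  have hsub : avg ρ n H x - H x =
      ∫ w, (H (x + (1 / 2 : ℝ) ^ n • w) - p ((1 / 2 : ℝ) ^ n • w)) * ρ w := by
    have hHc : Continuous fun w => H (x + (1 / 2 : ℝ) ^ n • w) :=
      hH.comp (continuous_const.add (continuous_const_smul _))
    simp only [sub_mul]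
    rw [integral_sub (integrable_mul_of_isTest hHc (.ofReal ρ))
      (integrable_mul_of_isTest hp'.continuous (.ofReal ρ)), hρ.integral_mul _ hp', smul_zero,
      eq_of_norm_sub_le_mul_rpow hα hpH, avg]
  rw [hsub, mul_right_comm]
  refine norm_integral_mul_test_le fun w hw => ?_
  have hw' := norm_half_pow_smul_le hρ.tsupport_subset n hw
  refine (hpH _ (hw'.trans (pow_le_one₀ (by norm_num) (by norm_num)))).trans ?_
  gcongr

variable [FiniteDimensional ℝ E]

theorem pair_avg (g : Distr E) (ρ : Test E) (n : ℕ) {φ : E → ℂ} (h : IsTest φ) :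
    pair g (avg ρ n φ) = ∫ w, (pair g fun z => φ (z + (1 / 2 : ℝ) ^ n • w)) * ρ w := by
  have hfubini := integral_mul_pair_comp_add_smul g (IsTest.ofReal ρ).continuous
    (IsTest.ofReal ρ).compact h ((1 / 2) ^ n)
  simp only [mul_comm (ρ _ : ℂ)] at hfubini
  exact hfubini.symm

theorem avg_comm (ρ : Test E) (n m : ℕ) {H : E → ℂ} (hH : Continuous H) :
    avg ρ n (avg ρ m H) = avg ρ m (avg ρ n H) := by
  ext x
  simp only [avg, ← integral_mul_const]
  rw [integral_integral_swap]
  · congr 1; ext w; congr 1; ext w'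
    rw [add_right_comm]; ring
  · have := ρ.continuous
    refine Continuous.integrable_of_hasCompactSupport
      (by simp only [Function.uncurry_def]; fun_prop) (.intro
        (ρ.hasCompactSupport.isCompact.prod ρ.hasCompactSupport.isCompact) ?_)
    rintro ⟨w, w'⟩ h
    simp only [Set.mem_prod, not_and_or] at h
    rcases h with h | h <;> simp [image_eq_zero_of_notMem_tsupport h]

end Averages

section ScalePair

theorem norm_integral_mul_le {X : Type*} [TopologicalSpace X] [T2Space X] [MeasurableSpace X]
    [BorelSpace X] {μ : Measure X} [IsFiniteMeasureOnCompacts μ] {a b : X → ℂ} {K : Set X}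
    (hK : IsCompact K) (ha : Function.support a ⊆ K) {B : ℝ} (hB : ∀ x, ‖a x‖ ≤ B)
    (hb : Continuous b) : ‖∫ x, a x * b x ∂μ‖ ≤ B * ∫ x in K, ‖b x‖ ∂μ := by
  rw [← setIntegral_eq_integral_of_forall_compl_eq_zero (s := K) fun x hx => by
    rw [Function.support_subset_iff'.1 ha x hx, zero_mul], ← integral_const_mul]
  refine norm_integral_le_of_norm_le ((hb.norm.continuousOn.integrableOn_compact hK).const_mul B)
    (Eventually.of_forall fun x => ?_)
  rw [norm_mul]
  exact mul_le_mul_of_nonneg_right (hB x) (norm_nonneg _)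

variable {E : Type} [NormedAddCommGroup E] [NormedSpace ℝ E] [MeasureSpace E]

/-- The approximate pairing of `g` with `H` at scale `2⁻ⁿ`. -/
def scalePair (g : Distr E) (ρ : Test E) (n : ℕ) (H : E → ℂ) : ℂ :=
  ∫ x, avg ρ n H x * kern g ρ n x

theorem scalePair_const_mul (g : Distr E) (ρ : Test E) (n : ℕ) (c : ℂ) (H : E → ℂ) :
    scalePair g ρ n (fun y => c * H y) = c * scalePair g ρ n H := by
  simp only [scalePair, avg_const_mul, mul_assoc, integral_const_mul]

variable [BorelSpace E] [FiniteDimensional ℝ E] [(volume : Measure E).IsAddHaarMeasure]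

theorem integrable_mul_kern (g : Distr E) (ρ : Test E) (n : ℕ) {φ : E → ℂ} (h : IsTest φ) :
    Integrable fun x => φ x * kern g ρ n x := by
  simpa only [mul_comm] using integrable_mul_of_isTest (continuous_kern g ρ n) h

theorem norm_scalePair_le (g : Distr E) {ρ : Test E} (hρ : tsupport ρ ⊆ Metric.ball 0 1)
    {K : Set E} (hK : IsCompact K) (n : ℕ) {B : ℝ} {H : E → ℂ} (hHK : tsupport H ⊆ K)
    (hB : ∀ x, ‖H x‖ ≤ B) :
    ‖scalePair g ρ n H‖ ≤
      B * ((∫ w, ‖ρ w‖) * ∫ x in Metric.cthickening 1 K, ‖kern g ρ n x‖) :=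
  (norm_integral_mul_le hK.cthickening (support_avg_subset hρ n hHK) (norm_avg_le hB)
    (continuous_kern g ρ n)).trans_eq (mul_assoc _ _ _)

theorem avg_eq_integral_mul_rescale (ρ : Test E) (n : ℕ) (H : E → ℂ) (z : E) :
    avg ρ n H z =
      ∫ x, H x * (rescale ρ 0 ((1 / 2) ^ n) (by positivity) (z + (-1 : ℝ) • x) : ℂ) := by
  have hrefl := integral_mul_rescale (fun y => H (z - y)) ρ 0
    (show (0 : ℝ) < (1 / 2) ^ n by positivity)
  simp only [zero_sub, sub_neg_eq_add] at hrefl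
  rw [avg, ← hrefl, ← integral_sub_left_eq_self _ _ z]
  congr 1; ext x
  rw [sub_sub_cancel, neg_one_smul, ← sub_eq_add_neg]

theorem isTest_avg (ρ : Test E) (n : ℕ) {H : E → ℂ} (hH : Continuous H)
    (hc : HasCompactSupport H) : IsTest (avg ρ n H) := by
  rw [funext (avg_eq_integral_mul_rescale ρ n H)]
  exact IsTest.integral_mul_comp_add_smul (.ofReal _) hH hc (-1)

theorem integral_mul_kern (g : Distr E) (ρ : Test E) (n : ℕ) {H : E → ℂ} (hH : Continuous H)
    (hc : HasCompactSupport H) : ∫ x, H x * kern g ρ n x = pair g (avg ρ n H) := by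
  simp only [kern_eq_pair]
  rw [integral_mul_pair_comp_add_smul g hH hc (.ofReal _) (-1),
    funext (avg_eq_integral_mul_rescale ρ n H)]

theorem scalePair_eq_pair (g : Distr E) (ρ : Test E) (n : ℕ) {H : E → ℂ} (hH : Continuous H)
    (hc : HasCompactSupport H) : scalePair g ρ n H = pair g (avg ρ n (avg ρ n H)) :=
  integral_mul_kern g ρ n (isTest_avg ρ n hH hc).continuous (isTest_avg ρ n hH hc).compact

theorem scalePair_add (g : Distr E) (ρ : Test E) (n : ℕ) {H H' : E → ℂ} (hH : Continuous H)
    (hc : HasCompactSupport H) (hH' : Continuous H') (hc' : HasCompactSupport H') :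
    scalePair g ρ n (fun y => H y + H' y) = scalePair g ρ n H + scalePair g ρ n H' := by
  simp only [scalePair, avg_add ρ n hH hH', add_mul]
  exact integral_add (integrable_mul_kern g ρ n (isTest_avg ρ n hH hc))
    (integrable_mul_kern g ρ n (isTest_avg ρ n hH' hc'))

/-- The mixed terms cancel because the averages at different scales commute. -/
theorem scalePair_sub (g : Distr E) (ρ : Test E) (n m : ℕ) {H : E → ℂ} (hH : Continuous H)
    (hc : HasCompactSupport H) :
    scalePair g ρ n H - scalePair g ρ m H =
      ∫ x, (avg ρ n H x - avg ρ m H x) * (kern g ρ n x + kern g ρ m x) := by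
  have hn := isTest_avg ρ n hH hc
  have hm := isTest_avg ρ m hH hc
  have hcross : ∫ x, avg ρ n H x * kern g ρ m x = ∫ x, avg ρ m H x * kern g ρ n x := by
    rw [integral_mul_kern g ρ m hn.continuous hn.compact,
      integral_mul_kern g ρ n hm.continuous hm.compact, avg_comm ρ n m hH]
  have hint (k : ℕ) :
      Integrable fun x => avg ρ n H x * kern g ρ k x - avg ρ m H x * kern g ρ k x :=
    (integrable_mul_kern g ρ k hn).sub (integrable_mul_kern g ρ k hm)
  simp only [mul_add, sub_mul]
  rw [integral_add (hint n) (hint m),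
    integral_sub (integrable_mul_kern g ρ n hn) (integrable_mul_kern g ρ n hm),
    integral_sub (integrable_mul_kern g ρ m hn) (integrable_mul_kern g ρ m hm), hcross,
    scalePair, scalePair]
  ring

theorem tendsto_scalePair (g : Distr E) {ρ : Test E} (hρ : tsupport ρ ⊆ Metric.ball 0 1)
    (hρ1 : ∫ w, ρ w = 1) {φ : E → ℂ} (h : IsTest φ) :
    Tendsto (fun n : ℕ => scalePair g ρ n φ) atTop (𝓝 (pair g φ)) := by
  set R := ∫ w, ‖ρ w‖
  have hcont {χ : E → ℂ} (hχ : IsTest χ) : Continuous fun c => pair g fun z => χ (z + c) := by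
    simpa only [one_smul] using continuous_pair_comp_add_smul g hχ 1
  rw [Metric.tendsto_atTop]
  intro ε hε
  obtain ⟨δ, hδ, hδε⟩ := Metric.continuousAt_iff.1 ((hcont h).continuousAt (x := 0))
    (ε / (R * R + 1)) (by positivity)
  simp only [dist_zero_right, add_zero, dist_eq_norm (pair g _)] at hδε
  obtain ⟨N, hN⟩ := exists_pow_lt_of_lt_one (half_pos hδ) (by norm_num : (1 / 2 : ℝ) < 1)
  refine ⟨N, fun n hn => ?_⟩
  have hnδ : (1 / 2 : ℝ) ^ n < δ / 2 :=
    (pow_le_pow_of_le_one (by norm_num) (by norm_num) hn).trans_lt hN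
  have inner_average : ∀ w ∈ tsupport ρ,
      ‖(pair g fun z => avg ρ n φ (z + (1 / 2 : ℝ) ^ n • w)) - pair g φ‖ ≤
        ε / (R * R + 1) * R := by
    intro w hw
    rw [← avg_comp_add_right, pair_avg g ρ n (h.comp_add_right _)]
    refine norm_integral_mul_test_sub_le hρ1
      ((hcont (h.comp_add_right _)).comp (continuous_const_smul _)) fun w' hw' => ?_
    have hlt : ‖(1 / 2 : ℝ) ^ n • w' + (1 / 2 : ℝ) ^ n • w‖ < δ := by
      refine (norm_add_le _ _).trans_lt ?_
      linarith [norm_half_pow_smul_le hρ n hw, norm_half_pow_smul_le hρ n hw']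
    simpa only [Function.comp_apply, add_assoc] using (hδε hlt).le
  have havg := isTest_avg ρ n h.continuous h.compact
  rw [scalePair_eq_pair g ρ n h.continuous h.compact, pair_avg g ρ n havg, dist_eq_norm]
  refine (norm_integral_mul_test_sub_le hρ1
    ((hcont havg).comp (continuous_const_smul _)) inner_average).trans_lt ?_
  rw [mul_assoc, div_mul_eq_mul_div, div_lt_iff₀ (by positivity)]
  nlinarith

end ScalePair

section Rates

variable {E : Type} [NormedAddCommGroup E] [NormedSpace ℝ E] [MeasureSpace E]

/-- The functions supported in `K` whose averages at scale `2⁻ⁿ` converge uniformly at rate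
`2 ^ (-n α)`, with constant `B`. -/
structure AvgRate (α : ℝ) (ρ : Test E) (K : Set E) (B : ℝ) (H : E → ℂ) : Prop where
  continuous : Continuous H
  tsupport_subset : tsupport H ⊆ K
  norm_avg_sub_le : ∀ n x, ‖avg ρ n H x - H x‖ ≤ B * ((1 / 2 : ℝ) ^ n) ^ α

/-- The regularity of `g`, measured by a kernel: the averages at scale `2⁻ⁿ` grow, in `L¹` on
compact sets, summably slower than `2 ^ (n α)`. -/
def SummableKern (α : ℝ) (g : Distr E) (ρ : Test E) : Prop :=
  ∀ K : Set E, IsCompact K →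
    Summable fun n : ℕ => ((1 / 2 : ℝ) ^ n) ^ α * ∫ x in K, ‖kern g ρ n x‖

/-- The bound for the difference of the approximate pairings at the scales `2⁻ⁿ` and `2⁻ⁿ⁻¹`
with functions supported in `K`. -/
def kernGap (α : ℝ) (g : Distr E) (ρ : Test E) (K : Set E) (n : ℕ) : ℝ :=
  2 * ((1 / 2 : ℝ) ^ n) ^ α * ((∫ x in Metric.cthickening 1 K, ‖kern g ρ n x‖) +
    ∫ x in Metric.cthickening 1 K, ‖kern g ρ (n + 1) x‖)

/-- The bound for the difference between the approximate pairing at scale `2⁻ⁿ` and its limit. -/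
def kernTail (α : ℝ) (g : Distr E) (ρ : Test E) (K : Set E) (n : ℕ) : ℝ :=
  ∑' m, kernGap α g ρ K (n + m)

/-- The extension of the pairing with `g` to non-smooth functions: the limit of the approximate
pairings, with a junk value where it does not exist. -/
def extPair (g : Distr E) (ρ : Test E) (H : E → ℂ) : ℂ :=
  limUnder atTop fun n => scalePair g ρ n H

variable {α B : ℝ} {g : Distr E} {ρ : Test E} {K : Set E} {H : E → ℂ}

theorem tendsto_kernTail : Tendsto (kernTail α g ρ K) atTop (𝓝 0) :=
  (tendsto_sum_nat_add (kernGap α g ρ K)).congr fun n =>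
    tsum_congr fun m => by rw [add_comm]

theorem AvgRate.mono {C : ℝ} (h : AvgRate α ρ K B H) (hBC : B ≤ C) : AvgRate α ρ K C H :=
  ⟨h.continuous, h.tsupport_subset, fun n x => (h.norm_avg_sub_le n x).trans (by gcongr)⟩

theorem AvgRate.hasCompactSupport (h : AvgRate α ρ K B H) (hK : IsCompact K) :
    HasCompactSupport H :=
  .of_support_subset_isCompact hK ((subset_tsupport H).trans h.tsupport_subset)

theorem AvgRate.nonneg (h : AvgRate α ρ K B H) : 0 ≤ B := by
  simpa using (norm_nonneg _).trans (h.norm_avg_sub_le 0 0)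

theorem AvgRate.norm_avg_sub_avg_succ_le (hα : 0 ≤ α) (h : AvgRate α ρ K B H) (n : ℕ) (x : E) :
    ‖avg ρ n H x - avg ρ (n + 1) H x‖ ≤ B * (2 * ((1 / 2 : ℝ) ^ n) ^ α) := by
  have hB := h.nonneg
  have hscale : (1 / 2 : ℝ) ^ (n + 1) ≤ (1 / 2) ^ n :=
    pow_le_pow_of_le_one (by norm_num) (by norm_num) n.le_succ
  calc ‖avg ρ n H x - avg ρ (n + 1) H x‖
      = ‖(avg ρ n H x - H x) - (avg ρ (n + 1) H x - H x)‖ := by rw [sub_sub_sub_cancel_right]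
    _ ≤ B * ((1 / 2 : ℝ) ^ n) ^ α + B * ((1 / 2 : ℝ) ^ n) ^ α :=
        (norm_sub_le _ _).trans (add_le_add (h.norm_avg_sub_le n x)
          ((h.norm_avg_sub_le (n + 1) x).trans (by gcongr)))
    _ = B * (2 * ((1 / 2 : ℝ) ^ n) ^ α) := by ring

variable [FiniteDimensional ℝ E]

theorem SummableKern.summable_kernGap (hg : SummableKern α g ρ) (hK : IsCompact K) :
    Summable (kernGap α g ρ K) := by
  have hsum := hg _ (hK.cthickening (r := 1))
  refine ((hsum.add (((summable_nat_add_iff 1).2 hsum).mul_left (2 ^ α))).mul_left 2).congr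
    fun n => ?_
  have hscale : ((1 / 2 : ℝ) ^ n) ^ α = 2 ^ α * ((1 / 2 : ℝ) ^ (n + 1)) ^ α := by
    rw [← Real.mul_rpow (by norm_num) (by positivity), pow_succ]
    congr 1; ring
  rw [kernGap, ← mul_assoc (2 ^ α), ← hscale]
  ring

variable [BorelSpace E] [(volume : Measure E).IsAddHaarMeasure]

theorem integrableOn_norm_kern (g : Distr E) (ρ : Test E) (n : ℕ) (hK : IsCompact K) :
    IntegrableOn (fun x => ‖kern g ρ n x‖) K :=
  (continuous_kern g ρ n).norm.continuousOn.integrableOn_compact hK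

theorem AvgRate.norm_scalePair_sub_succ_le (hα : 0 ≤ α) (hρ : tsupport ρ ⊆ Metric.ball 0 1)
    (hK : IsCompact K) (h : AvgRate α ρ K B H) (n : ℕ) :
    ‖scalePair g ρ n H - scalePair g ρ (n + 1) H‖ ≤ B * kernGap α g ρ K n := by
  have hK1 := hK.cthickening (r := 1)
  have hsupp : (Function.support fun x => avg ρ n H x - avg ρ (n + 1) H x) ⊆
      Metric.cthickening 1 K :=
    (Function.support_sub _ _).trans (Set.union_subset
      (support_avg_subset hρ n h.tsupport_subset)
      (support_avg_subset hρ (n + 1) h.tsupport_subset))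
  have hkern : ∫ x in Metric.cthickening 1 K, ‖kern g ρ n x + kern g ρ (n + 1) x‖ ≤
      (∫ x in Metric.cthickening 1 K, ‖kern g ρ n x‖) +
        ∫ x in Metric.cthickening 1 K, ‖kern g ρ (n + 1) x‖ := by
    have hn := integrableOn_norm_kern g ρ n hK1
    have hn1 := integrableOn_norm_kern g ρ (n + 1) hK1
    rw [← integral_add hn hn1]
    exact integral_mono_of_nonneg (Eventually.of_forall fun _ => norm_nonneg _) (hn.add hn1)
      (Eventually.of_forall fun x => norm_add_le _ _)
  have hB := h.nonneg
  rw [scalePair_sub g ρ n (n + 1) h.continuous (h.hasCompactSupport hK), kernGap, ← mul_assoc]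
  refine (norm_integral_mul_le hK1 hsupp (h.norm_avg_sub_avg_succ_le hα n)
    ((continuous_kern g ρ n).add (continuous_kern g ρ (n + 1)))).trans ?_
  gcongr
  exact hkern

theorem AvgRate.tendsto_scalePair (h : AvgRate α ρ K B H) (hα : 0 ≤ α)
    (hρ : tsupport ρ ⊆ Metric.ball 0 1) (hg : SummableKern α g ρ) (hK : IsCompact K) :
    Tendsto (fun n => scalePair g ρ n H) atTop (𝓝 (extPair g ρ H)) := by
  refine (cauchySeq_of_dist_le_of_summable (fun n => B * kernGap α g ρ K n) (fun n => ?_)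
    ((hg.summable_kernGap hK).mul_left B)).tendsto_limUnder
  rw [dist_eq_norm]
  exact h.norm_scalePair_sub_succ_le hα hρ hK n

theorem AvgRate.norm_scalePair_sub_extPair_le (h : AvgRate α ρ K B H) (hα : 0 ≤ α)
    (hρ : tsupport ρ ⊆ Metric.ball 0 1) (hg : SummableKern α g ρ) (hK : IsCompact K) (n : ℕ) :
    ‖scalePair g ρ n H - extPair g ρ H‖ ≤ B * kernTail α g ρ K n := by
  rw [← dist_eq_norm, kernTail, ← tsum_mul_left]
  refine dist_le_tsum_of_dist_le_of_tendsto _ (fun k => ?_)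
    ((hg.summable_kernGap hK).mul_left B) (h.tendsto_scalePair hα hρ hg hK) n
  rw [dist_eq_norm]
  exact h.norm_scalePair_sub_succ_le hα hρ hK k

theorem extPair_eq_pair (g : Distr E) (hρ : tsupport ρ ⊆ Metric.ball 0 1) (hρ1 : ∫ w, ρ w = 1)
    {φ : E → ℂ} (h : IsTest φ) : extPair g ρ φ = pair g φ :=
  (tendsto_scalePair g hρ hρ1 h).limUnder_eq

theorem extPair_add {C : ℝ} {H' : E → ℂ} (hα : 0 ≤ α) (hρ : tsupport ρ ⊆ Metric.ball 0 1)
    (hg : SummableKern α g ρ) (hK : IsCompact K) (h : AvgRate α ρ K B H)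
    (h' : AvgRate α ρ K C H') :
    extPair g ρ (fun x => H x + H' x) = extPair g ρ H + extPair g ρ H' := by
  refine (((h.tendsto_scalePair hα hρ hg hK).add
    (h'.tendsto_scalePair hα hρ hg hK)).congr fun n => ?_).limUnder_eq
  rw [scalePair_add g ρ n h.continuous (h.hasCompactSupport hK) h'.continuous
    (h'.hasCompactSupport hK)]

theorem extPair_const_mul (hα : 0 ≤ α) (hρ : tsupport ρ ⊆ Metric.ball 0 1)
    (hg : SummableKern α g ρ) (hK : IsCompact K) (h : AvgRate α ρ K B H) (c : ℂ) :
    extPair g ρ (fun x => c * H x) = c * extPair g ρ H :=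
  (((h.tendsto_scalePair hα hρ hg hK).const_mul c).congr fun n =>
    (scalePair_const_mul g ρ n c H).symm).limUnder_eq

theorem norm_extPair_le (hα : 0 ≤ α) (hρ : tsupport ρ ⊆ Metric.ball 0 1)
    (hg : SummableKern α g ρ) (hK : IsCompact K) (h : AvgRate α ρ K B H) {C : ℝ}
    (hC : ∀ x, ‖H x‖ ≤ C) :
    ‖extPair g ρ H‖ ≤ C * ((∫ w, ‖ρ w‖) * ∫ x in Metric.cthickening 1 K, ‖kern g ρ 0 x‖) +
      B * kernTail α g ρ K 0 := by
  have htriangle := norm_sub_norm_le (extPair g ρ H) (scalePair g ρ 0 H)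
  rw [norm_sub_rev] at htriangle
  linarith [norm_scalePair_le g hρ hK 0 h.tsupport_subset hC,
    h.norm_scalePair_sub_extPair_le hα hρ hg hK 0]

theorem tendsto_scalePair_of_tendstoUniformly (g : Distr E) (hρ : tsupport ρ ⊆ Metric.ball 0 1)
    (hK : IsCompact K) {φ : ℕ → E → ℂ} (hφ : ∀ j, Continuous (φ j))
    (hφK : ∀ j, tsupport (φ j) ⊆ K) (hH : Continuous H) (hHK : tsupport H ⊆ K)
    (hlim : TendstoUniformly φ H atTop) (n : ℕ) :
    Tendsto (fun j => scalePair g ρ n (φ j)) atTop (𝓝 (scalePair g ρ n H)) := by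
  have hc {f : E → ℂ} (hf : tsupport f ⊆ K) : HasCompactSupport f :=
    .of_support_subset_isCompact hK ((subset_tsupport f).trans hf)
  have hsub (j : ℕ) : tsupport (fun z => φ j z - H z) ⊆ K :=
    (tsupport_sub _ _).trans (Set.union_subset (hφK j) hHK)
  have hsplit (j : ℕ) :
      scalePair g ρ n (φ j) = scalePair g ρ n H + scalePair g ρ n fun z => φ j z - H z := by
    rw [← scalePair_add (H' := fun z => φ j z - H z) g ρ n hH (hc hHK) ((hφ j).sub hH)
      (hc (hsub j))]
    simp only [add_sub_cancel]
  set R := (∫ w, ‖ρ w‖) * ∫ x in Metric.cthickening 1 K, ‖kern g ρ n x‖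
  have : 0 ≤ R := by positivity
  rw [Metric.tendsto_nhds]
  intro ε hε
  filter_upwards [Metric.tendstoUniformly_iff.1 hlim (ε / (R + 1)) (by positivity)] with j hj
  rw [hsplit, dist_eq_norm, add_sub_cancel_left]
  have hbound : ∀ x, ‖φ j x - H x‖ ≤ ε / (R + 1) := fun x => by
    rw [← dist_eq_norm, dist_comm]; exact (hj x).le
  refine (norm_scalePair_le g hρ hK n (hsub j) hbound).trans_lt ?_
  rw [div_mul_eq_mul_div, div_lt_iff₀ (by positivity)]
  linarith

/-- By the common rate, the limits in the scale and along the sequence may be interchanged. -/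
theorem tendsto_pair_of_avgRate (hα : 0 ≤ α) (hρ : tsupport ρ ⊆ Metric.ball 0 1)
    (hρ1 : ∫ w, ρ w = 1) (hg : SummableKern α g ρ) (hK : IsCompact K) {φ : ℕ → E → ℂ}
    (hφ : ∀ j, IsTest (φ j)) (hφB : ∀ j, AvgRate α ρ K B (φ j)) {C : ℝ}
    (hHC : AvgRate α ρ K C H) (hlim : TendstoUniformly φ H atTop) :
    Tendsto (fun j => pair g (φ j)) atTop (𝓝 (extPair g ρ H)) := by
  have huniform : TendstoUniformly (fun n j => scalePair g ρ n (φ j)) (fun j => pair g (φ j))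
      atTop := by
    refine Metric.tendstoUniformly_iff.2 fun ε hε => ?_
    have htail : Tendsto (fun n => B * kernTail α g ρ K n) atTop (𝓝 0) := by
      simpa only [mul_zero] using tendsto_kernTail.const_mul B
    filter_upwards [htail.eventually_lt_const hε] with n hn j
    rw [dist_comm, dist_eq_norm, ← extPair_eq_pair g hρ hρ1 (hφ j)]
    exact ((hφB j).norm_scalePair_sub_extPair_le hα hρ hg hK n).trans_lt hn
  have hscale := tendsto_scalePair_of_tendstoUniformly g hρ hK (fun j => (hφB j).continuous)
    (fun j => (hφB j).tsupport_subset) hHC.continuous hHC.tsupport_subset hlim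
  exact (huniform.tendstoUniformlyOnFilter.mono_right le_top).tendsto_of_eventually_tendsto
    (Eventually.of_forall hscale) (hHC.tendsto_scalePair hα hρ hg hK)

end Rates

section Smear

variable {E : Type} [NormedAddCommGroup E] [NormedSpace ℝ E] {κ η F : E → ℂ}

theorem IsTest.ofReal_mul_ofReal (χ ψ : Test E) : IsTest fun x => (χ x : ℂ) * (ψ x : ℂ) :=
  (IsTest.ofReal χ).mul_right (IsTest.ofReal ψ).smooth

theorem exists_cthickening_subset {χ : Test E} {U : Set E} (hU : IsOpen U)
    (hχU : tsupport χ ⊆ U) : ∃ ε : ℝ, 0 < ε ∧ ∀ ψ : E → ℂ,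
      Metric.cthickening ε (tsupport fun x => (χ x : ℂ) * ψ x) ⊆ U := by
  obtain ⟨ε, hε, h⟩ := χ.hasCompactSupport.isCompact.exists_cthickening_subset_open hU hχU
  refine ⟨ε, hε, fun ψ => (Metric.cthickening_subset_of_subset _ ?_).trans h⟩
  exact tsupport_mul_subset_left.trans (tsupport_comp_subset (g := Complex.ofReal) rfl χ)

theorem isTest_smear_kernel (hη : IsTest η) (Θ : Test (E × E)) :
    IsTest fun r : (E × E) × E => η r.1.1 * (Θ (r.1.1 - r.1.2, r.1.1 - r.2) : ℂ) := by
  refine ⟨(hη.smooth.comp (by fun_prop)).mul ((IsTest.ofReal Θ).smooth.comp (by fun_prop)), ?_⟩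
  refine HasCompactSupport.intro ((hη.compact.isCompact.prod Θ.hasCompactSupport.isCompact).image
    (f := fun q : E × (E × E) => ((q.1, q.1 - q.2.1), q.1 - q.2.2)) (by fun_prop)) ?_
  rintro ⟨⟨x, y⟩, z⟩ hnotMem
  contrapose! hnotMem with hne
  have hx : η x ≠ 0 := left_ne_zero_of_mul hne
  have hxyz : Θ (x - y, x - z) ≠ 0 := fun h => hne (by simp [h])
  exact ⟨(x, (x - y, x - z)), ⟨subset_tsupport _ hx, subset_tsupport _ hxyz⟩, by simp⟩

variable [FiniteDimensional ℝ E] [MeasureSpace E] [BorelSpace E]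
  [(volume : Measure E).IsAddHaarMeasure]

/-- The function whose pairing with `g` is the pairing of `η` with the regularization of `F ⊗ g`
by `Θ`, restricted to the diagonal. -/
def smear (η F : E → ℂ) (Θ : Test (E × E)) (z : E) : ℂ :=
  ∫ q : E × E, F q.2 * (η q.1 * (Θ (q.1 - q.2, q.1 - z) : ℂ))

/-- The integrand of `κ * smear η F Θ`, as a density against `Θ`. -/
def shiftedProduct (κ η F : E → ℂ) (q : E × E) (z : E) : ℂ :=
  κ z * (η (z + q.2) * F (z + q.2 - q.1))

theorem isTest_smear (hη : IsTest η) (hF : Continuous F) (Θ : Test (E × E)) :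
    IsTest (smear η F Θ) :=
  isTest_integral (hF.comp continuous_snd) (isTest_smear_kernel hη Θ)

theorem smear_eq (hη : IsTest η) (hF : Continuous F) (Θ : Test (E × E)) (z : E) :
    smear η F Θ z = ∫ q : E × E, η (z + q.2) * F (z + q.2 - q.1) * (Θ q : ℂ) := by
  have hint : Integrable fun q : E × E => F q.2 * (η q.1 * (Θ (q.1 - q.2, q.1 - z) : ℂ)) :=
    integrable_mul_of_isTest (hF.comp continuous_snd) ((isTest_smear_kernel hη Θ).slice_left z)
  have hcont : Continuous fun q : E × E => η (z + q.2) * F (z + q.2 - q.1) := by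
    have := hη.continuous
    fun_prop
  have hint' : Integrable fun q : E × E => η (z + q.2) * F (z + q.2 - q.1) * (Θ q : ℂ) :=
    integrable_mul_of_isTest hcont (IsTest.ofReal Θ)
  rw [smear]
  refine (integral_prod _ hint).trans (Eq.trans ?_ (integral_prod_symm _ hint').symm)
  rw [← integral_add_left_eq_self (μ := volume) _ z]
  congr 1 with b
  rw [← integral_sub_left_eq_self (μ := volume) _ (z + b)]
  congr 1 with a
  simp only [sub_sub_cancel, add_sub_cancel_left]
  ring

theorem tsupport_smear_subset (hη : IsTest η) (hF : Continuous F) {Θ : Test (E × E)} {ε : ℝ}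
    (hΘ : tsupport Θ ⊆ Metric.ball 0 ε) :
    tsupport (smear η F Θ) ⊆ Metric.cthickening ε (tsupport η) := by
  refine closure_minimal (fun z hz => ?_) Metric.isClosed_cthickening
  contrapose! hz
  rw [Function.notMem_support, smear_eq hη hF]
  refine integral_eq_zero_of_ae (Eventually.of_forall fun q => ?_)
  by_cases hq : q ∈ tsupport Θ
  · have hzq : z + q.2 ∉ tsupport η := fun h => by
      have hqε : ‖q‖ < ε := by simpa using hΘ hq
      refine hz (Metric.mem_cthickening_of_dist_le z (z + q.2) _ _ h ?_)
      rw [dist_self_add_right]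
      exact (norm_snd_le q).trans hqε.le
    simp [image_eq_zero_of_notMem_tsupport hzq]
  · simp [image_eq_zero_of_notMem_tsupport hq]

theorem mul_smear_eq (κ : E → ℂ) (hη : IsTest η) (hF : Continuous F) (Θ : Test (E × E)) (z : E) :
    κ z * smear η F Θ z = ∫ q, shiftedProduct κ η F q z * Θ q := by
  simp only [smear_eq hη hF, ← integral_const_mul, shiftedProduct, mul_assoc]

end Smear

section ShiftedProduct

variable {E : Type} [NormedAddCommGroup E] {κ η F : E → ℂ}

theorem continuous_uncurry_shiftedProduct (hκ : Continuous κ) (hη : Continuous η)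
    (hF : Continuous F) : Continuous (Function.uncurry (shiftedProduct κ η F)) := by
  simp only [Function.uncurry_def, shiftedProduct]
  fun_prop

theorem hasCompactSupport_uncurry_shiftedProduct (hκ : HasCompactSupport κ)
    (hη : HasCompactSupport η) (hF : HasCompactSupport F) :
    HasCompactSupport (Function.uncurry (shiftedProduct κ η F)) := by
  refine HasCompactSupport.intro (((hκ.isCompact.prod hη.isCompact).prod hF.isCompact).image
    (f := fun r : (E × E) × E => ((r.1.2 - r.2, r.1.2 - r.1.1), r.1.1)) (by fun_prop)) ?_
  rintro ⟨⟨a, b⟩, z⟩ hnotMem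
  contrapose! hnotMem with hne
  simp only [Function.uncurry_apply_pair, shiftedProduct, mul_ne_zero_iff] at hne
  exact ⟨((z, z + b), z + b - a), ⟨⟨subset_tsupport _ hne.1, subset_tsupport _ hne.2.1⟩,
    subset_tsupport _ hne.2.2⟩, by simp⟩

theorem tsupport_shiftedProduct_subset (κ η F : E → ℂ) (q : E × E) :
    tsupport (shiftedProduct κ η F q) ⊆ tsupport κ :=
  tsupport_mul_subset_left

variable [NormedSpace ℝ E]

theorem exists_approxAt_shiftedProduct {α A : ℝ} {m n : ℕ} {χ : E → ℂ} (hκ : IsTest κ)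
    (hχ : IsTest χ) (hα : 0 < α) (hαm : α ≤ m + 1) (hF : ∀ x, ApproxAt α n A F x) :
    ∃ D : ℝ, 0 ≤ D ∧ ∀ ψ : E → ℂ, ContDiff ℝ ∞ ψ → ∀ S : ℝ, CkNormLE (m + 1) ψ S → ∀ q x,
      ApproxAt α (m + (m + m + n)) (D * S) (shiftedProduct κ (fun y => χ y * ψ y) F q) x := by
  obtain ⟨B, hB⟩ := hκ.exists_approxAt hαm
  obtain ⟨C, hC⟩ := hχ.exists_approxAt hαm
  have hA0 := (hF 0).nonneg
  have hB0 := (hB 0).nonneg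
  have hC0 := (hC 0).nonneg
  refine ⟨3 * B * (3 * (3 * C * (m + 1)) * A), by positivity, fun ψ hψ S hS q x => ?_⟩
  have hψA := approxAt_of_contDiff (hψ.of_le (mod_cast le_top)) hαm hS
  have hprod := (hB x).mul hα (((hC (x + q.2)).comp_add_right.mul hα
    (hψA (x + q.2)).comp_add_right).mul hα (hF (x + (q.2 - q.1))).comp_add_right)
  simp only [← add_sub_assoc] at hprod
  exact hprod.mono (le_of_eq (by ring))

end ShiftedProduct

section DeltaSeq

variable {P : Type} [NormedAddCommGroup P] [NormedSpace ℝ P] [MeasureSpace P] [BorelSpace P]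
  [IsLocallyFiniteMeasure (volume : Measure P)] {Θ : ℕ → Test P}

theorem IsDeltaSeq.tendstoUniformly_integral_mul {ι : Type} {H : P → ι → ℂ} (hΘ : IsDeltaSeq Θ)
    (hH : ∀ z, Continuous fun q => H q z) (hH0 : TendstoUniformly H (H 0) (𝓝 0)) :
    TendstoUniformly (fun j z => ∫ q, H q z * Θ j q) (H 0) atTop := by
  obtain ⟨C, hC⟩ := hΘ.bounded
  have hC0 : 0 ≤ C := (integral_nonneg fun _ => norm_nonneg _).trans (hC 0)
  refine Metric.tendstoUniformly_iff.2 fun ε hε => ?_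
  obtain ⟨δ, hδ, hHδ⟩ := Metric.eventually_nhds_iff_ball.1
    (Metric.tendstoUniformly_iff.1 hH0 (ε / (C + 1)) (by positivity))
  filter_upwards [hΘ.shrinking δ hδ] with j hj z
  have hclose : ∀ q ∈ tsupport (Θ j), ‖H q z - H 0 z‖ ≤ ε / (C + 1) := fun q hq => by
    rw [← dist_eq_norm, dist_comm]
    exact (hHδ q (hj hq) z).le
  rw [dist_comm, dist_eq_norm]
  calc _ ≤ ε / (C + 1) * ∫ q, ‖Θ j q‖ :=
        norm_integral_mul_test_sub_le (hΘ.integral_eq_one j) (hH z) hclose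
    _ ≤ ε / (C + 1) * C := by gcongr; exact hC j
    _ < ε := by
        rw [div_mul_eq_mul_div, div_lt_iff₀ (by positivity)]
        linarith

theorem IsDeltaSeq.tendsto_integral_mul {G : P → ℂ} (hΘ : IsDeltaSeq Θ) (hG : Continuous G) :
    Tendsto (fun j => ∫ q, G q * Θ j q) atTop (𝓝 (G 0)) :=
  (hΘ.tendstoUniformly_integral_mul (H := fun q (_ : Unit) => G q) (fun _ => hG)
    (tendstoUniformlyOn_univ.1 ((hG.tendsto 0).tendstoUniformlyOn_const _))).tendsto_at ()

theorem IsDeltaSeq.tendstoUniformly_integral_mul_of_hasCompactSupport {E : Type}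
    [NormedAddCommGroup E] {H : P → E → ℂ} (hΘ : IsDeltaSeq Θ)
    (hH : Continuous (Function.uncurry H)) (hHc : HasCompactSupport (Function.uncurry H)) :
    TendstoUniformly (fun j z => ∫ q, H q z * Θ j q) (H 0) atTop := by
  refine hΘ.tendstoUniformly_integral_mul (fun z => hH.comp (.prodMk_left z)) ?_
  refine Metric.tendstoUniformly_iff.2 fun ε hε => ?_
  obtain ⟨δ, hδ, hHδ⟩ := Metric.uniformContinuous_iff.1
    (hHc.uniformContinuous_of_continuous hH) ε hε
  filter_upwards [Metric.ball_mem_nhds 0 hδ] with q hq z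
  exact hHδ (a := (0, z)) (b := (q, z)) (by simpa [Prod.dist_eq] using hq)

end DeltaSeq

section ParametricAverage

variable {P E : Type} [NormedAddCommGroup P] [NormedSpace ℝ P] [FiniteDimensional ℝ P]
  [MeasureSpace P] [BorelSpace P] [IsLocallyFiniteMeasure (volume : Measure P)]
  [NormedAddCommGroup E] [NormedSpace ℝ E] [FiniteDimensional ℝ E] [MeasureSpace E]
  [BorelSpace E] [IsLocallyFiniteMeasure (volume : Measure E)] {H : P → E → ℂ}

theorem norm_avg_integral_sub_le {b : ℝ}
    (hH : Continuous (Function.uncurry H)) (ρ : Test E) (n : ℕ) {x : E}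
    (hb : ∀ q, ‖avg ρ n (H q) x - H q x‖ ≤ b) (Θ : Test P) :
    ‖avg ρ n (fun z => ∫ q, H q z * Θ q) x - ∫ q, H q x * Θ q‖ ≤ b * ∫ q, ‖Θ q‖ := by
  have hint : Integrable
      (fun r : E × P => H r.2 (x + (1 / 2 : ℝ) ^ n • r.1) * (Θ r.2 : ℂ) * (ρ r.1 : ℂ))
      ((volume : Measure E).prod volume) := by
    have hcont : Continuous fun r : E × P => H r.2 (x + (1 / 2 : ℝ) ^ n • r.1) :=
      hH.comp (continuous_snd.prodMk (by fun_prop))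
    refine Continuous.integrable_of_hasCompactSupport
      ((hcont.mul ((IsTest.ofReal Θ).continuous.comp continuous_snd)).mul
        ((IsTest.ofReal ρ).continuous.comp continuous_fst))
      (.intro (ρ.hasCompactSupport.isCompact.prod Θ.hasCompactSupport.isCompact) ?_)
    rintro ⟨w, q⟩ h
    simp only [Set.mem_prod, not_and_or] at h
    rcases h with h | h <;> simp [image_eq_zero_of_notMem_tsupport h]
  have hswap (q : P) :
      ∫ w, H q (x + (1 / 2 : ℝ) ^ n • w) * (Θ q : ℂ) * (ρ w : ℂ) = avg ρ n (H q) x * Θ q := by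
    simp only [avg, ← integral_mul_const, mul_right_comm _ (Θ q : ℂ)]
  have havg : avg ρ n (fun z => ∫ q, H q z * Θ q) x = ∫ q, avg ρ n (H q) x * Θ q := by
    simp only [← hswap]
    rw [← integral_integral_swap hint]
    simp only [avg, ← integral_mul_const]
  have havg_int : Integrable fun q => avg ρ n (H q) x * (Θ q : ℂ) :=
    hint.integral_prod_right.congr (Eventually.of_forall hswap)
  have hH_int : Integrable fun q => H q x * (Θ q : ℂ) :=
    integrable_mul_of_isTest (hH.comp (continuous_id.prodMk continuous_const)) (.ofReal Θ)
  rw [havg, ← integral_sub havg_int hH_int]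
  simp only [← sub_mul]
  exact norm_integral_mul_test_le fun q _ => hb q

end ParametricAverage

section SmearLimit

variable {E : Type} [NormedAddCommGroup E] [NormedSpace ℝ E] [FiniteDimensional ℝ E]
  [MeasureSpace E] [BorelSpace E] [(volume : Measure E).IsAddHaarMeasure] {α A : ℝ} {m n : ℕ}
  {ρ : Test E} {g' : Distr E} {κ F : E → ℂ}

theorem IsReproducing.exists_avgRate_shiftedProduct (hρ : IsReproducing (m + (m + m + n)) ρ)
    (hκ : IsTest κ) (χ : Test E) (hα : 0 < α) (hαm : α ≤ m + 1) (hF : Continuous F)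
    (hFA : ∀ x, ApproxAt α n A F x) :
    ∃ D : ℝ, 0 ≤ D ∧ ∀ ψ : E → ℂ, IsTest ψ → ∀ S : ℝ, CkNormLE (m + 1) ψ S → ∀ q,
      AvgRate α ρ (tsupport κ) (D * S) (shiftedProduct κ (fun y => χ y * ψ y) F q) ∧
      ∀ x, ‖shiftedProduct κ (fun y => χ y * ψ y) F q x‖ ≤ D * S := by
  have hχ := IsTest.ofReal χ
  obtain ⟨D, hD, hDψ⟩ := exists_approxAt_shiftedProduct hκ hχ hα hαm hFA
  have hR : 0 ≤ ∫ w, ‖ρ w‖ := by positivity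
  refine ⟨D * (1 + ∫ w, ‖ρ w‖), by positivity, fun ψ hψ S hS q => ?_⟩
  have hS0 := hS.nonneg
  have happrox := hDψ ψ hψ.smooth S hS q
  have hcont : Continuous (shiftedProduct κ (fun y => χ y * ψ y) F q) :=
    (continuous_uncurry_shiftedProduct hκ.continuous (hχ.continuous.mul hψ.continuous) hF).comp
      (continuous_const.prodMk continuous_id)
  have hrate : AvgRate α ρ (tsupport κ) (D * S * ∫ w, ‖ρ w‖)
      (shiftedProduct κ (fun y => χ y * ψ y) F q) :=
    ⟨hcont, tsupport_shiftedProduct_subset _ _ _ q,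
      fun k x => hρ.norm_avg_sub_le hα hcont (happrox x) k⟩
  have hDS : 0 ≤ D * S := by positivity
  exact ⟨hrate.mono (by nlinarith), fun x => ((happrox x).norm_le hα).trans (by nlinarith)⟩

theorem IsReproducing.exists_distr_eq_extPair (hρ : IsReproducing (m + (m + m + n)) ρ)
    (hκ : IsTest κ) (χ : Test E) (hα : 0 < α) (hαm : α ≤ m + 1) (hF : Continuous F)
    (hFA : ∀ x, ApproxAt α n A F x) (hg : SummableKern α g' ρ) :
    ∃ T : Distr E, ∀ ψ : Test E,
      T ψ = extPair g' ρ (shiftedProduct κ (fun y => (χ y : ℂ) * ψ y) F 0) := by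
  have hK : IsCompact (tsupport κ) := hκ.compact.isCompact
  obtain ⟨D, _, hDψ⟩ := hρ.exists_avgRate_shiftedProduct hκ χ hα hαm hF hFA
  have hrate (ψ : Test E) : ∃ B, AvgRate α ρ (tsupport κ) B
      (shiftedProduct κ (fun y => (χ y : ℂ) * ψ y) F 0) := by
    obtain ⟨S, hS⟩ := (IsTest.ofReal ψ).exists_ckNormLE (m + 1)
    exact ⟨_, (hDψ _ (.ofReal ψ) S hS 0).1⟩
  set R := (∫ w, ‖ρ w‖) * ∫ x in Metric.cthickening 1 (tsupport κ), ‖kern g' ρ 0 x‖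
  refine ⟨mkDistr (fun ψ => extPair g' ρ (shiftedProduct κ (fun y => (χ y : ℂ) * ψ y) F 0))
    (fun φ ψ => ?_) (fun c ψ => ?_) fun _ _ =>
      ⟨m + 1, |D * R + D * kernTail α g' ρ (tsupport κ) 0|, abs_nonneg _, fun ψ _ S hS => ?_⟩,
    fun _ => rfl⟩
  · obtain ⟨B, hB⟩ := hrate φ
    obtain ⟨C, hC⟩ := hrate ψ
    rw [← extPair_add hα.le hρ.tsupport_subset hg hK hB hC]
    congr 1 with z
    simp only [shiftedProduct, FunLike.coe_add, Pi.add_apply, Complex.ofReal_add]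
    ring
  · obtain ⟨B, hB⟩ := hrate ψ
    rw [Complex.real_smul, ← extPair_const_mul hα.le hρ.tsupport_subset hg hK hB]
    congr 1 with z
    simp only [shiftedProduct, FunLike.coe_smul, Pi.smul_apply, smul_eq_mul, Complex.ofReal_mul]
    ring
  · obtain ⟨hB, hbound⟩ := hDψ _ (.ofReal ψ) S (IsTest.ckNormLE_ofReal hS) 0
    have hS0 := hS.nonneg
    calc _ ≤ (D * R + D * kernTail α g' ρ (tsupport κ) 0) * S :=
          (norm_extPair_le hα.le hρ.tsupport_subset hg hK hB hbound).trans_eq (by ring)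
      _ ≤ _ := by gcongr; exact le_abs_self _

theorem tendsto_pair_mul_smear (hρ : IsReproducing (m + (m + m + n)) ρ)
    (hκ : IsTest κ) (χ : Test E) (hα : 0 < α) (hαm : α ≤ m + 1) (hF : Continuous F)
    (hFc : HasCompactSupport F) (hFA : ∀ x, ApproxAt α n A F x) (hg : SummableKern α g' ρ)
    {Θ : ℕ → Test (E × E)} (hΘ : IsDeltaSeq Θ) (ψ : Test E) :
    Tendsto (fun j => pair g' fun z => κ z * smear (fun y => (χ y : ℂ) * ψ y) F (Θ j) z) atTop
      (𝓝 (extPair g' ρ (shiftedProduct κ (fun y => (χ y : ℂ) * ψ y) F 0))) := by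
  have hη := IsTest.ofReal_mul_ofReal χ ψ
  have hcont := continuous_uncurry_shiftedProduct hκ.continuous hη.continuous hF
  have htest (j : ℕ) : IsTest fun z => κ z * smear (fun y => (χ y : ℂ) * ψ y) F (Θ j) z :=
    (isTest_smear hη hF (Θ j)).mul_left hκ.smooth
  obtain ⟨D, hD, hDψ⟩ := hρ.exists_avgRate_shiftedProduct hκ χ hα hαm hF hFA
  obtain ⟨S, hS⟩ := (IsTest.ofReal ψ).exists_ckNormLE (m + 1)
  have hrate := hDψ _ (.ofReal ψ) S hS
  have hS0 := hS.nonneg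
  obtain ⟨C, hC⟩ := hΘ.bounded
  refine tendsto_pair_of_avgRate (B := D * S * C) hα.le hρ.tsupport_subset hρ.integral_eq_one hg
    hκ.compact.isCompact htest
    (fun j => ⟨(htest j).continuous, tsupport_mul_subset_left, fun k x => ?_⟩) (hrate 0).1 ?_
  · simp only [mul_smear_eq κ hη hF]
    refine (norm_avg_integral_sub_le hcont ρ k (fun q => (hrate q).1.norm_avg_sub_le k x)
      (Θ j)).trans ?_
    rw [mul_right_comm]
    gcongr
    exact hC j
  · simp only [mul_smear_eq κ hη hF]
    exact hΘ.tendstoUniformly_integral_mul_of_hasCompactSupport hcont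
      (hasCompactSupport_uncurry_shiftedProduct hκ.compact hη.compact hFc)

theorem exists_distr_tendsto_smear {g : Distr E} (hκ : IsTest κ) (χ : Test E) {V : Set E}
    (hV : IsOpen V) (hχV : tsupport χ ⊆ V)
    (hg : ∀ φ, IsTest φ → tsupport φ ⊆ V → pair g φ = pair g' fun z => κ z * φ z)
    (hF : Continuous F) (hFc : HasCompactSupport F) (hα : 0 < α)
    (hFA : ∀ x, ApproxAt α n A F x)
    (hsum : ∀ ρ : Test E, tsupport ρ ⊆ Metric.ball 0 1 → SummableKern α g' ρ) :
    ∃ T : Distr E, ∀ Θ : ℕ → Test (E × E), IsDeltaSeq Θ → ∀ ψ : Test E,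
      Tendsto (fun j => pair g (smear (fun x => (χ x : ℂ) * ψ x) F (Θ j))) atTop (𝓝 (T ψ)) := by
  have hαm : α ≤ ⌈α⌉₊ + 1 := (Nat.le_ceil α).trans (le_add_of_nonneg_right zero_le_one)
  obtain ⟨ρ, hρ⟩ := exists_isReproducing E (⌈α⌉₊ + (⌈α⌉₊ + ⌈α⌉₊ + n))
  have hgρ := hsum ρ hρ.tsupport_subset
  obtain ⟨T, hT⟩ := hρ.exists_distr_eq_extPair hκ χ hα hαm hF hFA hgρ
  refine ⟨T, fun Θ hΘ ψ => ?_⟩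
  rw [hT]
  refine (tendsto_pair_mul_smear hρ hκ χ hα hαm hF hFc hFA hgρ hΘ ψ).congr' ?_
  have hη := IsTest.ofReal_mul_ofReal χ ψ
  obtain ⟨δ, hδ, hδV⟩ := exists_cthickening_subset hV hχV
  filter_upwards [hΘ.shrinking δ hδ] with j hj
  exact (hg _ (isTest_smear hη hF (Θ j)) ((tsupport_smear_subset hη hF hj).trans (hδV _))).symm

end SmearLimit

section Localize

variable {E : Type} [NormedAddCommGroup E] [NormedSpace ℝ E]

theorem pair_localize (φ : CTest E) (f : Distr E) {η : E → ℂ} (hη : IsTest η) :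
    pair (localize φ f) η = pair f fun x => φ x * η x := by
  have hφ : IsTest φ := ⟨φ.contDiff, φ.hasCompactSupport⟩
  have hreal (ψ : Test E) : localize φ f ψ = pair f fun x => φ x * ψ x := by
    rw [pair_eq f (hφ.mul_right (IsTest.ofReal ψ).smooth)]
    refine congrArg₂ (fun a b => f a + Complex.I * f b) ?_ ?_ <;> ext x <;>
      simp [IsTest.realPart_apply, mulCLM, mul_comm]
  have hre := hφ.mul_right (IsTest.ofReal (hη.realPart Complex.reCLM)).smooth
  have him := hφ.mul_right (IsTest.ofReal (hη.realPart Complex.imCLM)).smooth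
  rw [pair_eq _ hη, hreal, hreal, ← pair_const_mul f him, ← pair_add f hre (him.const_mul _)]
  congr 1 with x
  simp only [IsTest.realPart_apply, Complex.reCLM_apply, Complex.imCLM_apply]
  conv_rhs => rw [← Complex.re_add_im (η x)]
  ring

theorem exists_distr_pair_mul (g : Distr E) {φ : E → ℂ} (hφ : IsTest φ) :
    ∃ T : Distr E, ∀ ψ : Test E, T ψ = pair g fun z => φ z * ψ z :=
  ⟨localize ⟨φ, hφ.smooth, hφ.compact, fun _ _ => trivial⟩ g, fun ψ => by
    rw [← pair_ofReal, pair_localize _ _ (IsTest.ofReal ψ)]; rfl⟩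

end Localize

section Diagonal

variable {E : Type} [NormedAddCommGroup E] [NormedSpace ℝ E] {Θ : Test (E × E)} {ε : ℝ}

theorem tsupport_pair_reflect_subset (g : Distr E) (hΘ : tsupport Θ ⊆ Metric.ball 0 ε) (x : E) :
    tsupport (fun y => pair g fun z => (Θ (x - y, x - z) : ℂ)) ⊆ Metric.cthickening ε {x} := by
  refine closure_minimal (fun y hy => ?_) Metric.isClosed_cthickening
  by_contra hy'
  have hzero (z : E) : Θ (x - y, x - z) = 0 := by
    by_contra h
    have hlt : ‖(x - y, x - z)‖ < ε := by simpa using hΘ (subset_tsupport _ h)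
    refine hy' (Metric.mem_cthickening_of_dist_le y x _ _ rfl ?_)
    rw [dist_comm, dist_eq_norm]
    exact (norm_fst_le (x - y, x - z)).trans hlt.le
  exact hy (by simp [hzero, pair_zero])

theorem tsupport_reflect_subset (hΘ : tsupport Θ ⊆ Metric.ball 0 ε) (x y : E) :
    tsupport (fun z => (Θ (x - y, x - z) : ℂ)) ⊆ Metric.cthickening ε {x} := by
  refine closure_minimal (fun z hz => ?_) Metric.isClosed_cthickening
  have hne : Θ (x - y, x - z) ≠ 0 := fun h => hz (by simp [h])
  have hlt : ‖(x - y, x - z)‖ < ε := by simpa using hΘ (subset_tsupport _ hne)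
  refine Metric.mem_cthickening_of_dist_le z x _ _ rfl ?_
  rw [dist_comm, dist_eq_norm]
  exact (norm_snd_le (x - y, x - z)).trans hlt.le

/-- The test function with exchanged arguments. -/
def swapTest (Θ : Test (E × E)) : Test (E × E) where
  toFun q := Θ (q.2, q.1)
  contDiff' := Θ.contDiff.comp (contDiff_snd.prodMk contDiff_fst)
  hasCompactSupport' := Θ.hasCompactSupport.comp_homeomorph (Homeomorph.prodComm E E)
  tsupport_subset' := fun _ _ => trivial

theorem regularize_tensor [FiniteDimensional ℝ E] (f g : Distr E) (Θ : Test (E × E)) (x : E) :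
    regularize (tensor f g) Θ (x, x)
      = pair f fun y => pair g fun z => (Θ (x - y, x - z) : ℂ) := rfl

variable [MeasureSpace E]

theorem IsDeltaSeq.swap [SFinite (volume : Measure E)] {Θ : ℕ → Test (E × E)}
    (h : IsDeltaSeq Θ) : IsDeltaSeq fun n => swapTest (Θ n) := by
  have hswap (G : E × E → ℝ) : ∫ q : E × E, G (q.2, q.1) = ∫ q, G q :=
    integral_prod_swap (μ := volume) (ν := volume) G
  refine ⟨fun n => (hswap _).trans (h.integral_eq_one n), ?_, fun ε hε => ?_⟩
  · obtain ⟨C, hC⟩ := h.bounded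
    exact ⟨C, fun n => (hswap fun q => ‖Θ n q‖).trans_le (hC n)⟩
  · filter_upwards [h.shrinking ε hε] with n hn q hq
    have hsupp : tsupport (swapTest (Θ n)) = Homeomorph.prodComm E E ⁻¹' tsupport (Θ n) :=
      tsupport_comp_eq_preimage (Θ n) (Homeomorph.prodComm E E)
    rw [hsupp] at hq
    simpa [Prod.norm_def, max_comm] using hn hq

/-- `f` is given by the function `F` on `U`. -/
def EqFunOn (f : Distr E) (F : E → ℂ) (U : Set E) : Prop :=
  ∀ φ, IsTest φ → tsupport φ ⊆ U → pair f φ = ∫ y, F y * φ y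

variable [FiniteDimensional ℝ E] [BorelSpace E] [(volume : Measure E).IsAddHaarMeasure]

theorem integral_mul_integral_pair (g : Distr E) {η F : E → ℂ} (hη : IsTest η)
    (hF : Continuous F) (Θ : Test (E × E)) :
    ∫ x, η x * ∫ y, F y * pair g (fun z => (Θ (x - y, x - z) : ℂ)) = pair g (smear η F Θ) := by
  have hkernel := isTest_smear_kernel hη Θ
  have hF₂ : Continuous fun q : E × E => F q.2 := hF.comp continuous_snd
  refine Eq.trans ?_ ((integral_prod _ (integrable_mul_of_isTest hF₂ (hkernel.partialPair g))).symm
    |>.trans (integral_mul_partialPair g hF₂ hkernel))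
  congr 1 with x
  rw [← integral_const_mul]
  congr 1 with y
  have hslice : IsTest fun z => (Θ (x - y, x - z) : ℂ) :=
    (IsTest.ofReal (reflect Θ (x, x))).slice y
  simp only [partialPair, pair_const_mul g hslice]
  ring

theorem integral_mul_regularize_left {f : Distr E} (g : Distr E) {η F : E → ℂ} (hη : IsTest η)
    (hF : Continuous F) {U : Set E} (hf : EqFunOn f F U)
    (hU : Metric.cthickening ε (tsupport η) ⊆ U) (hΘ : tsupport Θ ⊆ Metric.ball 0 ε) :
    ∫ x, η x * regularize (tensor f g) Θ (x, x) = pair g (smear η F Θ) := by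
  rw [← integral_mul_integral_pair g hη hF]
  congr 1 with x
  by_cases hx : x ∈ tsupport η
  · have hpartial : IsTest fun y => pair g fun z => (Θ (x - y, x - z) : ℂ) :=
      (IsTest.ofReal (reflect Θ (x, x))).partialPair g
    rw [regularize_tensor, hf _ hpartial]
    refine (tsupport_pair_reflect_subset g hΘ x).trans (Set.Subset.trans ?_ hU)
    exact Metric.cthickening_subset_of_subset _ (Set.singleton_subset_iff.2 hx)
  · rw [image_eq_zero_of_notMem_tsupport hx, zero_mul, zero_mul]

theorem integral_mul_regularize_right (f : Distr E) {g : Distr E} {η G : E → ℂ} (hη : IsTest η)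
    (hG : Continuous G) {U : Set E} (hg : EqFunOn g G U)
    (hU : Metric.cthickening ε (tsupport η) ⊆ U) (hΘ : tsupport Θ ⊆ Metric.ball 0 ε) :
    ∫ x, η x * regularize (tensor f g) Θ (x, x) = pair f (smear η G (swapTest Θ)) := by
  rw [← integral_mul_integral_pair f hη hG]
  congr 1 with x
  by_cases hx : x ∈ tsupport η
  · have hΘx := IsTest.ofReal (reflect Θ (x, x))
    have hpair : (fun y => pair g fun z => (Θ (x - y, x - z) : ℂ))
        = fun y => ∫ z, G z * (Θ (x - y, x - z) : ℂ) := by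
      ext y
      refine hg _ (hΘx.slice y) ((tsupport_reflect_subset hΘ x y).trans (.trans ?_ hU))
      exact Metric.cthickening_subset_of_subset _ (Set.singleton_subset_iff.2 hx)
    rw [regularize_tensor, hpair]
    congr 1
    exact (integral_mul_partialPair f hG hΘx.comp_swap).symm
  · rw [image_eq_zero_of_notMem_tsupport hx, zero_mul, zero_mul]

theorem tendsto_pair_smear (g : Distr E) {η F : E → ℂ} (hη : IsTest η) (hF : IsTest F)
    {Θ : ℕ → Test (E × E)} (hΘ : IsDeltaSeq Θ) :
    Tendsto (fun n => pair g (smear η F (Θ n))) atTop (𝓝 (pair g fun z => η z * F z)) := by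
  obtain ⟨ζ, -, hζ⟩ := exists_cutoff hη.compact.isCompact isOpen_univ (Set.subset_univ _)
  set κ : E → ℂ := fun z => ζ z
  have hκ : IsTest κ := .ofReal ζ
  have hκη : ∀ᶠ z in 𝓝ˢ (tsupport η), κ z = 1 := hζ.mono fun z hz => by simp [κ, hz]
  obtain ⟨U, hU, hηU, hκU⟩ := (eventually_nhdsSet_iff_exists.1 hκη)
  obtain ⟨δ, hδ, hδU⟩ := hη.compact.isCompact.exists_cthickening_subset_open hU hηU
  have htest : IsTest fun r : (E × E) × E => shiftedProduct κ η F r.1 r.2 :=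
    ⟨(hκ.smooth.comp contDiff_snd).mul
      ((hη.smooth.comp (by fun_prop)).mul (hF.smooth.comp (by fun_prop))),
      hasCompactSupport_uncurry_shiftedProduct hκ.compact hη.compact hF.compact⟩
  have hlim := hΘ.tendsto_integral_mul (htest.partialPair g).continuous
  have hzero : (pair g fun z => η z * F z)
      = partialPair g (fun r : (E × E) × E => shiftedProduct κ η F r.1 r.2) 0 := by
    refine congrArg (pair g) (funext fun z => ?_)
    by_cases hz : z ∈ tsupport η
    · simp [shiftedProduct, hκU z (hηU hz)]
    · simp [shiftedProduct, image_eq_zero_of_notMem_tsupport hz]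
  rw [hzero]
  refine hlim.congr' ?_
  filter_upwards [hΘ.shrinking δ hδ] with n hn
  simp only [mul_comm _ ((Θ n _ : ℝ) : ℂ)]
  rw [integral_mul_partialPair g (IsTest.ofReal (Θ n)).continuous htest]
  refine congrArg (pair g) (funext fun z => ?_)
  simp only [mul_comm ((Θ n _ : ℝ) : ℂ), ← mul_smear_eq κ hη hF.continuous]
  by_cases hz : z ∈ tsupport (smear η F (Θ n))
  · rw [hκU z (hδU (tsupport_smear_subset hη hF.continuous hn hz)), one_mul]
  · rw [image_eq_zero_of_notMem_tsupport hz, mul_zero]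

end Diagonal

section LocalProduct

variable {E : Type} [NormedAddCommGroup E] [NormedSpace ℝ E] [FiniteDimensional ℝ E]
  [MeasureSpace E] [BorelSpace E] [(volume : Measure E).IsAddHaarMeasure]

/-- The product of `f` and `g` exists after multiplication by the cutoff `χ`. -/
def HasLocalProduct (f g : Distr E) (χ : Test E) : Prop :=
  ∃ T : Distr E, ∀ Θ : ℕ → Test (E × E), IsDeltaSeq Θ → ∀ ψ : Test E,
    Tendsto (fun n => ∫ x, (χ x : ℂ) * ψ x * regularize (tensor f g) (Θ n) (x, x)) atTop
      (𝓝 (T ψ))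

variable {f g : Distr E} {U : Set E} {χ : Test E}

theorem hasLocalProduct_of_smooth_left {F : E → ℂ} (hF : IsTest F) (hU : IsOpen U)
    (hf : EqFunOn f F U) (hχU : tsupport χ ⊆ U) : HasLocalProduct f g χ := by
  obtain ⟨ε, hε, hεU⟩ := exists_cthickening_subset hU hχU
  obtain ⟨T, hT⟩ := exists_distr_pair_mul g ((IsTest.ofReal χ).mul_right hF.smooth)
  refine ⟨T, fun Θ hΘ ψ => ?_⟩
  have hη := IsTest.ofReal_mul_ofReal χ ψ
  simp only [hT, mul_right_comm _ (F _)]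
  refine (tendsto_pair_smear g hη hF hΘ).congr' ?_
  filter_upwards [hΘ.shrinking ε hε] with n hn
  exact (integral_mul_regularize_left g hη hF.continuous hf (hεU _) hn).symm

theorem hasLocalProduct_of_smooth_right {G : E → ℂ} (hG : IsTest G) (hU : IsOpen U)
    (hg : EqFunOn g G U) (hχU : tsupport χ ⊆ U) : HasLocalProduct f g χ := by
  obtain ⟨ε, hε, hεU⟩ := exists_cthickening_subset hU hχU
  obtain ⟨T, hT⟩ := exists_distr_pair_mul f ((IsTest.ofReal χ).mul_right hG.smooth)
  refine ⟨T, fun Θ hΘ ψ => ?_⟩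
  have hη := IsTest.ofReal_mul_ofReal χ ψ
  simp only [hT, mul_right_comm _ (G _)]
  refine (tendsto_pair_smear f hη hG hΘ.swap).congr' ?_
  filter_upwards [hΘ.shrinking ε hε] with n hn
  exact (integral_mul_regularize_right f hη hG.continuous hg (hεU _) hn).symm

theorem hasLocalProduct_of_approxAt {g' : Distr E} {F κ : E → ℂ} (hF : Continuous F)
    (hFc : HasCompactSupport F) {α A : ℝ} {n : ℕ} (hα : 0 < α)
    (hFA : ∀ x, ApproxAt α n A F x) (hκ : IsTest κ)
    (hsum : ∀ ρ : Test E, tsupport ρ ⊆ Metric.ball 0 1 → SummableKern α g' ρ)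
    (hU : IsOpen U) (hf : EqFunOn f F U)
    (hg : ∀ φ, IsTest φ → tsupport φ ⊆ U → pair g φ = pair g' fun z => κ z * φ z)
    (hχU : tsupport χ ⊆ U) : HasLocalProduct f g χ := by
  obtain ⟨ε, hε, hεU⟩ := exists_cthickening_subset hU hχU
  obtain ⟨T, hT⟩ := exists_distr_tendsto_smear hκ χ hU hχU hg hF hFc hα hFA hsum
  refine ⟨T, fun Θ hΘ ψ => (hT Θ hΘ ψ).congr' ?_⟩
  filter_upwards [hΘ.shrinking ε hε] with n hn
  exact (integral_mul_regularize_left g (.ofReal_mul_ofReal χ ψ) hF hf (hεU _) hn).symm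

end LocalProduct

section LocalData

variable {E : Type} [NormedAddCommGroup E] [NormedSpace ℝ E]

theorem isTest_ofReal_mul_of_contDiffOn {ζ : Test E} {F : E → ℂ} {U : Set E} (hU : IsOpen U)
    (hζU : tsupport ζ ⊆ U) (hF : ContDiffOn ℝ ∞ F U) : IsTest fun y => (ζ y : ℂ) * F y := by
  have hζ := IsTest.ofReal ζ
  refine ⟨contMDiff_iff_contDiff.1 (contMDiff_of_tsupport fun x hx => ?_), hζ.compact.mul_right⟩
  have hxU : x ∈ U := hζU (tsupport_comp_subset Complex.ofReal_zero ζ (tsupport_mul_subset_left hx))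
  exact (hζ.smooth.contDiffAt.mul (hF.contDiffAt (hU.mem_nhds hxU))).contMDiffAt

theorem exists_cutoff_nhds [FiniteDimensional ℝ E] {U : Set E} (hU : IsOpen U) {x : E}
    (hx : x ∈ U) :
    ∃ ζ : Test E, tsupport ζ ⊆ U ∧ ∃ V, IsOpen V ∧ x ∈ V ∧ V ⊆ U ∧ ∀ y ∈ V, ζ y = 1 := by
  obtain ⟨ζ, hζU, hζ⟩ := exists_cutoff isCompact_singleton hU (Set.singleton_subset_iff.2 hx)
  obtain ⟨V, hV, hVo, hxV⟩ := eventually_nhds_iff.1 (nhdsSet_singleton (x := x) ▸ hζ)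
  exact ⟨ζ, hζU, V ∩ U, hVo.inter hU, ⟨hxV, hx⟩, Set.inter_subset_right, fun y hy => hV y hy.1⟩

theorem exists_pair_eq_pair_localize [FiniteDimensional ℝ E] (f : Distr E) (φ : CTest E) {x : E}
    (hx : φ x ≠ 0) : ∃ κ : E → ℂ, IsTest κ ∧ ∃ U, IsOpen U ∧ x ∈ U ∧
      ∀ η, IsTest η → tsupport η ⊆ U → pair f η = pair (localize φ f) fun z => κ z * η z := by
  have hU : IsOpen {y | φ y ≠ 0} := isOpen_ne_fun φ.continuous continuous_const
  obtain ⟨ζ, hζU, V, hVo, hxV, hVU, hV⟩ := exists_cutoff_nhds hU hx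
  have hκ : IsTest fun y => (ζ y : ℂ) * (φ y)⁻¹ :=
    isTest_ofReal_mul_of_contDiffOn hU hζU (φ.contDiff.contDiffOn.inv fun _ hy => hy)
  refine ⟨_, hκ, V, hVo, hxV, fun η hη hηV => ?_⟩
  rw [pair_localize _ _ (hη.mul_left hκ.smooth)]
  congr 1 with y
  by_cases hy : y ∈ tsupport η
  · have hφy : φ y ≠ 0 := hVU (hηV hy)
    rw [hV y (hηV hy)]
    field_simp
    simp
  · simp [image_eq_zero_of_notMem_tsupport hy]

theorem exists_approxAt_of_taylor [ProperSpace E] {α : ℝ} (hα : 0 < α) {F : E → ℂ}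
    (hF : ContDiff ℝ ((⌈α⌉₊ - 1 : ℕ) : WithTop ℕ∞) F)
    (hT : ∀ K : Set E, IsCompact K → ∃ C : ℝ, ∀ x ∈ K, ∀ y ∈ K,
      ‖F y - ∑ j ∈ Finset.range ⌈α⌉₊,
        ((j.factorial : ℝ)⁻¹) • iteratedFDeriv ℝ j F x (fun _ => y - x)‖ ≤ C * ‖x - y‖ ^ α)
    {K : Set E} (hK : IsCompact K) : ∃ A, ∀ x ∈ K, ApproxAt α (⌈α⌉₊ - 1) A F x := by
  have hceil : ⌈α⌉₊ - 1 + 1 = ⌈α⌉₊ := Nat.sub_add_cancel (Nat.ceil_pos.2 hα)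
  obtain ⟨C, hC⟩ := hT _ (hK.cthickening (r := 1))
  have hcont : Continuous fun x => ∑ j ∈ Finset.range ⌈α⌉₊, ‖iteratedFDeriv ℝ j F x‖ := by
    refine continuous_finsetSum _ fun j hj => (hF.continuous_iteratedFDeriv ?_).norm
    exact_mod_cast Nat.le_sub_one_of_lt (Finset.mem_range.1 hj)
  obtain ⟨S, hS⟩ := hK.exists_bound_of_continuousOn hcont.continuousOn
  refine ⟨S + |C|, fun x hx => ⟨_, isRayPoly_sum (⌈α⌉₊ - 1) (fun j => (j.factorial : ℝ)⁻¹)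
    fun j => iteratedFDeriv ℝ j F x, fun w hw => ?_, fun w hw => ?_⟩⟩ <;> rw [hceil]
  · calc _ ≤ ∑ j ∈ Finset.range ⌈α⌉₊, ‖iteratedFDeriv ℝ j F x‖ := norm_sum_le_of_le _ fun j _ =>
          norm_inv_factorial_smul_apply_le _ hw
      _ ≤ S := (le_abs_self _).trans (hS x hx)
      _ ≤ S + |C| := le_add_of_nonneg_right (abs_nonneg C)
  · have hxw := hC x (Metric.self_subset_cthickening K hx) (x + w)
      (Metric.mem_cthickening_of_dist_le _ x _ _ hx (by simpa using hw))
    simp only [add_sub_cancel_left, sub_add_cancel_left, norm_neg] at hxw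
    have hS0 : 0 ≤ S := (norm_nonneg _).trans (hS x hx)
    exact hxw.trans (by gcongr; linarith [le_abs_self C])

variable {d : ℕ} {f : Distr (Rd d)} {x : Rd d}

theorem exists_eqFunOn_of_notMem_singSupp (hx : x ∉ singSupp f) :
    ∃ F : Rd d → ℂ, IsTest F ∧ ∃ U, IsOpen U ∧ x ∈ U ∧ EqFunOn f F U := by
  simp only [singSupp, Set.mem_ofPred_eq, not_not] at hx
  obtain ⟨U, hU, hxU, F, hF, hf⟩ := hx
  obtain ⟨ζ, hζU, V, hVo, hxV, hVU, hV⟩ := exists_cutoff_nhds hU hxU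
  have hζF := isTest_ofReal_mul_of_contDiffOn hU hζU hF
  refine ⟨_, hζF, V, hVo, hxV, fun φ hφ hφV => ?_⟩
  refine pair_eq_integral_of_forall hζF.continuous hφ fun ψ hψ => ?_
  rw [hf ψ ((hψ.trans hφV).trans hVU)]
  congr 1 with y
  by_cases hy : y ∈ tsupport ψ
  · simp [hV y (hφV (hψ hy))]
  · simp [image_eq_zero_of_notMem_tsupport hy]

theorem exists_eqFunOn_of_memHolderPosLoc {φ : CTest (Rd d)} (hx : φ x ≠ 0) {α : ℝ} (hα : 0 < α)
    (h : MemHolderPosLoc α (localize φ f)) :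
    ∃ F : Rd d → ℂ, Continuous F ∧ HasCompactSupport F ∧
      (∃ (n : ℕ) (A : ℝ), ∀ y, ApproxAt α n A F y) ∧ ∃ U, IsOpen U ∧ x ∈ U ∧ EqFunOn f F U := by
  obtain ⟨F, hF, hT, hf⟩ := h
  obtain ⟨κ, hκ, U, hU, hxU, hκf⟩ := exists_pair_eq_pair_localize f φ hx
  obtain ⟨A, hA⟩ := hκ.exists_approxAt_mul (m := ⌈α⌉₊) hα
    ((Nat.le_ceil α).trans (le_add_of_nonneg_right zero_le_one))
    fun K hK => exists_approxAt_of_taylor hα hF hT hK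
  refine ⟨fun y => κ y * F y, hκ.continuous.mul hF.continuous, hκ.compact.mul_right,
    ⟨_, A, hA⟩, U, hU, hxU, fun η hη hηU => ?_⟩
  rw [hκf η hη hηU, pair_eq_integral_of_forall hF.continuous (hη.mul_left hκ.smooth)
    fun ψ _ => hf ψ]
  congr 1 with y
  ring

end LocalData

section DyadicDiff

variable {E : Type} [NormedAddCommGroup E] [NormedSpace ℝ E]

/-- The difference of two consecutive dyadic rescalings of a kernel. Its integral vanishes, so it
is admissible in the definition of the Besov spaces of exponent `0`. -/
def dyadicDiff (ρ : Test E) : Test E where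
  toFun w := ((1 / 2 : ℝ) ^ Module.finrank ℝ E)⁻¹ * ρ ((1 / 2 : ℝ)⁻¹ • w) - ρ w
  contDiff' := (contDiff_const.mul (ρ.contDiff.comp (contDiff_id.const_smul _))).sub ρ.contDiff
  hasCompactSupport' := ((ρ.hasCompactSupport.comp_homeomorph
    (Homeomorph.smulOfNeZero (1 / 2 : ℝ)⁻¹ (by norm_num))).mul_left).sub ρ.hasCompactSupport
  tsupport_subset' := fun _ _ => trivial

theorem dyadicDiff_apply (ρ : Test E) (w : E) : dyadicDiff ρ w =
    ((1 / 2 : ℝ) ^ Module.finrank ℝ E)⁻¹ * ρ ((1 / 2 : ℝ)⁻¹ • w) - ρ w := rfl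

theorem tsupport_dyadicDiff_subset {ρ : Test E} (hρ : tsupport ρ ⊆ Metric.ball 0 1) :
    tsupport (dyadicDiff ρ) ⊆ Metric.ball 0 1 := by
  refine (tsupport_sub _ _).trans (Set.union_subset (tsupport_mul_subset_right.trans ?_) hρ)
  have hpre := tsupport_comp_eq_preimage ρ
    (Homeomorph.smulOfNeZero (1 / 2 : ℝ)⁻¹ (by norm_num) (α := E))
  refine hpre.subset.trans fun w hw => ?_
  have hlt : ‖(1 / 2 : ℝ)⁻¹ • w‖ < 1 := by simpa using hρ hw
  rw [norm_smul] at hlt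
  norm_num at hlt
  rw [mem_ball_zero_iff]
  linarith [norm_nonneg w]

theorem kern_succ (g : Distr E) (ρ : Test E) (n : ℕ) (x : E) :
    kern g ρ (n + 1) x = kern g ρ n x + kern g (dyadicDiff ρ) n x := by
  simp only [kern]
  rw [← map_add]
  congr 1 with y
  rw [FunLike.coe_add, Pi.add_apply]
  simp only [rescale_apply, dyadicDiff_apply, smul_smul, pow_succ, mul_pow, mul_inv,
    mul_comm (1 / 2 : ℝ)⁻¹]
  ring

theorem kern_smul (g : Distr E) (c : ℝ) (ρ : Test E) (n : ℕ) (x : E) :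
    kern g (c • ρ) n x = c • kern g ρ n x := by
  simp only [kern]
  rw [← map_smul]
  congr 1 with y
  simp only [rescale_apply, FunLike.coe_smul, Pi.smul_apply, smul_eq_mul]
  ring

theorem integral_dyadicDiff [FiniteDimensional ℝ E] [MeasureSpace E] [BorelSpace E]
    [(volume : Measure E).IsAddHaarMeasure] (ρ : Test E) : ∫ w, dyadicDiff ρ w = 0 := by
  have hρ : Integrable ρ := ρ.continuous.integrable_of_hasCompactSupport ρ.hasCompactSupport
  simp only [dyadicDiff_apply]
  rw [integral_sub ((hρ.comp_smul (by norm_num)).const_mul _) hρ, integral_const_mul,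
    Measure.integral_comp_inv_smul_of_nonneg _ _ (by norm_num), smul_eq_mul,
    inv_mul_cancel_left₀ (by positivity), sub_self]

end DyadicDiff

section Besov

theorem integral_norm_le_of_eLpNorm_le {X F : Type*} [MeasurableSpace X] {μ : Measure X}
    [IsFiniteMeasure μ] [NormedAddCommGroup F] {p M : ℝ≥0∞} (hp : 1 ≤ p) {G : X → F}
    (hG : AEStronglyMeasurable G μ) (hM : M ≠ ⊤) (h : eLpNorm G p μ ≤ M) :
    ∫ x, ‖G x‖ ∂μ ≤ (M * μ Set.univ ^ (1 - 1 / p.toReal)).toReal := by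
  have hexp : 0 ≤ 1 - 1 / p.toReal := by
    rcases eq_or_ne p ⊤ with rfl | hpt
    · simp
    · have hp1 : 1 ≤ p.toReal := by simpa using ENNReal.toReal_mono hpt hp
      exact sub_nonneg.2 ((div_le_one (by linarith)).2 hp1)
  rw [integral_norm_eq_lintegral_enorm hG, ← eLpNorm_one_eq_lintegral_enorm]
  refine ENNReal.toReal_mono (ENNReal.mul_ne_top hM
    (ENNReal.rpow_ne_top_of_nonneg hexp (measure_ne_top μ _))) ?_
  calc eLpNorm G 1 μ ≤ eLpNorm G p μ * μ Set.univ ^ (1 - 1 / p.toReal) := by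
        simpa using eLpNorm_le_eLpNorm_mul_rpow_measure_univ hp hG
    _ ≤ M * μ Set.univ ^ (1 - 1 / p.toReal) := by gcongr

theorem two_rpow_natCast_mul (n : ℕ) (γ : ℝ) :
    (2 : ℝ) ^ ((n : ℝ) * γ) = (((1 / 2 : ℝ) ^ n) ^ γ)⁻¹ := by
  rw [Real.rpow_natCast_mul (by norm_num), ← Real.inv_rpow (by positivity), one_div, inv_pow,
    inv_inv]

variable {d : ℕ} {g : Distr (Rd d)} {ρ : Test (Rd d)} {B : Set (Test (Rd d))} {K : Set (Rd d)}
  {γ : ℝ} {p : ℝ≥0∞}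

theorem enorm_kern_le_scaleSup (hρ : ρ ∈ B) (n : ℕ) (x : Rd d) :
    ‖kern g ρ n x‖ₑ ≤ scaleSup g B n x :=
  le_iSup₂ (f := fun ψ (_ : ψ ∈ B) => ‖kern g ψ n x‖ₑ) ρ hρ

theorem scaleNorm_top_eq_iSup (γ : ℝ) (p : ℝ≥0∞) (g : Distr (Rd d)) (B : Set (Test (Rd d)))
    (K : Set (Rd d)) :
    scaleNorm γ p ⊤ g B K = ⨆ n : ℕ, eLpNorm
      (fun x => ENNReal.ofReal ((2 : ℝ) ^ ((n : ℝ) * γ)) * scaleSup g B n x) p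
      (volume.restrict K) := by
  simp only [scaleNorm, eLpNorm_exponent_top, eLpNormEssSup_count, enorm_eq_self]

theorem exists_smul_mem_unitTests (r : ℕ) (hρ : tsupport ρ ⊆ Metric.ball 0 1) :
    ∃ c : ℝ, 0 < c ∧ c • ρ ∈ unitTests d r := by
  obtain ⟨S, hS⟩ := (IsTest.ofReal ρ).exists_ckNormLE r
  have hS0 := hS.nonneg
  refine ⟨(S + 1)⁻¹, by positivity, ?_, fun k hk x => ?_⟩
  · exact (closure_mono (Function.support_const_smul_subset _ _)).trans hρ
  · have hsmul : iteratedFDeriv ℝ k (⇑((S + 1)⁻¹ • ρ)) x = (S + 1)⁻¹ • iteratedFDeriv ℝ k ρ x :=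
      iteratedFDeriv_const_smul_apply (ρ.contDiff.contDiffAt.of_le (mod_cast le_top))
    have hρS : ‖iteratedFDeriv ℝ k ρ x‖ ≤ S :=
      (Complex.ofRealLI.norm_iteratedFDeriv_comp_left ρ.contDiff.contDiffAt
        (mod_cast le_top)).symm.trans_le (hS k hk x)
    rw [hsmul, norm_smul, Real.norm_of_nonneg (by positivity), inv_mul_le_one₀ (by positivity)]
    linarith

theorem exists_integral_norm_kern_le_of_smul_mem (hp : 1 ≤ p) (hK : IsCompact K) {c : ℝ}
    (hc : 0 < c) (hρ : c • ρ ∈ B) (hg : scaleNorm γ p ⊤ g B K < ⊤) :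
    ∃ C : ℝ, ∀ n : ℕ, ∫ x in K, ‖kern g ρ n x‖ ≤ C * ((1 / 2 : ℝ) ^ n) ^ γ := by
  have : IsFiniteMeasure (volume.restrict K) := isFiniteMeasure_restrict.2 hK.measure_ne_top
  refine ⟨(scaleNorm γ p ⊤ g B K *
    volume.restrict K Set.univ ^ (1 - 1 / p.toReal)).toReal / c, fun n => ?_⟩
  set w : ℝ := 2 ^ ((n : ℝ) * γ)
  have hw : 0 < w := by positivity
  have hle (x : Rd d) :
      ‖w • kern g (c • ρ) n x‖ₑ ≤ ‖ENNReal.ofReal w * scaleSup g B n x‖ₑ := by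
    rw [enorm_smul, enorm_eq_self, Real.enorm_of_nonneg hw.le]
    gcongr
    exact enorm_kern_le_scaleSup hρ n x
  have hcont : Continuous fun x => w • kern g (c • ρ) n x := (continuous_kern g _ n).const_smul w
  have hint := integral_norm_le_of_eLpNorm_le hp hcont.aestronglyMeasurable hg.ne <|
    (eLpNorm_mono_enorm hle).trans <| (le_iSup _ n).trans_eq (scaleNorm_top_eq_iSup γ p g B K).symm
  simp only [kern_smul, norm_smul, Real.norm_of_nonneg hc.le, Real.norm_of_nonneg hw.le,
    integral_const_mul] at hint
  rw [div_mul_eq_mul_div, le_div_iff₀' hc, ← inv_inv (((1 / 2 : ℝ) ^ n) ^ γ),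
    ← two_rpow_natCast_mul, ← div_eq_mul_inv, le_div_iff₀' hw]
  exact hint

theorem MemBesovLoc.exists_integral_norm_kern_le_of_neg (h : MemBesovLoc γ p ⊤ g) (hγ : γ < 0)
    (hp : 1 ≤ p) (hρ : tsupport ρ ⊆ Metric.ball 0 1) (hK : IsCompact K) :
    ∃ C : ℝ, ∀ n : ℕ, ∫ x in K, ‖kern g ρ n x‖ ≤ C * ((1 / 2 : ℝ) ^ n) ^ γ := by
  obtain ⟨r, -, hg⟩ := h
  obtain ⟨c, hc, hcρ⟩ := exists_smul_mem_unitTests r hρ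
  exact exists_integral_norm_kern_le_of_smul_mem hp hK hc hcρ ((hg K hK).1 hγ)

theorem MemBesovLoc.exists_integral_norm_kern_le_of_eq_zero (h : MemBesovLoc 0 p ⊤ g) (hp : 1 ≤ p)
    (hρ : tsupport ρ ⊆ Metric.ball 0 1) (hK : IsCompact K) :
    ∃ C : ℝ, ∀ n : ℕ, ∫ x in K, ‖kern g ρ n x‖ ≤ C * (n + 1) := by
  obtain ⟨r, -, hg⟩ := h
  obtain ⟨c, hc, hcσ⟩ := exists_smul_mem_unitTests r (tsupport_dyadicDiff_subset hρ)
  have hmoments : c • dyadicDiff ρ ∈ unitTestsMoments d r ⌊(0 : ℝ)⌋₊ := by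
    refine ⟨hcσ, fun k hk => ?_⟩
    have hk0 : ∀ i, k i = 0 := by simpa using hk
    simp [hk0, integral_const_mul, integral_dyadicDiff]
  obtain ⟨C, hC⟩ := exists_integral_norm_kern_le_of_smul_mem hp hK hc hmoments
    (ENNReal.add_lt_top.1 ((hg K hK).2 le_rfl)).2
  simp only [Real.rpow_zero, mul_one] at hC
  have hint (σ : Test (Rd d)) (n : ℕ) : IntegrableOn (fun x => ‖kern g σ n x‖) K :=
    (continuous_kern g σ n).norm.continuousOn.integrableOn_compact hK
  have hsucc (n : ℕ) : ∫ x in K, ‖kern g ρ (n + 1) x‖ ≤ (∫ x in K, ‖kern g ρ n x‖) + C := by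
    refine le_trans ?_ (add_le_add_right (hC n) _)
    rw [← integral_add (hint _ _) (hint _ _)]
    refine integral_mono (hint _ _) ((hint _ _).add (hint _ _)) fun x => ?_
    rw [kern_succ]
    exact norm_add_le _ _
  refine ⟨max C (∫ x in K, ‖kern g ρ 0 x‖), fun n => ?_⟩
  induction n with
  | zero => simp
  | succ n ih =>
    have hmax := le_max_left C (∫ x in K, ‖kern g ρ 0 x‖)
    push_cast
    linarith [hsucc n]

theorem MemBesovLoc.exists_integral_norm_kern_le (h : MemBesovLoc γ p ⊤ g) (hγ : γ ≤ 0)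
    (hp : 1 ≤ p) (hρ : tsupport ρ ⊆ Metric.ball 0 1) (hK : IsCompact K) :
    ∃ C : ℝ, ∀ n : ℕ, ∫ x in K, ‖kern g ρ n x‖ ≤ C * (n + 1) * ((1 / 2 : ℝ) ^ n) ^ γ := by
  rcases hγ.lt_or_eq with hγ | rfl
  · obtain ⟨C, hC⟩ := h.exists_integral_norm_kern_le_of_neg hγ hp hρ hK
    have hC0 : 0 ≤ C := by simpa using (integral_nonneg fun _ => norm_nonneg _).trans (hC 0)
    refine ⟨C, fun n => (hC n).trans ?_⟩
    gcongr
    exact le_mul_of_one_le_right hC0 (by simp)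
  · simpa using h.exists_integral_norm_kern_le_of_eq_zero hp hρ hK

theorem MemBesovLoc.summableKern (h : MemBesovLoc γ p ⊤ g) (hγ : γ ≤ 0) (hp : 1 ≤ p) {α : ℝ}
    (hαγ : 0 < α + γ) (hρ : tsupport ρ ⊆ Metric.ball 0 1) : SummableKern α g ρ := by
  intro K hK
  obtain ⟨C, hC⟩ := h.exists_integral_norm_kern_le hγ hp hρ hK
  set q : ℝ := (1 / 2) ^ (α + γ)
  have hq : ‖q‖ < 1 := by
    rw [Real.norm_of_nonneg (by positivity)]
    exact Real.rpow_lt_one (by norm_num) (by norm_num) hαγ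
  have hsum : Summable fun n : ℕ => C * ((n : ℝ) ^ 1 * q ^ n + (n : ℝ) ^ 0 * q ^ n) :=
    ((summable_pow_mul_geometric_of_norm_lt_one 1 hq).add
      (summable_pow_mul_geometric_of_norm_lt_one 0 hq)).mul_left C
  refine Summable.of_nonneg_of_le (fun n => mul_nonneg (by positivity)
    (integral_nonneg fun _ => norm_nonneg _)) (fun n => ?_) hsum
  have hpow : q ^ n = ((1 / 2 : ℝ) ^ n) ^ α * ((1 / 2 : ℝ) ^ n) ^ γ := by
    rw [← Real.rpow_add (by positivity), Real.rpow_pow_comm (by norm_num)]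
  calc _ ≤ ((1 / 2 : ℝ) ^ n) ^ α * (C * (n + 1) * ((1 / 2 : ℝ) ^ n) ^ γ) := by
        gcongr; exact hC n
    _ = _ := by rw [hpow]; ring

theorem MemHolderNegLoc.memBesovLoc {β : ℝ} (h : MemHolderNegLoc β g) (hβ : β < 0) :
    MemBesovLoc β ⊤ ⊤ g := by
  refine ⟨⌊-β⌋₊ + 1, by exact_mod_cast Nat.lt_floor_add_one (-β), fun K hK =>
    ⟨fun _ => ?_, fun hβ0 => absurd hβ0 hβ.not_ge⟩⟩
  obtain ⟨C, hC⟩ := h K hK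
  refine lt_of_le_of_lt (b := ENNReal.ofReal C) ?_ ENNReal.ofReal_lt_top
  rw [scaleNorm_top_eq_iSup]
  refine iSup_le fun n => eLpNorm_exponent_top.trans_le (eLpNormEssSup_le_of_ae_enorm_bound ?_)
  filter_upwards [ae_restrict_mem hK.measurableSet] with x hx
  have hsup : scaleSup g (unitTests d (⌊-β⌋₊ + 1)) n x
      ≤ ENNReal.ofReal (C * ((1 / 2 : ℝ) ^ n) ^ β) := by
    refine iSup₂_le fun ψ hψ => ?_
    rw [← ofReal_norm]
    exact ENNReal.ofReal_le_ofReal (hC x hx _ (by positivity)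
      (pow_le_one₀ (by norm_num) (by norm_num)) ψ hψ)
  rw [enorm_eq_self, two_rpow_natCast_mul]
  calc _ ≤ ENNReal.ofReal (((1 / 2 : ℝ) ^ n) ^ β)⁻¹ *
          ENNReal.ofReal (C * ((1 / 2 : ℝ) ^ n) ^ β) := by gcongr
    _ = ENNReal.ofReal C := by
        rw [← ENNReal.ofReal_mul (by positivity), mul_comm C,
          inv_mul_cancel_left₀ (by positivity)]

theorem exists_memBesovLoc_of_lt_betaStar {β s : ℝ} (h : MemHolderNegLoc β g) (hβ : β < 0)
    (hs : s < betaStar g) : ∃ γ ≤ 0, s < γ ∧ ∃ p, 2 ≤ p ∧ MemBesovLoc γ p ⊤ g := by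
  have hne : {γ : ℝ | γ ≤ 0 ∧ ∃ p : ℝ≥0∞, 2 ≤ p ∧ MemBesovLoc γ p ⊤ g}.Nonempty :=
    ⟨β, hβ.le, ⊤, le_top, h.memBesovLoc hβ⟩
  obtain ⟨γ, ⟨hγ, hmem⟩, hsγ⟩ := exists_lt_of_lt_csSup hne hs
  exact ⟨γ, hγ, hsγ, hmem⟩

end Besov

section Gluing

variable {E : Type} [NormedAddCommGroup E] [NormedSpace ℝ E]

theorem exists_distr_eq_of_forall_isCompact (L : Test E → ℂ)
    (h : ∀ K : Set E, IsCompact K → ∃ T : Distr E, ∀ ψ : Test E, tsupport ψ ⊆ K → L ψ = T ψ) :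
    ∃ T : Distr E, ∀ ψ, T ψ = L ψ := by
  refine ⟨mkDistr L (fun φ ψ => ?_) (fun c φ => ?_) fun K hK => ?_, mkDistr_apply L _ _ _⟩
  · obtain ⟨T, hT⟩ := h _ (φ.hasCompactSupport.isCompact.union ψ.hasCompactSupport.isCompact)
    rw [hT _ (tsupport_add φ ψ), hT φ Set.subset_union_left, hT ψ Set.subset_union_right, map_add]
  · obtain ⟨T, hT⟩ := h _ φ.hasCompactSupport.isCompact
    rw [hT _ (tsupport_smul_subset_right (fun _ => c) φ), hT φ le_rfl, map_smul]
  · obtain ⟨T, hT⟩ := h K hK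
    obtain ⟨N, C, hC, hb⟩ := exists_norm_apply_le T hK
    exact ⟨N, C, hC, fun φ hφ S hS => hT φ hφ ▸ hb φ hφ S hS⟩

theorem tsupport_tensorTest_subset {E' : Type} [NormedAddCommGroup E'] [NormedSpace ℝ E']
    (φ : Test E) (ψ : Test E') : tsupport (tensorTest φ ψ) ⊆ tsupport φ ×ˢ tsupport ψ := by
  refine closure_minimal (fun q hq => ?_) ((isClosed_tsupport φ).prod (isClosed_tsupport ψ))
  have hq : φ q.1 * ψ q.2 ≠ 0 := hq
  exact ⟨subset_tsupport _ (left_ne_zero_of_mul hq), subset_tsupport _ (right_ne_zero_of_mul hq)⟩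

theorem IsTest.integrable [MeasureSpace E] [OpensMeasurableSpace E]
    [IsFiniteMeasureOnCompacts (volume : Measure E)] {φ : E → ℂ} (h : IsTest φ) : Integrable φ :=
  h.continuous.integrable_of_hasCompactSupport h.compact

variable [FiniteDimensional ℝ E]

theorem IsTest.mul_regularize {η : E → ℂ} (hη : IsTest η) (u : Distr (E × E)) (Θ : Test (E × E)) :
    IsTest fun x => η x * regularize u Θ (x, x) := by
  have hkernel : IsTest fun r : E × (E × E) => η r.1 * (Θ ((r.1, r.1) - r.2) : ℂ) := by
    refine ⟨(hη.smooth.comp contDiff_fst).mul ((IsTest.ofReal Θ).smooth.comp (by fun_prop)), ?_⟩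
    refine HasCompactSupport.intro ((hη.compact.isCompact.prod
      Θ.hasCompactSupport.isCompact).image
        (f := fun r : E × (E × E) => (r.1, (r.1, r.1) - r.2)) (by fun_prop)) ?_
    rintro ⟨x, q⟩ hxq
    contrapose! hxq
    have hx : η x ≠ 0 := left_ne_zero_of_mul hxq
    have hq : Θ ((x, x) - q) ≠ 0 := Complex.ofReal_ne_zero.1 (right_ne_zero_of_mul hxq)
    exact ⟨(x, (x, x) - q), ⟨subset_tsupport _ hx, subset_tsupport _ hq⟩, by simp⟩
  convert hkernel.partialPair u using 2 with x
  have hreg : regularize u Θ (x, x) = pair u fun q => (Θ ((x, x) - q) : ℂ) :=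
    (pair_ofReal u (reflect Θ (x, x))).symm
  rw [hreg]
  exact (pair_const_mul u (.ofReal (reflect Θ (x, x))) (η x)).symm

variable [MeasureSpace E] {f g : Distr E} {χ χ₁ χ₂ : Test E}

theorem HasLocalProduct.zero : HasLocalProduct f g 0 :=
  ⟨0, fun Θ _ ψ => by simp⟩

theorem HasLocalProduct.mul (h : HasLocalProduct f g χ) {a : E → ℝ} (ha : ContDiff ℝ ∞ a) :
    HasLocalProduct f g (mulCLM a ha χ) := by
  obtain ⟨T, hT⟩ := h
  refine ⟨{ toLinearMap := T.toLinearMap ∘ₗ (mulCLM a ha).toLinearMap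
            cont := T.continuous.comp (mulCLM a ha).continuous },
    fun Θ hΘ ψ => (hT Θ hΘ (mulCLM a ha ψ)).congr fun n => ?_⟩
  congr 1 with x
  have hmul (φ : Test E) : mulCLM a ha φ x = φ x * a x := rfl
  simp only [hmul, Complex.ofReal_mul]
  ring

/-- The product of `f` and `g` exists near `x`: it exists after multiplication by any cutoff
supported in some neighbourhood of `x`. -/
def HasProductAt (f g : Distr E) (x : E) : Prop :=
  ∃ U ∈ 𝓝 x, ∀ χ : Test E, tsupport χ ⊆ U → HasLocalProduct f g χ

variable [BorelSpace E] [(volume : Measure E).IsAddHaarMeasure]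

theorem HasLocalProduct.add (h₁ : HasLocalProduct f g χ₁) (h₂ : HasLocalProduct f g χ₂) :
    HasLocalProduct f g (χ₁ + χ₂) := by
  obtain ⟨T₁, hT₁⟩ := h₁
  obtain ⟨T₂, hT₂⟩ := h₂
  refine ⟨T₁ + T₂, fun Θ hΘ ψ => ((hT₁ Θ hΘ ψ).add (hT₂ Θ hΘ ψ)).congr fun n => ?_⟩
  have hint (χ : Test E) := ((IsTest.ofReal_mul_ofReal χ ψ).mul_regularize (tensor f g)
    (Θ n)).integrable
  rw [← integral_add (hint χ₁) (hint χ₂)]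
  congr 1 with x
  simp only [FunLike.coe_add, Pi.add_apply, Complex.ofReal_add]
  ring

variable (E) in
theorem exists_isDeltaSeq_tensorTest :
    ∃ θ : ℕ → Test E, IsDeltaSeq fun n => tensorTest (θ n) (θ n) := by
  choose θ hθ hint hnonneg using fun n : ℕ => exists_bump (E := E) (Nat.one_div_pos_of_nat (n := n))
  have hone (n : ℕ) : ∫ q, tensorTest (θ n) (θ n) q = 1 :=
    (integral_prod_mul (μ := volume) (ν := volume) (θ n) (θ n)).trans (by rw [hint, one_mul])
  refine ⟨θ, hone, ⟨1, fun n => ?_⟩, fun ε hε => ?_⟩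
  · refine le_of_eq (Eq.trans ?_ (hone n))
    congr 1 with q
    exact Real.norm_of_nonneg (mul_nonneg (hnonneg n _) (hnonneg n _))
  · obtain ⟨N, hN⟩ := exists_nat_one_div_lt hε
    filter_upwards [eventually_ge_atTop N] with n hn
    have hball : Metric.ball (0 : E) (1 / (n + 1)) ⊆ Metric.ball 0 ε :=
      Metric.ball_subset_ball ((Nat.one_div_le_one_div hn).trans hN.le)
    exact (tsupport_tensorTest_subset _ _).trans
      ((Set.prod_mono ((hθ n).trans hball) ((hθ n).trans hball)).trans_eq
        (ball_prod_same (0 : E) (0 : E) ε))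

theorem exists_hasLocalProduct_of_isCompact (h : ∀ x, HasProductAt f g x) {K : Set E}
    (hK : IsCompact K) : ∃ χ : Test E, HasLocalProduct f g χ ∧ ∀ x ∈ K, χ x = 1 := by
  refine hK.induction_on (p := fun K => ∃ χ : Test E, HasLocalProduct f g χ ∧ ∀ x ∈ K, χ x = 1)
    ⟨0, .zero, fun _ hx => hx.elim⟩ ?mono ?union ?nhds
  case mono =>
    exact fun s t hst ⟨χ, hχ, hχt⟩ => ⟨χ, hχ, fun x hx => hχt x (hst hx)⟩
  case union =>
    rintro s t ⟨χ₁, h₁, hs⟩ ⟨χ₂, h₂, ht⟩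
    refine ⟨χ₁ + mulCLM (fun x => 1 - χ₁ x) (contDiff_const.sub χ₁.contDiff) χ₂,
      h₁.add (h₂.mul _), fun x hx => ?_⟩
    change χ₁ x + χ₂ x * (1 - χ₁ x) = 1
    rcases hx with hx | hx
    · rw [hs x hx]; ring
    · rw [ht x hx]; ring
  case nhds =>
    intro x _
    obtain ⟨U, hU, hUχ⟩ := h x
    obtain ⟨χ, hχU, V, hV, hxV, -, hχV⟩ :=
      exists_cutoff_nhds isOpen_interior (mem_interior_iff_mem_nhds.2 hU)
    exact ⟨V, mem_nhdsWithin_of_mem_nhds (hV.mem_nhds hxV), χ, hUχ χ (hχU.trans interior_subset),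
      hχV⟩

theorem exists_tendsto_regularize_of_isCompact (h : ∀ x, HasProductAt f g x) {K : Set E}
    (hK : IsCompact K) : ∃ T : Distr E, ∀ ψ : Test E, tsupport ψ ⊆ K →
      ∀ Θ : ℕ → Test (E × E), IsDeltaSeq Θ →
        Tendsto (fun n => ∫ x, (ψ x : ℂ) * regularize (tensor f g) (Θ n) (x, x)) atTop
          (𝓝 (T ψ)) := by
  obtain ⟨χ, ⟨T, hT⟩, hχ⟩ := exists_hasLocalProduct_of_isCompact h hK
  refine ⟨T, fun ψ hψ Θ hΘ => (hT Θ hΘ ψ).congr fun n => ?_⟩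
  congr 1 with x
  by_cases hx : x ∈ tsupport ψ
  · rw [hχ x (hψ hx), Complex.ofReal_one, one_mul]
  · simp [image_eq_zero_of_notMem_tsupport hx]

theorem exists_tendsto_regularize (h : ∀ x, HasProductAt f g x) :
    ∃ T : Distr E, ∀ Θ : ℕ → Test (E × E), IsDeltaSeq Θ → ∀ ψ : Test E,
      Tendsto (fun n => ∫ x, (ψ x : ℂ) * regularize (tensor f g) (Θ n) (x, x)) atTop
        (𝓝 (T ψ)) := by
  have hlim (ψ : Test E) : ∃ L : ℂ, ∀ Θ : ℕ → Test (E × E), IsDeltaSeq Θ →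
      Tendsto (fun n => ∫ x, (ψ x : ℂ) * regularize (tensor f g) (Θ n) (x, x)) atTop (𝓝 L) := by
    obtain ⟨T, hT⟩ := exists_tendsto_regularize_of_isCompact h ψ.hasCompactSupport.isCompact
    exact ⟨T ψ, hT ψ le_rfl⟩
  choose L hL using hlim
  obtain ⟨θ, hθ⟩ := exists_isDeltaSeq_tensorTest E
  obtain ⟨T, hT⟩ := exists_distr_eq_of_forall_isCompact L fun K hK => by
    obtain ⟨T, hT⟩ := exists_tendsto_regularize_of_isCompact h hK
    exact ⟨T, fun ψ hψ => tendsto_nhds_unique (hL ψ _ hθ) (hT ψ hψ _ hθ)⟩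
  exact ⟨T, fun Θ hΘ ψ => hT ψ ▸ hL ψ Θ hΘ⟩

end Gluing

section CanonicalProduct

variable {d : ℕ} {f g : Distr (Rd d)} {x : Rd d}

theorem hasProductAt_of_notMem_singSupp_left (g : Distr (Rd d)) (hx : x ∉ singSupp f) :
    HasProductAt f g x := by
  obtain ⟨F, hF, U, hU, hxU, hf⟩ := exists_eqFunOn_of_notMem_singSupp hx
  exact ⟨U, hU.mem_nhds hxU, fun _ => hasLocalProduct_of_smooth_left hF hU hf⟩

theorem hasProductAt_of_notMem_singSupp_right (f : Distr (Rd d)) (hx : x ∉ singSupp g) :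
    HasProductAt f g x := by
  obtain ⟨G, hG, U, hU, hxU, hg⟩ := exists_eqFunOn_of_notMem_singSupp hx
  exact ⟨U, hU.mem_nhds hxU, fun _ => hasLocalProduct_of_smooth_right hG hU hg⟩

theorem hasProductAt_of_memHolderPosLoc_of_memBesovLoc {φf φg : CTest (Rd d)} (hφf : φf x ≠ 0)
    (hφg : φg x ≠ 0) {α γ : ℝ} {p : ℝ≥0∞} (hα : 0 < α) (hγ : γ ≤ 0) (hp : 1 ≤ p)
    (hf : MemHolderPosLoc α (localize φf f)) (hg : MemBesovLoc γ p ⊤ (localize φg g))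
    (hαγ : 0 < α + γ) : HasProductAt f g x := by
  obtain ⟨F, hF, hFc, ⟨n, A, hA⟩, U, hU, hxU, hfU⟩ := exists_eqFunOn_of_memHolderPosLoc hφf hα hf
  obtain ⟨κ, hκ, V, hV, hxV, hgV⟩ := exists_pair_eq_pair_localize g φg hφg
  exact ⟨U ∩ V, (hU.inter hV).mem_nhds ⟨hxU, hxV⟩, fun χ hχ =>
    hasLocalProduct_of_approxAt hF hFc hα hA hκ (fun _ => hg.summableKern hγ hp hαγ)
      (hU.inter hV) (fun φ hφ hs => hfU φ hφ (hs.trans Set.inter_subset_left))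
      (fun φ hφ hs => hgV φ hφ (hs.trans Set.inter_subset_right)) hχ⟩

theorem regularize_tensorTest {u : Distr (Rd d × Rd d)} (hu : IsTensorProduct f g u)
    (θ : Test (Rd d)) (x : Rd d) :
    regularize u (tensorTest θ θ) (x, x) = f (reflect θ x) * g (reflect θ x) :=
  hu (reflect θ x) (reflect θ x)

theorem IsCanonicalProduct.unique {h₁ h₂ : Distr (Rd d)} (H₁ : IsCanonicalProduct f g h₁)
    (H₂ : IsCanonicalProduct f g h₂) : h₁ = h₂ := by
  obtain ⟨u₁, hu₁, hp₁⟩ := H₁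
  obtain ⟨u₂, hu₂, hp₂⟩ := H₂
  obtain ⟨θ, hθ⟩ := exists_isDeltaSeq_tensorTest (Rd d)
  ext ψ
  have hlim₁ := hp₁ _ hθ ψ
  have hlim₂ := hp₂ _ hθ ψ
  simp only [regularize_tensorTest hu₁] at hlim₁
  simp only [regularize_tensorTest hu₂] at hlim₂
  exact tendsto_nhds_unique hlim₁ hlim₂

theorem existsUnique_isCanonicalProduct (h : ∀ x, HasProductAt f g x) :
    ∃! h : Distr (Rd d), IsCanonicalProduct f g h := by
  obtain ⟨T, hT⟩ := exists_tendsto_regularize h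
  have hprod : IsCanonicalProduct f g T := ⟨_, isTensorProduct_tensor f g, hT⟩
  exact ⟨T, hprod, fun h' hh' => hh'.unique hprod⟩

end CanonicalProduct

end

end MicrolocalYoung

open MicrolocalYoung in
theorem theorem1p1_general (d : ℕ) (f g : Distr (Rd d))
    (hfg : ∀ x ∈ singSupp f ∩ singSupp g, ∃ φf φg : CTest (Rd d), φf x ≠ 0 ∧ φg x ≠ 0 ∧
      ∃ (α γ : ℝ) (p : ℝ≥0∞), 0 < α ∧ γ ≤ 0 ∧ 1 ≤ p ∧
        MemHolderPosLoc α (localize φf f) ∧ MemBesovLoc γ p ⊤ (localize φg g) ∧ 0 < α + γ) :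
    ∃! h : Distr (Rd d), IsCanonicalProduct f g h := by
  refine existsUnique_isCanonicalProduct fun x => ?_
  by_cases hxf : x ∈ singSupp f
  · by_cases hxg : x ∈ singSupp g
    · obtain ⟨φf, φg, hφf, hφg, α, γ, p, hα, hγ, hp, hf, hg, hαγ⟩ := hfg x ⟨hxf, hxg⟩
      exact hasProductAt_of_memHolderPosLoc_of_memBesovLoc hφf hφg hα hγ hp hf hg hαγ
    · exact hasProductAt_of_notMem_singSupp_right f hxg
  · exact hasProductAt_of_notMem_singSupp_left g hxf

open MicrolocalYoung in
theorem theorem1p1 (d : ℕ) (f g : Distr (Rd d))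
    (hfg : ∀ x ∈ singSupp f ∩ singSupp g, ∃ φf φg : CTest (Rd d), φf x ≠ 0 ∧ φg x ≠ 0 ∧
      ∃ α β : ℝ, 0 < α ∧ β < 0 ∧
        MemHolderPosCompact α (localize φf f) ∧ MemHolderNegCompact β (localize φg g) ∧
        0 < α + betaStar (localize φg g)) :
    ∃! h : Distr (Rd d), IsCanonicalProduct f g h := by
  refine theorem1p1_general d f g fun x hx => ?_
  obtain ⟨φf, φg, hφf, hφg, α, β, hα, hβ, ⟨hf, -⟩, ⟨hg, -⟩, hsum⟩ := hfg x hx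
  obtain ⟨γ, hγ, hαγ, p, hp, hgp⟩ :=
    exists_memBesovLoc_of_lt_betaStar hg hβ (neg_lt_iff_pos_add'.2 hsum)
  exact ⟨φf, φg, hφf, hφg, α, γ, p, hα, hγ, one_le_two.trans hp, hf, hgp,
    neg_lt_iff_pos_add'.1 hαγ⟩
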